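/- Let $V$ be a $6$-dimensional complex vector space, $\mathbb P(V)$ the projective space of $1$-dimensional subspaces $\ell\subset V$, fix an isomorphism $\mathrm{vol}\colon\wedge^6V\to\mathbb C$, and let $\sigma(\alpha,\beta)=\mathrm{vol}(\alpha\wedge\beta)$ be the resulting symplectic form on $\wedge^3V$. Let $F\subset\wedge^3V\otimes\mathcal O_{\mathbb P(V)}$ be the rank-$10$ Lagrangian subbundle with fibre $F_\ell=\mathrm{Im}(\ell\otimes\wedge^2(V/\ell)\hookrightarrow\wedge^3V)$. For a Lagrangian subspace $A\subset\wedge^3V$ and $i\ge 0$ let $D_i(A,F)\subset\mathbb P(V)$ be the following closed subscheme, with support $\{\ell:\dim(A\cap F_\ell)\ge i\}$: locally on $\mathbb P(V)$ choose transversal Lagrangian subspaces $L,L'\subset\wedge^3V$ such that $A$ and the $F_\ell$ are transversal to $L'$, write $A$ and $F$ as graphs of maps $q_A,q_F\colon L\to L'\cong L^\vee$; then $D_i(A,F)$ is defined by the vanishing of the $(11-i)\times(11-i)$-minors of the symmetric matrix of $q_A-q_F$ (the result does not depend on the choices). Let $Y_A$ be the zero-scheme of the determinant of the map $\lambda_A\colon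 F\to(\wedge^3V/A)\otimes\mathcal O_{\mathbb P(V)}$ induced by the inclusion of $F$ (so $Y_A=D_1(A,F)$), and let $W_A=D_2(A,F)$. **Proposition.** Let $A\subset\wedge^3V$ be a Lagrangian subspace such that $\dim(A\cap F_\ell)\le 2$ for all $\ell\in\mathbb P(V)$. The following statements are equivalent. 1. $A$ contains no nonzero completely decomposable element $v_0\wedge v_1\wedge v_2$. 2. For every $i\ge 0$ the scheme $D_i(A,F)\setminus D_{i+1}(A,F)$ is smooth, of codimension $i(i+1)/2$ in $\mathbb P(V)$ at each of its points. 3. $Y_A\setminus W_A$ is smooth, and for every $\ell_0\in W_A$ there are a subset $U\subset\mathbb P(V)$, open in the analytic topology and containing $\ell_0$, and holomorphic functions $x,y,z$ on $U$ that vanish at $\ell_0$, with $dx(\ell_0),dy(\ell_0),dz(\ell_0)$ linearly independent, such that $Y_A\cap U=V(xz-y^2)$ as analytic subspaces of $U$. -/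

import Mathlib

open scoped LinearAlgebra.Projectivization Topology

noncomputable section

namespace EPW

/-! ### The symplectic space of trivectors and the Lagrangian bundle `F` -/

section Linear

variable {V : Type*} [AddCommGroup V] [Module ℂ V]

/-- The wedge product `⋀³V × ⋀³V → ⋀⁶V`. -/
def wedge33 : ⋀[ℂ]^3 V →ₗ[ℂ] ⋀[ℂ]^3 V →ₗ[ℂ] ⋀[ℂ]^6 V :=
  LinearMap.mk₂ ℂ
    (fun α β => ⟨(α : ExteriorAlgebra ℂ V) * β, by
      have h := Submodule.mul_mem_mul α.2 β.2
      rwa [← pow_add] at h⟩)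
    (fun _ _ _ => Subtype.ext (add_mul _ _ _))
    (fun _ _ _ => Subtype.ext (smul_mul_assoc _ _ _))
    (fun _ _ _ => Subtype.ext (mul_add _ _ _))
    (fun _ _ _ => Subtype.ext (mul_smul_comm _ _ _))

/-- The wedge product `V × ⋀²V → ⋀³V`. -/
def wedge12 : V →ₗ[ℂ] ⋀[ℂ]^2 V →ₗ[ℂ] ⋀[ℂ]^3 V :=
  LinearMap.mk₂ ℂ
    (fun v ω => ⟨ExteriorAlgebra.ι ℂ v * (ω : ExteriorAlgebra ℂ V), by
      have h := Submodule.mul_mem_mul (LinearMap.mem_range_self (ExteriorAlgebra.ι ℂ) v) ω.2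
      rwa [← pow_succ'] at h⟩)
    (fun _ _ _ => Subtype.ext (by simp [add_mul]))
    (fun _ _ _ => Subtype.ext (by simp))
    (fun _ _ _ => Subtype.ext (by simp [mul_add]))
    (fun _ _ _ => Subtype.ext (by simp))

/-- The symplectic form `σ(α, β) = vol(α ∧ β)` on `⋀³V`. -/
def symp (vol : ⋀[ℂ]^6 V ≃ₗ[ℂ] ℂ) : LinearMap.BilinForm ℂ (⋀[ℂ]^3 V) :=
  wedge33.compr₂ vol.toLinearMap

/-- A subspace of a symplectic space `(W, σ)` is Lagrangian if it is its own `σ`-orthogonal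
complement. -/
def IsLagrangian {W : Type*} [AddCommGroup W] [Module ℂ W] (σ : LinearMap.BilinForm ℂ W)
    (A : Submodule ℂ W) : Prop :=
  A.orthogonalBilin σ = A

/-- The fibre `F_ℓ`, the image of `ℓ ⊗ ⋀²(V/ℓ)` (equivalently of `ℓ ⊗ ⋀²V`) in `⋀³V`. -/
def F (ℓ : ℙ ℂ V) : Submodule ℂ (⋀[ℂ]^3 V) :=
  Submodule.map₂ wedge12 ℓ.submodule ⊤

/-- `LG(⋀³V)`: the Lagrangian subspaces of `⋀³V`. -/
def LG (vol : ⋀[ℂ]^6 V ≃ₗ[ℂ] ℂ) : Set (Submodule ℂ (⋀[ℂ]^3 V)) :=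
  {A | IsLagrangian (symp vol) A}

/-- `LG(⋀³V)^×`: the Lagrangian `A` with `dim (A ∩ F_ℓ) ≤ 2` for all `ℓ`. -/
def LGtimes (vol : ⋀[ℂ]^6 V ≃ₗ[ℂ] ℂ) : Set (Submodule ℂ (⋀[ℂ]^3 V)) :=
  {A | A ∈ LG vol ∧ ∀ ℓ : ℙ ℂ V, Module.finrank ℂ ↥(A ⊓ F ℓ) ≤ 2}

/-- `LG(⋀³V)^0`: those `A` in `LG(⋀³V)^×` that contain no nonzero completely decomposable
element `v₀ ∧ v₁ ∧ v₂`. -/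
def LGzero (vol : ⋀[ℂ]^6 V ≃ₗ[ℂ] ℂ) : Set (Submodule ℂ (⋀[ℂ]^3 V)) :=
  {A | A ∈ LGtimes vol ∧
    ∀ v : Fin 3 → V, exteriorPower.ιMulti ℂ 3 v ∈ A → exteriorPower.ιMulti ℂ 3 v = 0}

end Linear

/-! ### Regular and holomorphic functions on `ℙ(V)` -/

section Functions

variable {V : Type*} [NormedAddCommGroup V] [NormedSpace ℂ V]

/-- The classical (analytic) topology of `ℙ(V)`, the quotient topology from `V ∖ {0}`. -/
instance projTopology : TopologicalSpace (ℙ ℂ V) :=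
  TopologicalSpace.coinduced (fun v : {v : V // v ≠ 0} => Projectivization.mk ℂ v.1 v.2)
    inferInstance

/-- The pull-back of a function on `ℙ(V)` along `V ∖ {0} → ℙ(V)`
(with the irrelevant value `0` at the origin). -/
def pull (f : ℙ ℂ V → ℂ) (v : V) : ℂ :=
  open Classical in if h : v = 0 then 0 else f (Projectivization.mk ℂ v h)

/-- The value at `v` of a polynomial in the linear forms on `V`. -/
def polyVal (p : MvPolynomial (Module.Dual ℂ V) ℂ) (v : V) : ℂ :=
  MvPolynomial.eval (fun φ : Module.Dual ℂ V => φ v) p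

/-- `f` is regular at `ℓ`: on a Zariski-open neighbourhood `{q ≠ 0}` of `ℓ` it is a quotient
`p / q` of homogeneous polynomials of the same degree. -/
def IsRegularAt (ℓ : ℙ ℂ V) (f : ℙ ℂ V → ℂ) : Prop :=
  ∃ (d : ℕ) (p q : MvPolynomial (Module.Dual ℂ V) ℂ), p.IsHomogeneous d ∧ q.IsHomogeneous d ∧
    polyVal q ℓ.rep ≠ 0 ∧
    ∀ m : ℙ ℂ V, polyVal q m.rep ≠ 0 → f m = polyVal p m.rep / polyVal q m.rep

/-- `f` is holomorphic at `ℓ`. Since `V ∖ {0} → ℙ(V)` is a holomorphic submersion, this may be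
tested on the pull-back. -/
def IsHolomorphicAt (ℓ : ℙ ℂ V) (f : ℙ ℂ V → ℂ) : Prop :=
  AnalyticAt ℂ (pull f) ℓ.rep

/-- The differential of `f` at `ℓ`, pulled back to `V`. Since `V ∖ {0} → ℙ(V)` is a submersion,
the cotangent space of `ℙ(V)` at `ℓ` embeds in the dual of `V` in this way. -/
def differential (ℓ : ℙ ℂ V) (f : ℙ ℂ V → ℂ) : V →L[ℂ] ℂ :=
  fderiv ℂ (pull f) ℓ.rep

/-- The ring of functions that are regular at `ℓ`. -/
def regularFunctions (ℓ : ℙ ℂ V) : Subring (ℙ ℂ V → ℂ) where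
  carrier := {f | IsRegularAt ℓ f}
  one_mem' := ⟨0, 1, 1, MvPolynomial.isHomogeneous_one _ _, MvPolynomial.isHomogeneous_one _ _,
    by simp [polyVal], by simp [polyVal]⟩
  zero_mem' := ⟨0, 0, 1, MvPolynomial.isHomogeneous_zero _ _ _,
    MvPolynomial.isHomogeneous_one _ _, by simp [polyVal], by simp [polyVal]⟩
  mul_mem' := by
    rintro f g ⟨d, p, q, hp, hq, h0, h⟩ ⟨d', p', q', hp', hq', h0', h'⟩
    refine ⟨d + d', p * p', q * q', hp.mul hp', hq.mul hq', ?_, ?_⟩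
    · simpa [polyVal] using And.intro h0 h0'
    · intro m hm
      have hm2 : polyVal q m.rep ≠ 0 ∧ polyVal q' m.rep ≠ 0 := by simpa [polyVal] using hm
      simp only [Pi.mul_apply, h m hm2.1, h' m hm2.2]
      simp [polyVal, div_mul_div_comm]
  add_mem' := by
    rintro f g ⟨d, p, q, hp, hq, h0, h⟩ ⟨d', p', q', hp', hq', h0', h'⟩
    refine ⟨d + d', p * q' + q * p', q * q', (hp.mul hq').add (hq.mul hp'), hq.mul hq', ?_, ?_⟩
    · simpa [polyVal] using And.intro h0 h0'
    · intro m hm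
      have hm2 : polyVal q m.rep ≠ 0 ∧ polyVal q' m.rep ≠ 0 := by simpa [polyVal] using hm
      simp only [Pi.add_apply, h m hm2.1, h' m hm2.2]
      rw [div_add_div _ _ hm2.1 hm2.2]
      simp [polyVal]
  neg_mem' := by
    rintro f ⟨d, p, q, hp, hq, h0, h⟩
    refine ⟨d, -p, q, hp.neg, hq, h0, ?_⟩
    intro m hm
    simp only [Pi.neg_apply, h m hm]
    simp [polyVal, neg_div]

/-- The ring of functions that are holomorphic at `ℓ`. -/
def holomorphicFunctions (ℓ : ℙ ℂ V) : Subring (ℙ ℂ V → ℂ) where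
  carrier := {f | IsHolomorphicAt ℓ f}
  one_mem' := by
    refine (analyticAt_const (v := (1 : ℂ))).congr ?_
    filter_upwards [isOpen_ne.mem_nhds ℓ.rep_nonzero] with v hv
    simp [pull, hv]
  zero_mem' := by
    refine (analyticAt_const (v := (0 : ℂ))).congr ?_
    filter_upwards with v
    simp [pull]
  mul_mem' := by
    intro f g hf hg
    refine (AnalyticAt.mul hf hg).congr ?_
    filter_upwards with v
    by_cases h : v = 0 <;> simp [pull, h]
  add_mem' := by
    intro f g hf hg
    refine (AnalyticAt.add hf hg).congr ?_
    filter_upwards with v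
    by_cases h : v = 0 <;> simp [pull, h]
  neg_mem' := by
    intro f hf
    refine (AnalyticAt.neg hf).congr ?_
    filter_upwards with v
    by_cases h : v = 0 <;> simp [pull, h]

/-- The algebraic local ring `𝒪_{ℙ(V),ℓ}`. A regular function is determined near `ℓ` by its
germ in the classical topology, so the local ring is realised as a ring of such germs. -/
def LocalRing (ℓ : ℙ ℂ V) : Subring ((𝓝 ℓ).Germ ℂ) :=
  (regularFunctions ℓ).map (Filter.Germ.coeRingHom (𝓝 ℓ))

/-- The ring of germs at `ℓ` of holomorphic functions on `ℙ(V)`. -/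
def AnLocalRing (ℓ : ℙ ℂ V) : Subring ((𝓝 ℓ).Germ ℂ) :=
  (holomorphicFunctions ℓ).map (Filter.Germ.coeRingHom (𝓝 ℓ))

/-- The ideal of the ring of germs `R` that is generated by the germs in `s`. -/
def idealGen {ℓ : ℙ ℂ V} (R : Subring ((𝓝 ℓ).Germ ℂ)) (s : Set ((𝓝 ℓ).Germ ℂ)) : Ideal R :=
  Ideal.span {f : R | (f : (𝓝 ℓ).Germ ℂ) ∈ s}

end Functions

/-! ### Closed subschemes of `ℙ(V)`, given by their ideals in all local rings -/

section Subschemes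

variable {V : Type*} [NormedAddCommGroup V] [NormedSpace ℂ V]

variable (V) in
/-- A closed subscheme of `ℙ(V)` is recorded by the stalks of its ideal sheaf
at the closed points. -/
abbrev StalkIdeals : Type _ := ∀ ℓ : ℙ ℂ V, Ideal (LocalRing ℓ)

/-- The closed points of a closed subscheme. -/
def StalkIdeals.supp (Z : StalkIdeals V) : Set (ℙ ℂ V) := {ℓ | Z ℓ ≠ ⊤}

/-- The closed subscheme `Z` is smooth at its point `ℓ`: its local ring there is regular. -/
def StalkIdeals.SmoothAt (Z : StalkIdeals V) (ℓ : ℙ ℂ V) : Prop :=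
  IsRegularLocalRing (LocalRing ℓ ⧸ Z ℓ)

/-- The closed subscheme `Z` has codimension `c` in `ℙ(V)` at its point `ℓ`. -/
def StalkIdeals.CodimAt (Z : StalkIdeals V) (ℓ : ℙ ℂ V) (c : ℕ) : Prop :=
  ringKrullDim (LocalRing ℓ) = ringKrullDim (LocalRing ℓ ⧸ Z ℓ) + c

/-- The stalk at `ℓ` of the ideal of holomorphic functions generated by the ideal of `Z`. -/
def StalkIdeals.an (Z : StalkIdeals V) (ℓ : ℙ ℂ V) : Ideal (AnLocalRing ℓ) :=
  idealGen (AnLocalRing ℓ) (Subtype.val '' (Z ℓ : Set (LocalRing ℓ)))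

end Subschemes

/-! ### The degeneracy loci `D_i(A, F)` and the hypersurface `Y_A` -/

section Degeneracy

variable {V : Type*} [NormedAddCommGroup V] [NormedSpace ℂ V]

/-- `E` is the graph of `q : L → L'`, where `L, L'` are subspaces of a vector space. -/
def IsGraph {W : Type*} [AddCommGroup W] [Module ℂ W] {L L' : Submodule ℂ W} (q : L →ₗ[ℂ] L')
    (E : Submodule ℂ W) : Prop :=
  E = LinearMap.range (L.subtype + L'.subtype ∘ₗ q)

/-- Let `A` be a Lagrangian subspace and `m ↦ E m` a family of Lagrangian subspaces of a
`20`-dimensional symplectic space `(W, σ)`, parametrized by `ℙ(V)`.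
A symplectic trivialization near `ℓ` by transversal Lagrangian subspaces `L, L'` of `W`
(with `L'` identified with the dual of `L` by `σ`) for which `A` and all `E m`, `m` near `ℓ`, are
transversal to `L'`, i.e. are graphs of maps `qA, qE m : L → L'`, together with a basis of `L`.
For `W = ⋀³V` and `E = F` such trivializations, constant in `m`, exist near every point, and they
suffice to define `D_i(A, F)`. -/
structure SympTriv {W : Type*} [AddCommGroup W] [Module ℂ W] (σ : LinearMap.BilinForm ℂ W)
    (A : Submodule ℂ W) (E : ℙ ℂ V → Submodule ℂ W) (ℓ : ℙ ℂ V) where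
  L : Submodule ℂ W
  L' : Submodule ℂ W
  lagrangian_L : IsLagrangian σ L
  lagrangian_L' : IsLagrangian σ L'
  isCompl : IsCompl L L'
  qA : L →ₗ[ℂ] L'
  qE : ℙ ℂ V → L →ₗ[ℂ] L'
  graph_A : IsGraph qA A
  graph_E : ∀ᶠ m in 𝓝 ℓ, IsGraph (qE m) (E m)
  b : Module.Basis (Fin 10) ℂ L

/-- The symmetric `10 × 10` matrix of `qA - qE` at the point `m`: its entries are the values of
the bilinear form `(β, β') ↦ σ((qA - qE m) β, β')` on the basis of `L`. -/
def SympTriv.matrix {W : Type*} [AddCommGroup W] [Module ℂ W] {σ : LinearMap.BilinForm ℂ W}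
    {A : Submodule ℂ W} {E : ℙ ℂ V → Submodule ℂ W} {ℓ : ℙ ℂ V}
    (T : SympTriv σ A E ℓ) (m : ℙ ℂ V) : Matrix (Fin 10) (Fin 10) ℂ :=
  Matrix.of fun j k => σ ((T.qA - T.qE m) (T.b j) : W) (T.b k : W)

/-- `D_i(A, F)`: near `ℓ` it is the closed subscheme defined by the vanishing of the
`(11 - i) × (11 - i)`-minors of `qA - qF`. All trivializations give the same ideal; the ideals
that they give are glued by taking all of them. -/
def D (vol : ⋀[ℂ]^6 V ≃ₗ[ℂ] ℂ) (A : Submodule ℂ (⋀[ℂ]^3 V)) (i : ℕ) : StalkIdeals V := fun ℓ =>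
  idealGen (LocalRing ℓ)
    {f | ∃ (T : SympTriv (symp vol) A F ℓ) (r s : Fin (11 - i) → Fin 10),
      f = ((fun m => ((T.matrix m).submatrix r s).det : ℙ ℂ V → ℂ) : (𝓝 ℓ).Germ ℂ)}

/-- `Y_A`: the zero-scheme of `det λ_A`, where `λ_A : F → (⋀³V / A) ⊗ 𝒪` is the inclusion of `F`
followed by the projection. Near `ℓ` the determinant is computed in a regular frame
`s₁, …, s₁₀` of `F` and a basis `e` of `⋀³V / A`; all choices give the same ideal. -/
def Y (A : Submodule ℂ (⋀[ℂ]^3 V)) : StalkIdeals V := fun ℓ =>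
  idealGen (LocalRing ℓ)
    {f | ∃ (s : Fin 10 → ℙ ℂ V → ⋀[ℂ]^3 V) (e : Module.Basis (Fin 10) ℂ (⋀[ℂ]^3 V ⧸ A)),
      (∀ (j : Fin 10) (φ : Module.Dual ℂ (⋀[ℂ]^3 V)), IsRegularAt ℓ fun m => φ (s j m)) ∧
      (∀ᶠ m in 𝓝 ℓ, LinearIndependent ℂ (fun j => s j m) ∧
        Submodule.span ℂ (Set.range fun j => s j m) = F m) ∧
      f = ((fun m => e.det fun j => A.mkQ (s j m) : ℙ ℂ V → ℂ) : (𝓝 ℓ).Germ ℂ)}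

/-- `W_A = D_2(A, F)`. -/
def W (vol : ⋀[ℂ]^6 V ≃ₗ[ℂ] ℂ) (A : Submodule ℂ (⋀[ℂ]^3 V)) : StalkIdeals V := D vol A 2

/-- Near `ℓ₀` the closed subscheme `Z` is, analytically, `V(xz - y²)`: there are an open
neighbourhood `U` of `ℓ₀` in the classical topology and holomorphic functions `x, y, z` on `U`
that vanish at `ℓ₀` and have linearly independent differentials there, such that
`Z ∩ U = V(xz - y²)` as analytic subspaces of `U`. -/
def IsLocallyCone (Z : StalkIdeals V) (ℓ₀ : ℙ ℂ V) : Prop :=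
  ∃ U : Set (ℙ ℂ V), IsOpen U ∧ ℓ₀ ∈ U ∧ ∃ x y z : ℙ ℂ V → ℂ,
    (∀ ℓ ∈ U, IsHolomorphicAt ℓ x ∧ IsHolomorphicAt ℓ y ∧ IsHolomorphicAt ℓ z) ∧
    x ℓ₀ = 0 ∧ y ℓ₀ = 0 ∧ z ℓ₀ = 0 ∧
    LinearIndependent ℂ ![differential ℓ₀ x, differential ℓ₀ y, differential ℓ₀ z] ∧
    ∀ ℓ ∈ U, Z.an ℓ = idealGen (AnLocalRing ℓ) {((x * z - y ^ 2 : ℙ ℂ V → ℂ) : (𝓝 ℓ).Germ ℂ)}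

end Degeneracy

end EPW

end

/-!
The proof is local: near a point `ℓ`, set `K = A ∩ F_ℓ` and `k = dim K`. The loci `D_i(A, F)` are
first rewritten in terms of the pairing `σ` between a regular frame of `F` and a basis of `A`
(`D_eq_minorsIdeal`), which removes the auxiliary Lagrangian subspaces `L`, `L'`; for `Y_A` this
is `Y_eq_minorsIdeal`. If frame and basis are adapted to `K` and normalised along a Lagrangian
complement of both `A` and `F_ℓ` (`exists_lagrangian_isCompl`), the matrix of the pairing is
symmetric and its lower right block is invertible at `ℓ` (`exists_local_matrix`). The Schur
complement of that block is a symmetric `k × k`-matrix `S` of regular functions that vanish at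
`ℓ`. Its entries generate the ideal of `D_k(A, F)`, its determinant that of `Y_A`, and the
differential of `S_{jl}` is `w ↦ σ(w ∧ η_j, ℓ ∧ η_l)`, where the `ℓ ∧ η_j` form a basis of `K`
(`exists_normal_form`).

What remains to be known about these differentials is linear algebra. For `k = 1`, the linear form
`w ↦ σ(w ∧ η, ℓ ∧ η)` vanishes exactly if `ℓ ∧ η` is decomposable
(`decomposable_of_symp_eq_zero`). For `k = 2`, the three linear forms are independent exactly if
`K` contains no nonzero decomposable trivector (`symp_products_independent`, `exists_relation`): a
linear relation between them can be factored as a binary quadratic form, so that in a new basis of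
`K` a square or the mixed product vanishes; in the second case the squares are proportional
(`symp_self_proportional`), and some element of `K` has square zero. The Jacobian criterion in the
local ring of `ℙ(V)`, a localization of a polynomial ring (`nonempty_localization_equiv`,
`regular_quotient_iff`), turns this into the equivalence of smoothness of the strata and the
absence of decomposable trivectors (`smooth_stratum_iff`).

If `A` contains no decomposable trivectors, the entries of `S` at a point of `W_A` are coordinates
`x`, `y`, `z` in which `Y_A` is `xz - y²`. For the converse, at a point of `W_A` the quadratic
leading terms of two equations of `Y_A` are compared, and a quadratic form of rank three is not
one in two variables (`differential_quadratic`, `linearIndependent_of_quadratic`). At a point of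
`Y_A ∖ W_A` with `K` decomposable, the equation of `Y_A` has no linear term; smoothness then
forces it to be zero (`eq_zero_of_isRegularLocalRing_quotient`), so that `Y_A` is the whole space
(`Y_eq_bot_of_eventually`); it is nowhere a cone, so all `A ∩ F_m` are lines spanned by
decomposable trivectors. A second such trivector, taken over a point outside the three-dimensional
subspace of a first one, is not proportional to it. But the subspaces of the two meet, because `A`
is isotropic, and `A ∩ F_m` contains both trivectors for `m` in the intersection
(`exists_finrank_ne_one_or_noDecomposable`).
-/

noncomputable section

namespace EPW

/-! ### The volume form and the symplectic form -/

section Symplectic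

open exteriorPower Module

variable {V : Type*} [AddCommGroup V] [Module ℂ V] (vol : ⋀[ℂ]^6 V ≃ₗ[ℂ] ℂ)

/-- The volume form of `V`, as an alternating form in six vectors. -/
def volForm : V [⋀^Fin 6]→ₗ[ℂ] ℂ := vol.toLinearMap.compAlternatingMap (ιMulti ℂ 6)

lemma volForm_ne_zero : volForm vol ≠ 0 := by
  intro h
  have h1 : vol.toLinearMap = 0 := by
    apply linearMap_ext
    change volForm vol = _
    rw [h]
    ext v
    simp
  have h2 := vol.apply_symm_apply 1
  have h3 : vol (vol.symm 1) = 0 := LinearMap.congr_fun h1 _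
  rw [h2] at h3
  exact one_ne_zero h3

lemma volForm_basis_ne_zero (e : Basis (Fin 6) ℂ V) : volForm vol e ≠ 0 := by
  rw [Ne, AlternatingMap.map_basis_eq_zero_iff]
  exact volForm_ne_zero vol

lemma volForm_ne_zero_of_linearIndependent (hV : finrank ℂ V = 6) {v : Fin 6 → V}
    (hv : LinearIndependent ℂ v) : volForm vol v ≠ 0 := by
  have := volForm_basis_ne_zero vol (basisOfLinearIndependentOfCardEqFinrank hv (by simp [hV]))
  rwa [coe_basisOfLinearIndependentOfCardEqFinrank] at this

lemma wedge12_ιMulti (v : V) (a : Fin 2 → V) :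
    wedge12 v (ιMulti ℂ 2 a) = ιMulti ℂ 3 (Matrix.vecCons v a) := by
  apply Subtype.ext
  simp [wedge12, ExteriorAlgebra.ιMulti_succ_apply]

lemma symp_ιMulti (a b : Fin 3 → V) :
    symp vol (ιMulti ℂ 3 a) (ιMulti ℂ 3 b) = volForm vol ![a 0, a 1, a 2, b 0, b 1, b 2] := by
  have h : wedge33 (ιMulti ℂ 3 a) (ιMulti ℂ 3 b) =
      ιMulti ℂ 6 ![a 0, a 1, a 2, b 0, b 1, b 2] := by
    apply Subtype.ext
    simp [wedge33, ExteriorAlgebra.ιMulti_succ_apply, mul_assoc]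
    rfl
  simp [symp, volForm, h]

lemma symp_wedge12_ιMulti (w u : V) (a b : Fin 2 → V) :
    symp vol (wedge12 w (ιMulti ℂ 2 a)) (wedge12 u (ιMulti ℂ 2 b)) =
      volForm vol ![w, a 0, a 1, u, b 0, b 1] := by
  rw [wedge12_ιMulti, wedge12_ιMulti, symp_ιMulti]
  rfl

/-- Permuting the arguments of the volume form, with the sign left to be computed. -/
lemma volForm_comp_perm (v : Fin 6 → V) (τ : Equiv.Perm (Fin 6)) :
    volForm vol (v ∘ τ) = (Equiv.Perm.sign τ : ℤ) • volForm vol v := by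
  rw [AlternatingMap.map_perm]; rfl

lemma symp_swap (α β : ⋀[ℂ]^3 V) : symp vol α β = -symp vol β α := by
  have : symp vol = -(symp vol).flip := by
    apply linearMap_ext
    ext a : 1
    apply linearMap_ext
    ext b
    change symp vol (ιMulti ℂ 3 a) (ιMulti ℂ 3 b) = -symp vol (ιMulti ℂ 3 b) (ιMulti ℂ 3 a)
    rw [symp_ιMulti, symp_ιMulti]
    let τ : Equiv.Perm (Fin 6) := Equiv.swap 0 3 * Equiv.swap 1 4 * Equiv.swap 2 5
    have h := volForm_comp_perm vol ![a 0, a 1, a 2, b 0, b 1, b 2] τ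
    have hs : (Equiv.Perm.sign τ : ℤ) = -1 := by decide
    have hv : ![a 0, a 1, a 2, b 0, b 1, b 2] ∘ τ = ![b 0, b 1, b 2, a 0, a 1, a 2] := by
      funext i
      fin_cases i <;> rfl
    rw [hs, hv] at h
    rw [h]
    simp
  exact LinearMap.congr_fun₂ this α β

lemma symp_isRefl : (symp vol).IsRefl := fun α β h => by
  rw [symp_swap, h, neg_zero]

/-- In the basis of trivectors of a basis of `V`, the form pairs each basis vector with the one
of the complementary index set. -/
lemma repr_eq_zero_of_symp (e : Basis (Fin 6) ℂ V) (X : ⋀[ℂ]^3 V)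
    (s t : Set.powersetCard (Fin 6) 3) (hst : (t : Finset (Fin 6)) = (s : Finset (Fin 6))ᶜ)
    (h : symp vol X (e.exteriorPower 3 t) = 0) : (e.exteriorPower 3).repr X s = 0 := by
  have hd : Disjoint (s : Finset (Fin 6)) t := by rw [hst]; exact disjoint_compl_right
  have hX : X = ∑ u, (e.exteriorPower 3).repr X u • e.exteriorPower 3 u :=
    ((e.exteriorPower 3).sum_repr X).symm
  have hpair : ∀ u : Set.powersetCard (Fin 6) 3, u ≠ s →
      wedge33 (e.exteriorPower 3 u) (e.exteriorPower 3 t) = 0 := by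
    intro u hu
    apply Subtype.ext
    change (e.exteriorPower 3 u : ExteriorAlgebra ℂ V) * (e.exteriorPower 3 t) = 0
    rw [← ExteriorAlgebra.basis_eq_coe_basis, ← ExteriorAlgebra.basis_eq_coe_basis]
    apply ExteriorAlgebra.basis_mul_of_not_disjoint
    intro hdis
    apply hu
    apply Subtype.ext
    have hsub : (u : Finset (Fin 6)) ⊆ s := by
      have := Finset.subset_compl_iff_disjoint_right.mpr hdis
      rwa [hst, compl_compl] at this
    have h1 : (u : Finset (Fin 6)).card = 3 := u.2
    have h2 : (s : Finset (Fin 6)).card = 3 := s.2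
    exact Finset.eq_of_subset_of_card_le hsub (by rw [h1, h2])
  have hne : wedge33 (e.exteriorPower 3 s) (e.exteriorPower 3 t) ≠ 0 := by
    intro h0
    have h1 : (e.exteriorPower 3 s : ExteriorAlgebra ℂ V) * (e.exteriorPower 3 t) = 0 :=
      congrArg Subtype.val h0
    rw [← ExteriorAlgebra.basis_eq_coe_basis, ← ExteriorAlgebra.basis_eq_coe_basis,
      ExteriorAlgebra.basis_mul_of_disjoint e s t hd, smul_eq_zero_iff_eq] at h1
    exact e.ExteriorAlgebra.ne_zero _ h1
  have h2 : wedge33 X (e.exteriorPower 3 t) = 0 := by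
    have : vol (wedge33 X (e.exteriorPower 3 t)) = 0 := h
    simpa using this
  rw [hX, map_sum, LinearMap.sum_apply, Finset.sum_eq_single s] at h2
  · rw [map_smul, LinearMap.smul_apply, smul_eq_zero] at h2
    exact h2.resolve_right hne
  · intro u _ hu
    rw [map_smul, LinearMap.smul_apply, hpair u hu, smul_zero]
  · simp

lemma exists_compl (s : Set.powersetCard (Fin 6) 3) :
    ∃ t : Set.powersetCard (Fin 6) 3, (t : Finset (Fin 6)) = (s : Finset (Fin 6))ᶜ :=
  ⟨⟨(s : Finset (Fin 6))ᶜ, by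
    have h2 : (s : Finset (Fin 6)).card = 3 := s.2
    change Finset.card _ = 3
    rw [Finset.card_compl, h2]; rfl⟩, rfl⟩

lemma symp_nondegenerate (hV : finrank ℂ V = 6) : (symp vol).Nondegenerate := by
  have : FiniteDimensional ℂ V := .of_finrank_pos (by omega)
  let e := finBasisOfFinrankEq ℂ V hV
  have hl : ∀ X, (∀ Y, symp vol X Y = 0) → X = 0 := by
    intro X hX
    apply (e.exteriorPower 3).repr.map_eq_zero_iff.mp
    ext s
    obtain ⟨t, ht⟩ := exists_compl s
    exact repr_eq_zero_of_symp vol e X s t ht (hX _)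
  exact ⟨hl, fun Y hY => hl Y fun X => by rw [symp_swap, hY, neg_zero]⟩

/-! ### The subspaces `F_ℓ` -/

lemma mem_F {ℓ : ℙ ℂ V} {X : ⋀[ℂ]^3 V} : X ∈ F ℓ ↔ ∃ η, wedge12 ℓ.rep η = X := by
  have : F ℓ = LinearMap.range (wedge12 ℓ.rep) := by
    apply le_antisymm
    · rw [F, Submodule.map₂_le]
      intro v hv η _
      rw [Projectivization.submodule_eq, Submodule.mem_span_singleton] at hv
      obtain ⟨c, rfl⟩ := hv
      exact ⟨c • η, by simp⟩
    · rintro _ ⟨η, rfl⟩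
      refine Submodule.apply_mem_map₂ _ ?_ trivial
      rw [Projectivization.submodule_eq]
      exact Submodule.mem_span_singleton_self _
  rw [this]; rfl

lemma wedge12_mem_F_mk {v : V} (hv : v ≠ 0) (η : ⋀[ℂ]^2 V) :
    wedge12 v η ∈ F (Projectivization.mk ℂ v hv) := by
  refine Submodule.apply_mem_map₂ _ ?_ trivial
  rw [Projectivization.submodule_mk]
  exact Submodule.mem_span_singleton_self _

lemma symp_wedge12_swap (u w : V) (η θ : ⋀[ℂ]^2 V) :
    symp vol (wedge12 u η) (wedge12 w θ) = -symp vol (wedge12 w η) (wedge12 u θ) := by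
  let f : V → V → ⋀[ℂ]^2 V →ₗ[ℂ] ⋀[ℂ]^2 V →ₗ[ℂ] ℂ := fun u w =>
    (symp vol).compl₁₂ (wedge12 u) (wedge12 w)
  have : f u w = - f w u := by
    apply linearMap_ext
    ext a : 1
    apply linearMap_ext
    ext b
    simp only [f, LinearMap.compAlternatingMap_apply, LinearMap.neg_apply,
      LinearMap.compl₁₂_apply, symp_wedge12_ιMulti]
    have h := volForm_comp_perm vol ![u, a 0, a 1, w, b 0, b 1] (Equiv.swap 0 3)
    have hs : (Equiv.Perm.sign (Equiv.swap (0 : Fin 6) 3) : ℤ) = -1 := by decide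
    have hv : ![u, a 0, a 1, w, b 0, b 1] ∘ Equiv.swap (0 : Fin 6) 3 =
        ![w, a 0, a 1, u, b 0, b 1] := by
      funext i
      fin_cases i <;> rfl
    rw [hs, hv] at h
    rw [h]
    simp
  exact LinearMap.congr_fun₂ this η θ

lemma symp_wedge12_self (u : V) (η θ : ⋀[ℂ]^2 V) :
    symp vol (wedge12 u η) (wedge12 u θ) = 0 := by
  have h := symp_wedge12_swap vol u u η θ
  exact self_eq_neg.mp h

lemma symp_wedge12_symm (w v : V) (η θ : ⋀[ℂ]^2 V) :
    symp vol (wedge12 w η) (wedge12 v θ) = symp vol (wedge12 w θ) (wedge12 v η) := by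
  rw [symp_wedge12_swap, symp_swap, neg_neg]

lemma exists_basis_zero_eq (hV : finrank ℂ V = 6) {v : V} (hv : v ≠ 0) :
    ∃ e : Basis (Fin 6) ℂ V, e 0 = v := by
  have : FiniteDimensional ℂ V := .of_finrank_pos (by omega)
  have hli : LinearIndepOn ℂ id ({v} : Set V) :=
    LinearIndepOn.singleton hv
  let b := Basis.extend hli
  have hvmem : v ∈ hli.extend (Set.subset_univ _) := hli.subset_extend _ rfl
  have : Fintype (hli.extend (Set.subset_univ _)) :=
    FiniteDimensional.fintypeBasisIndex b
  have hcard : Fintype.card (hli.extend (Set.subset_univ _)) = Fintype.card (Fin 6) := by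
    rw [← finrank_eq_card_basis b, hV]; rfl
  let g := Fintype.equivOfCardEq hcard
  let g' := g.trans (Equiv.swap (g ⟨v, hvmem⟩) 0)
  refine ⟨b.reindex g', ?_⟩
  have : g'.symm 0 = ⟨v, hvmem⟩ := by
    rw [Equiv.symm_apply_eq]; simp [g']
  rw [Basis.reindex_apply, this]
  simp [b]

lemma F_lagrangian (hV : finrank ℂ V = 6) (ℓ : ℙ ℂ V) : IsLagrangian (symp vol) (F ℓ) := by
  apply le_antisymm
  · intro X hX
    obtain ⟨e, he⟩ := exists_basis_zero_eq hV ℓ.rep_nonzero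
    have hmem : ∀ s : Set.powersetCard (Fin 6) 3, (0 : Fin 6) ∈ (s : Finset (Fin 6)) →
        e.exteriorPower 3 s ∈ F ℓ := by
      intro s hs
      rw [mem_F, ← he, exteriorPower.basis_apply, ιMulti_family]
      set g := Set.powersetCard.ofFinEmbEquiv.symm s
      have hg : g 0 = 0 := by
        have h0 : (0 : Fin 6) ∈ Set.range g :=
          (Set.powersetCard.mem_range_ofFinEmbEquiv_symm_iff_mem s 0).mpr hs
        obtain ⟨i, hi⟩ := h0
        have : g 0 ≤ g i := g.monotone (Fin.zero_le i)
        rw [hi] at this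
        exact Fin.le_zero_iff.mp this
      refine ⟨ιMulti ℂ 2 ![e (g 1), e (g 2)], ?_⟩
      rw [wedge12_ιMulti]
      congr 1
      funext i
      fin_cases i
      · simp [hg]
      · rfl
      · rfl
    rw [← (e.exteriorPower 3).sum_repr X]
    refine Submodule.sum_mem _ fun s _ => ?_
    by_cases hs : (0 : Fin 6) ∈ (s : Finset (Fin 6))
    · exact Submodule.smul_mem _ _ (hmem s hs)
    · obtain ⟨t, ht⟩ := exists_compl s
      have h0 : (0 : Fin 6) ∈ (t : Finset (Fin 6)) := by rw [ht]; simpa using hs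
      have := hX _ (hmem t h0)
      rw [repr_eq_zero_of_symp vol e X s t ht (symp_isRefl vol _ _ this), zero_smul]
      exact Submodule.zero_mem _
  · intro X hX Y hY
    obtain ⟨η, rfl⟩ := mem_F.mp hX
    obtain ⟨θ, rfl⟩ := mem_F.mp hY
    exact symp_wedge12_self vol _ _ _

lemma finrank_trivectors (hV : finrank ℂ V = 6) : finrank ℂ (⋀[ℂ]^3 V) = 20 := by
  have : FiniteDimensional ℂ V := .of_finrank_pos (by omega)
  rw [exteriorPower.finrank_eq, hV]; rfl

lemma IsLagrangian.finrank_eq (hV : finrank ℂ V = 6) {A : Submodule ℂ (⋀[ℂ]^3 V)}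
    (hA : IsLagrangian (symp vol) A) : finrank ℂ A = 10 := by
  have : FiniteDimensional ℂ V := .of_finrank_pos (by omega)
  have h := LinearMap.BilinForm.finrank_orthogonal (symp_nondegenerate vol hV) A
  have hA' : (symp vol).orthogonal A = A := hA
  rw [hA', finrank_trivectors hV] at h
  omega

end Symplectic

/-! ### Lagrangian complements -/

section Transversal

open Module

variable {W : Type*} [AddCommGroup W] [Module ℂ W]

/-- A maximal isotropic subspace among those that meet neither `A` nor `B` is Lagrangian: if `C` is
isotropic but not Lagrangian, then `(A ∩ Cᗮ) + C` and `(B ∩ Cᗮ) + C` are proper subspaces of `Cᗮ`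
and a vector of `Cᗮ` outside both can be added to `C`. -/
theorem exists_lagrangian_isCompl [FiniteDimensional ℂ W] {σ : LinearMap.BilinForm ℂ W}
    (hσ : σ.Nondegenerate) (halt : σ.IsAlt) {A B : Submodule ℂ W}
    (hA : IsLagrangian σ A) (hB : IsLagrangian σ B) :
    ∃ C : Submodule ℂ W, IsLagrangian σ C ∧ IsCompl A C ∧ IsCompl B C := by
  have hrefl : σ.IsRefl := halt.isRefl
  let S : Set (Submodule ℂ W) := {C | C ≤ σ.orthogonal C ∧ Disjoint A C ∧ Disjoint B C}
  have hS : S.Nonempty := ⟨⊥, bot_le, disjoint_bot_right, disjoint_bot_right⟩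
  obtain ⟨C, ⟨hC, hAC, hBC⟩, hmax⟩ := wellFounded_gt.has_min S hS
  have hdim : ∀ E : Submodule ℂ W, finrank ℂ (σ.orthogonal E) = finrank ℂ W - finrank ℂ E :=
    LinearMap.BilinForm.finrank_orthogonal hσ
  have hlag : ∀ E : Submodule ℂ W, IsLagrangian σ E → 2 * finrank ℂ E = finrank ℂ W := by
    intro E hE
    have h1 := hdim E
    have hE' : σ.orthogonal E = E := hE
    rw [hE'] at h1
    have := Submodule.finrank_le E
    omega
  have key : ∀ E : Submodule ℂ W, IsLagrangian σ E → Disjoint E C →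
      (E ⊓ σ.orthogonal C) ⊔ C = σ.orthogonal C → σ.orthogonal C = C := by
    intro E hE hEC h
    have horth : E ⊓ σ.orthogonal C = σ.orthogonal (E ⊔ C) := by
      have hE' : σ.orthogonal E = E := hE
      ext x
      constructor
      · rintro ⟨hx1, hx2⟩ y hy
        obtain ⟨a, ha, c, hc, rfl⟩ := Submodule.mem_sup.mp hy
        rw [← hE'] at hx1
        have h1 : σ a x = 0 := hx1 a ha
        have h2 : σ c x = 0 := hx2 c hc
        change σ (a + c) x = 0
        simp [h1, h2]
      · intro hx
        refine ⟨?_, fun c hc => hx c (Submodule.mem_sup_right hc)⟩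
        rw [← hE']
        exact fun a ha => hx a (Submodule.mem_sup_left ha)
    have h1 := Submodule.finrank_sup_add_finrank_inf_eq E C
    rw [hEC.eq_bot, finrank_bot] at h1
    have h2 := Submodule.finrank_sup_add_finrank_inf_eq (E ⊓ σ.orthogonal C) C
    have h3 : (E ⊓ σ.orthogonal C) ⊓ C = ⊥ := by
      rw [eq_bot_iff]
      exact (inf_le_inf_right C inf_le_left).trans hEC.le_bot
    rw [h3, finrank_bot, h, horth] at h2
    have h4 := hdim (E ⊔ C)
    have h5 := hdim C
    have h6 := hlag E hE
    have h7 := Submodule.finrank_le (E ⊔ C)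
    have h8 := Submodule.finrank_le C
    exact (Submodule.eq_of_le_of_finrank_le hC (by omega)).symm
  have hCL : IsLagrangian σ C := by
    by_contra hne
    have hA1 : (A ⊓ σ.orthogonal C) ⊔ C ≠ σ.orthogonal C := fun h => hne (key A hA hAC h)
    have hB1 : (B ⊓ σ.orthogonal C) ⊔ C ≠ σ.orthogonal C := fun h => hne (key B hB hBC h)
    have hlt : ∀ E : Submodule ℂ W, (E ⊓ σ.orthogonal C) ⊔ C ≠ σ.orthogonal C →
        ∃ x ∈ σ.orthogonal C, x ∉ (E ⊓ σ.orthogonal C) ⊔ C := by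
      intro E h
      by_contra! hcon
      exact h (le_antisymm (sup_le inf_le_right hC) hcon)
    obtain ⟨x, hx, hxA, hxB⟩ : ∃ x ∈ σ.orthogonal C,
        x ∉ (A ⊓ σ.orthogonal C) ⊔ C ∧ x ∉ (B ⊓ σ.orthogonal C) ⊔ C := by
      obtain ⟨x, hx, hxA⟩ := hlt A hA1
      obtain ⟨y, hy, hyB⟩ := hlt B hB1
      by_cases hxB : x ∈ (B ⊓ σ.orthogonal C) ⊔ C
      · by_cases hyA : y ∈ (A ⊓ σ.orthogonal C) ⊔ C
        · refine ⟨x + y, Submodule.add_mem _ hx hy, fun h => hxA ?_, fun h => hyB ?_⟩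
          · simpa using Submodule.sub_mem _ h hyA
          · simpa using Submodule.sub_mem _ h hxB
        · exact ⟨y, hy, hyA, hyB⟩
      · exact ⟨x, hx, hxA, hxB⟩
    have hxC : x ∉ C := fun h => hxA (Submodule.mem_sup_right h)
    have hdisj : ∀ E : Submodule ℂ W, Disjoint E C → x ∉ (E ⊓ σ.orthogonal C) ⊔ C →
        Disjoint E (C ⊔ Submodule.span ℂ {x}) := by
      intro E hEC hxE
      rw [Submodule.disjoint_def]
      intro y hyE hy
      obtain ⟨c, hc, z, hz, rfl⟩ := Submodule.mem_sup.mp hy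
      obtain ⟨t, rfl⟩ := Submodule.mem_span_singleton.mp hz
      by_cases ht : t = 0
      · subst ht
        rw [zero_smul, add_zero] at hyE ⊢
        exact Submodule.disjoint_def.mp hEC c hyE hc
      · exfalso
        apply hxE
        have : x = t⁻¹ • (c + t • x) - t⁻¹ • c := by
          rw [smul_add, smul_smul, inv_mul_cancel₀ ht]; simp
        rw [this]
        refine Submodule.sub_mem _ (Submodule.mem_sup_left (Submodule.smul_mem _ _ ⟨hyE, ?_⟩))
          (Submodule.mem_sup_right (Submodule.smul_mem _ _ hc))
        exact Submodule.add_mem _ (hC hc) (Submodule.smul_mem _ _ hx)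
    have hmem : C ⊔ Submodule.span ℂ {x} ∈ S := by
      refine ⟨?_, hdisj A hAC hxA, hdisj B hBC hxB⟩
      intro y hy z hz
      obtain ⟨c, hc, z1, hz1, rfl⟩ := Submodule.mem_sup.mp hy
      obtain ⟨t, rfl⟩ := Submodule.mem_span_singleton.mp hz1
      obtain ⟨d, hd, z2, hz2, rfl⟩ := Submodule.mem_sup.mp hz
      obtain ⟨r, rfl⟩ := Submodule.mem_span_singleton.mp hz2
      change σ (d + r • x) (c + t • x) = 0
      have h1 : σ d c = 0 := hC hc d hd
      have h2 : σ d x = 0 := hx d hd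
      have h3 : σ x c = 0 := hrefl _ _ (hx c hc)
      have h4 : σ x x = 0 := halt x
      simp [h1, h2, h3, h4]
    refine hmax _ hmem (lt_of_le_of_ne le_sup_left fun h => hxC ?_)
    rw [h]
    exact Submodule.mem_sup_right (Submodule.mem_span_singleton_self x)
  have hcompl : ∀ E : Submodule ℂ W, IsLagrangian σ E → Disjoint E C → IsCompl E C := by
    intro E hE hEC
    refine ⟨hEC, codisjoint_iff.mpr (Submodule.eq_top_of_finrank_eq ?_)⟩
    have h1 := Submodule.finrank_sup_add_finrank_inf_eq E C
    rw [hEC.eq_bot, finrank_bot] at h1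
    have h2 := hlag E hE
    have h3 := hlag C hCL
    omega
  exact ⟨C, hCL, hcompl A hA hAC, hcompl B hB hBC⟩

end Transversal

/-! ### Trivectors divisible by a vector -/

section Decomposable

open exteriorPower Module

variable {V : Type*} [AddCommGroup V] [Module ℂ V]

/-- The wedge product `V × V → ⋀²V`. -/
def wedge11 : V →ₗ[ℂ] V →ₗ[ℂ] ⋀[ℂ]^2 V :=
  LinearMap.mk₂ ℂ (fun x y => ιMulti ℂ 2 ![x, y])
    (fun _ _ _ => Subtype.ext (by simp [ExteriorAlgebra.ιMulti_succ_apply, add_mul]))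
    (fun _ _ _ => Subtype.ext (by simp [ExteriorAlgebra.ιMulti_succ_apply]))
    (fun _ _ _ => Subtype.ext (by simp [ExteriorAlgebra.ιMulti_succ_apply, mul_add]))
    (fun _ _ _ => Subtype.ext (by simp [ExteriorAlgebra.ιMulti_succ_apply]))

lemma wedge11_apply (x y : V) : wedge11 x y = ιMulti ℂ 2 ![x, y] := rfl

lemma wedge11_self (x : V) : wedge11 x x = 0 := by
  apply Subtype.ext
  simp [wedge11_apply, ExteriorAlgebra.ιMulti_succ_apply]

lemma wedge11_swap (x y : V) : wedge11 x y = -wedge11 y x := by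
  have h := wedge11_self (x + y)
  simp only [map_add, LinearMap.add_apply, wedge11_self, zero_add, add_zero] at h
  exact eq_neg_of_add_eq_zero_right h

lemma wedge12_wedge11 (v x y : V) : wedge12 v (wedge11 x y) = ιMulti ℂ 3 ![v, x, y] := by
  rw [wedge11_apply, wedge12_ιMulti]

lemma wedge12_wedge11_self_left (v y : V) : wedge12 v (wedge11 v y) = 0 := by
  rw [wedge12_wedge11]
  exact AlternatingMap.map_eq_zero_of_eq _ (i := 0) (j := 1) _ rfl (by decide)

lemma wedge12_wedge11_self_right (v y : V) : wedge12 v (wedge11 y v) = 0 := by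
  rw [wedge11_swap, map_neg, wedge12_wedge11_self_left, neg_zero]

lemma symp_wedge11 (vol : ⋀[ℂ]^6 V ≃ₗ[ℂ] ℂ) (w u x y x' y' : V) :
    symp vol (wedge12 w (wedge11 x y)) (wedge12 u (wedge11 x' y')) =
      volForm vol ![w, x, y, u, x', y'] := by
  rw [wedge11_apply, wedge11_apply, symp_wedge12_ιMulti]
  rfl

/-- If one of the vectors `b j` is, modulo `v`, a combination of the other vectors, then a sum of
decomposable trivectors `v ∧ aᵢ ∧ bᵢ` can be shortened. -/
lemma shorten_sum {J : Type*} [DecidableEq J] (v : V) (s : Finset J) (a b : J → V)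
    {j : J} (hj : j ∈ s) (c : ℂ) (x y : J → ℂ)
    (hb : b j = c • v + ∑ i ∈ s, x i • a i + ∑ i ∈ s.erase j, y i • b i) :
    ∑ i ∈ s, wedge12 v (wedge11 (a i) (b i)) =
      ∑ i ∈ s.erase j, wedge12 v (wedge11 (a i + y i • a j) (b i - x i • a j)) := by
  rw [← Finset.add_sum_erase s _ hj]
  rw [← Finset.add_sum_erase s _ hj] at hb
  nth_rewrite 1 [hb]
  simp only [map_add, map_sub, map_smul, LinearMap.add_apply, LinearMap.smul_apply, map_sum,
    wedge12_wedge11_self_right, wedge11_self, smul_zero, zero_add, add_zero]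
  rw [← Finset.sum_add_distrib, ← Finset.sum_add_distrib]
  refine Finset.sum_congr rfl fun i _ => ?_
  rw [wedge11_swap (a i) (a j)]
  simp only [map_neg, smul_neg]
  abel

/-- A trivector `v ∧ η` is a sum of trivectors `v ∧ aᵢ ∧ bᵢ` for which `v` and all `aᵢ`, `bᵢ`
together are linearly independent: any sum with the least number of terms will do. -/
lemma exists_reduced_sum {v : V} (hv : v ≠ 0) (η : ⋀[ℂ]^2 V) :
    ∃ (s : Finset (Fin 2 → V)) (a b : (Fin 2 → V) → V),
      wedge12 v η = ∑ i ∈ s, wedge12 v (wedge11 (a i) (b i)) ∧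
      LinearIndependent ℂ (Sum.elim (fun _ : Unit => v)
        (Sum.elim (fun i : s => a i) (fun i : s => b i))) := by
  classical
  let P : ℕ → Prop := fun n => ∃ (s : Finset (Fin 2 → V)) (a b : (Fin 2 → V) → V),
    s.card = n ∧ wedge12 v η = ∑ i ∈ s, wedge12 v (wedge11 (a i) (b i))
  have hP : ∃ n, P n := by
    have hη : η ∈ Submodule.span ℂ (Set.range (ιMulti ℂ 2 (M := V))) := by
      rw [ιMulti_span]; trivial
    obtain ⟨c, rfl⟩ := Finsupp.mem_span_range_iff_exists_finsupp.mp hη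
    refine ⟨_, c.support, fun i => c i • i 0, fun i => i 1, rfl, ?_⟩
    rw [Finsupp.sum, map_sum]
    refine Finset.sum_congr rfl fun i _ => ?_
    rw [map_smul, LinearMap.map_smul, LinearMap.smul_apply, map_smul, wedge11_apply]
    congr 3
  obtain ⟨s, a, b, hcard, hsum⟩ := Nat.find_spec hP
  refine ⟨s, a, b, hsum, ?_⟩
  by_contra hli
  have hmin : ∀ j ∈ s, ∀ a' b' : (Fin 2 → V) → V,
      wedge12 v η ≠ ∑ i ∈ s.erase j, wedge12 v (wedge11 (a' i) (b' i)) := by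
    intro j hj a' b' h
    have h1 := Nat.find_min' hP ⟨s.erase j, a', b', rfl, h⟩
    rw [← hcard] at h1
    exact absurd (Finset.card_erase_lt_of_mem hj) (not_lt.mpr h1)
  rw [Fintype.not_linearIndependent_iff] at hli
  obtain ⟨g, hg, hg0⟩ := hli
  simp only [Fintype.sum_sum_type, Sum.elim_inl, Sum.elim_inr, Finset.univ_unique,
    Finset.sum_singleton] at hg
  let c := g (Sum.inl default)
  let x : (Fin 2 → V) → ℂ := fun i => if h : i ∈ s then g (Sum.inr (Sum.inl ⟨i, h⟩)) else 0
  let y : (Fin 2 → V) → ℂ := fun i => if h : i ∈ s then g (Sum.inr (Sum.inr ⟨i, h⟩)) else 0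
  have hx : ∑ i : s, g (Sum.inr (Sum.inl i)) • a i = ∑ i ∈ s, x i • a i := by
    rw [← Finset.sum_coe_sort s]
    exact Finset.sum_congr rfl fun i _ => by simp [x]
  have hy : ∑ i : s, g (Sum.inr (Sum.inr i)) • b i = ∑ i ∈ s, y i • b i := by
    rw [← Finset.sum_coe_sort s]
    exact Finset.sum_congr rfl fun i _ => by simp [y]
  rw [hx, hy] at hg
  change c • v + _ = 0 at hg
  have hnot : ∀ j ∈ s, x j = 0 ∧ y j = 0 := by
    intro j hj
    constructor
    · by_contra hne
      refine hmin j hj _ _ (?_ : _ = ∑ i ∈ s.erase j, wedge12 v (wedge11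
        (b i + (-(x j)⁻¹ * x i) • b j) (-a i - ((x j)⁻¹ * y i) • b j)))
      have h := shorten_sum v s b (fun i => - a i) hj ((x j)⁻¹ * c)
        (fun i => (x j)⁻¹ * y i) (fun i => -(x j)⁻¹ * x i) ?_
      · rw [hsum, ← h]
        refine Finset.sum_congr rfl fun i _ => ?_
        rw [wedge11_swap, map_neg, map_neg, map_neg]
      · rw [← Finset.add_sum_erase s _ hj] at hg
        have h2 : x j • a j = -(c • v + ∑ i ∈ s.erase j, x i • a i + ∑ i ∈ s, y i • b i) := by
          rw [eq_neg_iff_add_eq_zero, ← hg]; abel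
        have h3 : a j = (x j)⁻¹ • (x j • a j) := by
          rw [smul_smul, inv_mul_cancel₀ hne, one_smul]
        rw [h3, h2]
        simp only [smul_neg, neg_neg, smul_add, Finset.smul_sum, mul_smul, neg_smul]
        abel
    · by_contra hne
      refine hmin j hj _ _ (?_ : _ = ∑ i ∈ s.erase j, wedge12 v (wedge11
        (a i + (-(y j)⁻¹ * y i) • a j) (b i - (-(y j)⁻¹ * x i) • a j)))
      rw [hsum]
      refine shorten_sum v s a b hj (-(y j)⁻¹ * c) _ _ ?_
      rw [← Finset.add_sum_erase s (fun i => y i • b i) hj] at hg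
      have h2 : y j • b j = -(c • v + ∑ i ∈ s, x i • a i + ∑ i ∈ s.erase j, y i • b i) := by
        rw [eq_neg_iff_add_eq_zero, ← hg]; abel
      have h3 : b j = (y j)⁻¹ • (y j • b j) := by
        rw [smul_smul, inv_mul_cancel₀ hne, one_smul]
      rw [h3, h2]
      simp only [smul_neg, smul_add, Finset.smul_sum, mul_smul, neg_smul, neg_add,
        Finset.sum_neg_distrib]
  have hc : c = 0 := by
    rw [Finset.sum_eq_zero fun i hi => by rw [(hnot i hi).1, zero_smul],
      Finset.sum_eq_zero fun i hi => by rw [(hnot i hi).2, zero_smul]] at hg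
    simpa [hv] using hg
  obtain ⟨i, hi⟩ := hg0
  rcases i with i | i | i
  · exact hi hc
  · have := (hnot i i.2).1
    simp only [x, i.2, dif_pos] at this
    exact hi this
  · have := (hnot i i.2).2
    simp only [y, i.2, dif_pos] at this
    exact hi this

lemma exists_basis_of_five (hV : finrank ℂ V = 6) {f : Fin 5 → V} (hf : LinearIndependent ℂ f) :
    ∃ e : Basis (Fin 6) ℂ V, e 0 = f 0 ∧ e 1 = f 1 ∧ e 2 = f 2 ∧ e 3 = f 3 ∧ e 4 = f 4 := by
  have : FiniteDimensional ℂ V := .of_finrank_pos (by omega)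
  obtain ⟨u, hu⟩ : ∃ u, u ∉ Submodule.span ℂ (Set.range f) := by
    by_contra! h
    have h1 : Submodule.span ℂ (Set.range f) = ⊤ := by
      rw [eq_top_iff]; exact fun x _ => h x
    have h2 := finrank_span_eq_card hf
    rw [h1, finrank_top, hV] at h2
    simp at h2
  have hli : LinearIndependent ℂ (Fin.snoc f u : Fin 6 → V) := by
    rw [linearIndependent_finSnoc]
    exact ⟨hf, hu⟩
  refine ⟨basisOfLinearIndependentOfCardEqFinrank hli (by simp [hV]), ?_⟩
  rw [coe_basisOfLinearIndependentOfCardEqFinrank]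
  exact ⟨rfl, rfl, rfl, rfl, rfl⟩

/-- Normal form of trivectors divisible by `v`: either decomposable or of rank four modulo `v`. -/
lemma decomposable_or_exists_basis (hV : finrank ℂ V = 6) {v : V} (hv : v ≠ 0) (η : ⋀[ℂ]^2 V) :
    (∃ x y, wedge12 v η = wedge12 v (wedge11 x y)) ∨
    ∃ e : Basis (Fin 6) ℂ V, e 0 = v ∧
      wedge12 v η = wedge12 v (wedge11 (e 1) (e 2) + wedge11 (e 3) (e 4)) := by
  classical
  have : FiniteDimensional ℂ V := .of_finrank_pos (by omega)
  obtain ⟨s, a, b, hsum, hli⟩ := exists_reduced_sum hv η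
  have hcard := hli.fintype_card_le_finrank
  simp only [Fintype.card_sum, Fintype.card_unit, Fintype.card_coe, hV] at hcard
  have h3 : s.card = 0 ∨ s.card = 1 ∨ s.card = 2 := by omega
  rcases h3 with h | h | h
  · rw [Finset.card_eq_zero] at h
    subst h
    exact Or.inl ⟨0, 0, by simpa using hsum⟩
  · obtain ⟨i, rfl⟩ := Finset.card_eq_one.mp h
    exact Or.inl ⟨a i, b i, by simpa using hsum⟩
  · obtain ⟨i, j, hij, rfl⟩ := Finset.card_eq_two.mp h
    right
    let p : Fin 5 → Unit ⊕ (({i, j} : Finset (Fin 2 → V)) ⊕ ({i, j} : Finset (Fin 2 → V))) :=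
      ![Sum.inl (), Sum.inr (Sum.inl ⟨i, by simp⟩), Sum.inr (Sum.inr ⟨i, by simp⟩),
        Sum.inr (Sum.inl ⟨j, by simp⟩), Sum.inr (Sum.inr ⟨j, by simp⟩)]
    have hp : Function.Injective p := by
      intro k l hkl
      fin_cases k <;> fin_cases l <;> simp [p, hij, hij.symm] at hkl ⊢
    obtain ⟨e, h0, h1, h2, h3, h4⟩ := exists_basis_of_five hV (hli.comp p hp)
    refine ⟨e, h0, ?_⟩
    rw [h1, h2, h3, h4, hsum, Finset.sum_pair hij, map_add]
    rfl

variable (vol : ⋀[ℂ]^6 V ≃ₗ[ℂ] ℂ)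

/-- `σ(w ∧ η, v ∧ θ)` depends only on `v ∧ η` and `v ∧ θ`. -/
lemma symp_wedge12_congr (w : V) {v : V} {η η' θ θ' : ⋀[ℂ]^2 V} (h : wedge12 v η = wedge12 v η')
    (h' : wedge12 v θ = wedge12 v θ') :
    symp vol (wedge12 w η) (wedge12 v θ) = symp vol (wedge12 w η') (wedge12 v θ') := by
  rw [h', symp_wedge12_symm, h, symp_wedge12_symm]

lemma volForm_eq_zero_of_eq {f : Fin 6 → V} {i j : Fin 6} (h : f i = f j) (hij : i ≠ j) :
    volForm vol f = 0 := AlternatingMap.map_eq_zero_of_eq _ _ h hij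

/-- The linear form `w ↦ σ(w ∧ η, v ∧ η)` does not vanish on the last vector of the basis in the
normal form of a non-decomposable trivector. -/
lemma symp_normal_form_ne_zero (e : Basis (Fin 6) ℂ V) :
    symp vol (wedge12 (e 5) (wedge11 (e 1) (e 2) + wedge11 (e 3) (e 4)))
      (wedge12 (e 0) (wedge11 (e 1) (e 2) + wedge11 (e 3) (e 4))) ≠ 0 := by
  simp only [map_add, LinearMap.add_apply, symp_wedge11]
  rw [volForm_eq_zero_of_eq vol (f := ![e 5, e 1, e 2, e 0, e 1, e 2]) (i := 1) (j := 4) rfl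
    (by decide), volForm_eq_zero_of_eq vol (f := ![e 5, e 3, e 4, e 0, e 3, e 4]) (i := 1) (j := 4)
    rfl (by decide)]
  let τ₁ : Equiv.Perm (Fin 6) := Equiv.swap 0 5 * Equiv.swap 0 3 * Equiv.swap 0 4
  let τ₂ : Equiv.Perm (Fin 6) := Equiv.swap 1 4 * Equiv.swap 2 5
  have hx : volForm vol ![e 5, e 3, e 4, e 0, e 1, e 2] =
      volForm vol ![e 5, e 1, e 2, e 0, e 3, e 4] := by
    have h := volForm_comp_perm vol ![e 5, e 1, e 2, e 0, e 3, e 4] τ₂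
    have hs : (Equiv.Perm.sign τ₂ : ℤ) = 1 := by decide
    have hv : ![e 5, e 1, e 2, e 0, e 3, e 4] ∘ τ₂ = ![e 5, e 3, e 4, e 0, e 1, e 2] := by
      funext i
      fin_cases i <;> rfl
    rw [hs, hv, one_smul] at h
    exact h
  have hne : volForm vol ![e 5, e 1, e 2, e 0, e 3, e 4] ≠ 0 := by
    have hp : Function.Bijective (![5, 1, 2, 0, 3, 4] : Fin 6 → Fin 6) := by decide
    have h := volForm_basis_ne_zero vol (e.reindex (Equiv.ofBijective _ hp).symm)
    have hv : ⇑(e.reindex (Equiv.ofBijective _ hp).symm) = ![e 5, e 1, e 2, e 0, e 3, e 4] := by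
      funext i
      rw [Basis.reindex_apply, Equiv.symm_symm]
      fin_cases i <;> rfl
    rwa [hv] at h
  rw [hx, zero_add, add_zero, ← two_mul]
  exact mul_ne_zero two_ne_zero hne

/-- The quadratic criterion for decomposability: `v ∧ η ∧ η = 0` forces `v ∧ η` to be
decomposable. -/
lemma decomposable_of_symp_eq_zero (hV : finrank ℂ V = 6) {v : V} (hv : v ≠ 0) {η : ⋀[ℂ]^2 V}
    (h : ∀ w, symp vol (wedge12 w η) (wedge12 v η) = 0) :
    ∃ x y, wedge12 v η = wedge12 v (wedge11 x y) := by
  rcases decomposable_or_exists_basis hV hv η with h1 | ⟨e, he, h1⟩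
  · exact h1
  · exfalso
    have h2 := h (e 5)
    rw [symp_wedge12_congr vol _ h1 h1] at h2
    subst he
    exact symp_normal_form_ne_zero vol e h2

/-- Five of the six vectors lie in a space of dimension at most four. -/
lemma volForm_eq_zero_of_mem {H : Submodule ℂ V} [FiniteDimensional ℂ H] (hH : finrank ℂ H ≤ 4)
    {w x y v x' y' : V} (hw : w ∈ H) (hx : x ∈ H) (hy : y ∈ H) (hx' : x' ∈ H) (hy' : y' ∈ H) :
    volForm vol ![w, x, y, v, x', y'] = 0 := by
  apply AlternatingMap.map_linearDependent
  intro hli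
  have hp : Function.Injective (![0, 1, 2, 4, 5] : Fin 5 → Fin 6) := by decide
  have h5 := hli.comp _ hp
  let g : Fin 5 → H := ![⟨w, hw⟩, ⟨x, hx⟩, ⟨y, hy⟩, ⟨x', hx'⟩, ⟨y', hy'⟩]
  have hg : LinearIndependent ℂ g := by
    apply LinearIndependent.of_comp H.subtype
    have hgv : H.subtype ∘ g = ![w, x, y, v, x', y'] ∘ ![0, 1, 2, 4, 5] := by
      funext i
      fin_cases i <;> rfl
    rw [hgv]
    exact h5
  have := hg.fintype_card_le_finrank
  simp at this
  omega

/-- Evaluating the volume form on basis vectors with one of them replaced picks a coordinate. -/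
lemma volForm_update (e : Basis (Fin 6) ℂ V) {p : Fin 6 → Fin 6} (hp : Function.Bijective p)
    (k : Fin 6) (h : V) :
    volForm vol (Function.update (e ∘ p) k h) = e.repr h (p k) * volForm vol (e ∘ p) := by
  conv_lhs => rw [← e.sum_repr h]
  rw [AlternatingMap.map_update_sum, Finset.sum_eq_single (p k)]
  · rw [AlternatingMap.map_update_smul, smul_eq_mul]
    congr 2
    exact Function.update_eq_self k (e ∘ p)
  · intro i _ hi
    rw [AlternatingMap.map_update_smul]
    obtain ⟨l, rfl⟩ := hp.2 i
    have hl : l ≠ k := fun h => hi (by rw [h])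
    rw [volForm_eq_zero_of_eq vol (i := k) (j := l) _ hl.symm, smul_zero]
    simp [Function.update_of_ne hl]
  · simp

lemma volForm_comp_ne_zero (e : Basis (Fin 6) ℂ V) {p : Fin 6 → Fin 6}
    (hp : Function.Bijective p) : volForm vol (e ∘ p) ≠ 0 := by
  have h := volForm_basis_ne_zero vol (e.reindex (Equiv.ofBijective _ hp).symm)
  have hv : ⇑(e.reindex (Equiv.ofBijective _ hp).symm) = e ∘ p := by
    funext i
    rw [Basis.reindex_apply, Equiv.symm_symm]
    rfl
  rwa [hv] at h

/-- In a pencil of trivectors divisible by `v` with vanishing mixed products, the squares are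
proportional: `θ` lives on the four-space that carries the non-degenerate `η`. -/
lemma symp_self_proportional (hV : finrank ℂ V = 6) {v : V} (hv : v ≠ 0) {η θ : ⋀[ℂ]^2 V}
    (hη : ¬ ∃ x y, wedge12 v η = wedge12 v (wedge11 x y))
    (h : ∀ w, symp vol (wedge12 w η) (wedge12 v θ) = 0) :
    ∃ r : ℂ, ∀ w, symp vol (wedge12 w θ) (wedge12 v θ) =
      r * symp vol (wedge12 w η) (wedge12 v η) := by
  obtain ⟨e, he, h1⟩ := (decomposable_or_exists_basis hV hv η).resolve_left hη
  let η' := wedge11 (e 1) (e 2) + wedge11 (e 3) (e 4)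
  let H : Submodule ℂ V := Submodule.span ℂ (Set.range ![e 1, e 2, e 3, e 4])
  have hHfin : FiniteDimensional ℂ H := FiniteDimensional.span_of_finite ℂ (Set.finite_range _)
  have hH4 : finrank ℂ H ≤ 4 := finrank_range_le_card (R := ℂ) ![e 1, e 2, e 3, e 4]
  have heH : e 1 ∈ H ∧ e 2 ∈ H ∧ e 3 ∈ H ∧ e 4 ∈ H :=
    ⟨Submodule.subset_span ⟨0, rfl⟩, Submodule.subset_span ⟨1, rfl⟩,
      Submodule.subset_span ⟨2, rfl⟩, Submodule.subset_span ⟨3, rfl⟩⟩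
  let S : Submodule ℂ (⋀[ℂ]^2 V) := Submodule.map₂ wedge11 H H
  -- products of bivectors on `H` with vectors of `H` and `v` vanish
  have hzero : ∀ w ∈ H, ∀ α ∈ S, ∀ β ∈ S, symp vol (wedge12 w α) (wedge12 v β) = 0 := by
    intro w hw α hα β hβ
    let B : ⋀[ℂ]^2 V →ₗ[ℂ] ⋀[ℂ]^2 V →ₗ[ℂ] ℂ := (symp vol).compl₁₂ (wedge12 w) (wedge12 v)
    have h2 : ∀ x ∈ H, ∀ y ∈ H, S ≤ LinearMap.ker (B (wedge11 x y)) := by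
      intro x hx y hy
      refine Submodule.map₂_le.mpr fun x' hx' y' hy' => ?_
      change symp vol _ _ = 0
      rw [symp_wedge11]
      exact volForm_eq_zero_of_mem vol hH4 hw hx hy hx' hy'
    have h3 : S ≤ LinearMap.ker (B.flip β) :=
      Submodule.map₂_le.mpr fun x hx y hy => h2 x hx y hy hβ
    exact h3 hα
  have hη'S : η' ∈ S := Submodule.add_mem _
    (Submodule.apply_mem_map₂ _ heH.1 heH.2.1) (Submodule.apply_mem_map₂ _ heH.2.2.1 heH.2.2.2)
  have hdec : ∀ x : V, ∃ c d : ℂ, ∃ y ∈ H, x = c • v + d • e 5 + y := by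
    intro x
    refine ⟨e.repr x 0, e.repr x 5, e.repr x 1 • e 1 + e.repr x 2 • e 2 + e.repr x 3 • e 3 +
      e.repr x 4 • e 4, ?_, ?_⟩
    · exact Submodule.add_mem _ (Submodule.add_mem _ (Submodule.add_mem _
        (Submodule.smul_mem _ _ heH.1) (Submodule.smul_mem _ _ heH.2.1))
        (Submodule.smul_mem _ _ heH.2.2.1)) (Submodule.smul_mem _ _ heH.2.2.2)
    · conv_lhs => rw [← e.sum_repr x]
      simp only [Fin.sum_univ_six, he]
      abel
  have hform : ∀ θ : ⋀[ℂ]^2 V,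
      ∃ y ∈ H, ∃ β ∈ S, wedge12 v θ = wedge12 v (wedge11 (e 5) y + β) := by
    intro θ
    have hmem : θ ∈ Submodule.span ℂ (Set.range (ιMulti ℂ 2 (M := V))) := by
      rw [ιMulti_span]; trivial
    induction hmem using Submodule.span_induction with
    | mem θ hθ =>
      obtain ⟨p, rfl⟩ := hθ
      obtain ⟨c, d, y, hy, hx⟩ := hdec (p 0)
      obtain ⟨c', d', y', hy', hx'⟩ := hdec (p 1)
      refine ⟨d • y' - d' • y, Submodule.sub_mem _ (Submodule.smul_mem _ _ hy')
        (Submodule.smul_mem _ _ hy), wedge11 y y', Submodule.apply_mem_map₂ _ hy hy', ?_⟩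
      have hp : ιMulti ℂ 2 p = wedge11 (p 0) (p 1) := by
        rw [wedge11_apply]
        congr 1
        funext i
        fin_cases i <;> rfl
      rw [hp, hx, hx']
      simp only [map_add, map_sub, map_smul, LinearMap.add_apply, LinearMap.smul_apply,
        wedge12_wedge11_self_left, wedge12_wedge11_self_right, wedge11_self, smul_zero, zero_add,
        add_zero, wedge11_swap y (e 5), map_neg]
      simp only [smul_neg]
      abel
    | zero => exact ⟨0, zero_mem _, 0, zero_mem _, by simp⟩
    | add θ₁ θ₂ _ _ h₁ h₂ =>
      obtain ⟨y₁, hy₁, β₁, hβ₁, e₁⟩ := h₁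
      obtain ⟨y₂, hy₂, β₂, hβ₂, e₂⟩ := h₂
      refine ⟨y₁ + y₂, add_mem hy₁ hy₂, β₁ + β₂, add_mem hβ₁ hβ₂, ?_⟩
      rw [map_add, e₁, e₂, ← map_add, map_add (wedge11 (e 5))]
      congr 1
      abel
    | smul c θ₁ _ h₁ =>
      obtain ⟨y₁, hy₁, β₁, hβ₁, e₁⟩ := h₁
      refine ⟨c • y₁, H.smul_mem c hy₁, c • β₁, S.smul_mem c hβ₁, ?_⟩
      rw [map_smul, e₁, ← map_smul, smul_add, map_smul (wedge11 (e 5))]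
  obtain ⟨y, hy, β, hβ, h2⟩ := hform θ
  have hlast : ∀ p : Fin 6 → Fin 6, Function.Bijective p →
      volForm vol (Function.update (e ∘ p) 5 y) = 0 → e.repr y (p 5) = 0 := by
    intro p hp h0
    rw [volForm_update vol e hp] at h0
    exact (mul_eq_zero.mp h0).resolve_right (volForm_comp_ne_zero vol e hp)
  have hw : ∀ w ∈ H, symp vol (wedge12 w η') (wedge12 v (wedge11 (e 5) y)) = 0 := by
    intro w hw
    have h3 := h w
    rw [symp_wedge12_congr vol w h1 h2, map_add (wedge12 v), map_add (symp vol _)] at h3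
    rwa [hzero w hw _ hη'S _ hβ, add_zero] at h3
  simp only [η', map_add, LinearMap.add_apply, symp_wedge11] at hw
  have hy1 : e.repr y 2 = 0 := by
    refine hlast ![1, 3, 4, 0, 5, 2] (by decide) ?_
    have h3 := hw (e 1) heH.1
    rw [volForm_eq_zero_of_eq vol (i := 0) (j := 1) rfl (by decide), zero_add, ← he] at h3
    convert h3 using 2
    funext i
    fin_cases i <;> rfl
  have hy2 : e.repr y 1 = 0 := by
    refine hlast ![2, 3, 4, 0, 5, 1] (by decide) ?_
    have h3 := hw (e 2) heH.2.1
    rw [volForm_eq_zero_of_eq vol (i := 0) (j := 2) rfl (by decide), zero_add, ← he] at h3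
    convert h3 using 2
    funext i
    fin_cases i <;> rfl
  have hy3 : e.repr y 4 = 0 := by
    refine hlast ![3, 1, 2, 0, 5, 4] (by decide) ?_
    have h3 := hw (e 3) heH.2.2.1
    rw [add_comm, volForm_eq_zero_of_eq vol (i := 0) (j := 1) rfl (by decide), zero_add, ← he] at h3
    convert h3 using 2
    funext i
    fin_cases i <;> rfl
  have hy4 : e.repr y 3 = 0 := by
    refine hlast ![4, 1, 2, 0, 5, 3] (by decide) ?_
    have h3 := hw (e 4) heH.2.2.2
    rw [add_comm, volForm_eq_zero_of_eq vol (i := 0) (j := 2) rfl (by decide), zero_add, ← he] at h3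
    convert h3 using 2
    funext i
    fin_cases i <;> rfl
  have hy0 : ∀ i : Fin 6, i = 0 ∨ i = 5 → e.repr y i = 0 := by
    intro i hi
    have : H ≤ LinearMap.ker (e.coord i) := by
      refine Submodule.span_le.mpr ?_
      rintro _ ⟨j, rfl⟩
      rcases hi with rfl | rfl <;> fin_cases j <;> simp
    exact this hy
  have hyz : y = 0 := by
    apply e.repr.map_eq_zero_iff.mp
    ext i
    fin_cases i
    exacts [hy0 0 (Or.inl rfl), hy2, hy1, hy4, hy3, hy0 5 (Or.inr rfl)]
  rw [hyz, map_zero, zero_add] at h2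
  have hne := symp_normal_form_ne_zero vol e
  rw [he] at hne
  refine ⟨symp vol (wedge12 (e 5) β) (wedge12 v β) / symp vol (wedge12 (e 5) η') (wedge12 v η'),
    fun w => ?_⟩
  rw [symp_wedge12_congr vol w h1 h1, symp_wedge12_congr vol w h2 h2]
  -- both sides are linear in `w` and vanish on the basis vectors other than the last one
  have hlin : (symp vol).flip (wedge12 v β) ∘ₗ wedge12.flip β =
      (symp vol (wedge12 (e 5) β) (wedge12 v β) / symp vol (wedge12 (e 5) η') (wedge12 v η')) •
        ((symp vol).flip (wedge12 v η') ∘ₗ wedge12.flip η') := by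
    refine e.ext fun i => ?_
    change symp vol (wedge12 (e i) β) (wedge12 v β) =
      _ * symp vol (wedge12 (e i) η') (wedge12 v η')
    by_cases h5 : i = 5
    · subst h5
      rw [div_mul_cancel₀ _ hne]
    · by_cases h0 : i = 0
      · subst h0
        rw [he, symp_wedge12_self, symp_wedge12_self, mul_zero]
      · have hiH : e i ∈ H := by
          fin_cases i
          exacts [absurd rfl h0, heH.1, heH.2.1, heH.2.2.1, heH.2.2.2, absurd rfl h5]
        rw [hzero _ hiH _ hβ _ hβ, hzero _ hiH _ hη'S _ hη'S, mul_zero]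
  exact LinearMap.congr_fun hlin w

/-- Over `ℂ` a binary quadratic form is a product of linear forms. -/
lemma exists_binary_factorization (a b d : ℂ) (h : ¬ (a = 0 ∧ b = 0 ∧ d = 0)) :
    ∃ p q p' q' : ℂ, ¬ (p = 0 ∧ q = 0) ∧ ¬ (p' = 0 ∧ q' = 0) ∧
      a = p * p' ∧ b = p * q' + p' * q ∧ d = q * q' := by
  by_cases ha : a = 0
  · exact ⟨0, 1, b, d, by simp, fun h' => h ⟨ha, h'⟩, by simp [ha], by simp, by simp⟩
  · obtain ⟨s, hs⟩ := IsAlgClosed.exists_pow_nat_eq (b ^ 2 - 4 * a * d) two_pos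
    refine ⟨1, (b - s) / (2 * a), a, (b + s) / 2, by simp, by simp [ha], by ring, ?_, ?_⟩
    · field_simp
      ring
    · field_simp
      linear_combination hs

/-- If no nonzero combination of `v ∧ η` and `v ∧ θ` is decomposable, the three products
`η ∧ η`, `η ∧ θ`, `θ ∧ θ` are linearly independent modulo `v`. -/
theorem symp_products_independent (hV : finrank ℂ V = 6) {v : V} (hv : v ≠ 0) {η θ : ⋀[ℂ]^2 V}
    (hno : ∀ s t : ℂ, (∃ x y, wedge12 v (s • η + t • θ) = wedge12 v (wedge11 x y)) →
      s = 0 ∧ t = 0)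
    (a b d : ℂ) (h : ∀ w, a * symp vol (wedge12 w η) (wedge12 v η) +
      b * symp vol (wedge12 w η) (wedge12 v θ) + d * symp vol (wedge12 w θ) (wedge12 v θ) = 0) :
    a = 0 ∧ b = 0 ∧ d = 0 := by
  by_contra hne
  obtain ⟨p, q, p', q', hpq, hpq', ha, hb, hd⟩ := exists_binary_factorization a b d hne
  have hmix : ∀ w, symp vol (wedge12 w (p • η + q • θ)) (wedge12 v (p' • η + q' • θ)) = 0 := by
    intro w
    rw [← h w, ha, hb, hd]
    simp only [map_add, map_smul, LinearMap.add_apply, LinearMap.smul_apply, smul_eq_mul]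
    rw [symp_wedge12_symm vol w v θ η]
    ring
  have hind : ¬ ∃ x y, wedge12 v (p • η + q • θ) = wedge12 v (wedge11 x y) :=
    fun h' => hpq (hno p q h')
  obtain ⟨r, hr⟩ := symp_self_proportional vol hV hv hind hmix
  obtain ⟨ρ, hρ⟩ := IsAlgClosed.exists_pow_nat_eq (-r) two_pos
  have hsq : ∀ w, symp vol (wedge12 w ((p' + ρ * p) • η + (q' + ρ * q) • θ))
      (wedge12 v ((p' + ρ * p) • η + (q' + ρ * q) • θ)) = 0 := by
    intro w
    have heq : (p' + ρ * p) • η + (q' + ρ * q) • θ =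
        (p' • η + q' • θ) + ρ • (p • η + q • θ) := by
      simp only [add_smul, mul_smul, smul_add]
      abel
    rw [heq]
    have h1 := hmix w
    have h2 : symp vol (wedge12 w (p' • η + q' • θ)) (wedge12 v (p • η + q • θ)) = 0 := by
      rw [symp_wedge12_symm, h1]
    have h3 := hr w
    generalize p' • η + q' • θ = β at *
    generalize p • η + q • θ = α at *
    simp only [map_add, map_smul, LinearMap.add_apply, LinearMap.smul_apply, smul_eq_mul]
    rw [h1, h2, h3]
    linear_combination (symp vol (wedge12 w α) (wedge12 v α)) * hρ
  obtain ⟨h1, h2⟩ := hno _ _ (decomposable_of_symp_eq_zero vol hV hv hsq)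
  have hp' : p' = -ρ * p := by linear_combination h1
  have hq' : q' = -ρ * q := by linear_combination h2
  have hρ0 : ρ ≠ 0 := by
    rintro rfl
    exact hpq' ⟨by simp [hp'], by simp [hq']⟩
  refine hind (decomposable_of_symp_eq_zero vol hV hv fun w => ?_)
  have h3 := hmix w
  rw [hp', hq', mul_smul, mul_smul, ← smul_add, map_smul, map_smul, smul_eq_mul] at h3
  exact (mul_eq_zero.mp h3).resolve_left (neg_ne_zero.mpr hρ0)

/-- The square of a decomposable trivector `v ∧ x ∧ y` vanishes. -/
lemma symp_decomposable (w v x y : V) :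
    symp vol (wedge12 w (wedge11 x y)) (wedge12 v (wedge11 x y)) = 0 := by
  rw [symp_wedge11]
  exact volForm_eq_zero_of_eq vol (i := 1) (j := 4) rfl (by decide)

end Decomposable

/-! ### Regular functions -/

section RegularFunctions

open Filter

variable {V : Type*} [NormedAddCommGroup V] [NormedSpace ℂ V]

lemma polyVal_smul {d : ℕ} {p : MvPolynomial (Module.Dual ℂ V) ℂ} (hp : p.IsHomogeneous d)
    (c : ℂ) (v : V) : polyVal p (c • v) = c ^ d * polyVal p v := by
  simp only [polyVal, MvPolynomial.eval_eq, Finset.mul_sum, map_smul, smul_eq_mul, mul_pow]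
  refine Finset.sum_congr rfl fun i hi => ?_
  have hdeg : ∑ j ∈ i.support, i j = d := by
    have := hp.degree_eq_sum_deg_support hi
    rw [this]
  rw [Finset.prod_mul_distrib, Finset.prod_pow_eq_pow_sum, hdeg]
  ring

lemma exists_rep_mk_eq {v : V} (hv : v ≠ 0) :
    ∃ c : ℂ, c ≠ 0 ∧ (Projectivization.mk ℂ v hv).rep = c • v := by
  obtain ⟨a, ha⟩ := Projectivization.exists_smul_eq_mk_rep ℂ v hv
  exact ⟨a, a.ne_zero, ha.symm⟩

lemma polyVal_rep_mk_ne_zero_iff {d : ℕ} {p : MvPolynomial (Module.Dual ℂ V) ℂ}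
    (hp : p.IsHomogeneous d) {v : V} (hv : v ≠ 0) :
    polyVal p (Projectivization.mk ℂ v hv).rep ≠ 0 ↔ polyVal p v ≠ 0 := by
  obtain ⟨c, hc, h⟩ := exists_rep_mk_eq hv
  rw [h, polyVal_smul hp]
  simp [hc]

lemma polyVal_div_rep_mk {d : ℕ} {p q : MvPolynomial (Module.Dual ℂ V) ℂ}
    (hp : p.IsHomogeneous d) (hq : q.IsHomogeneous d) {v : V} (hv : v ≠ 0) :
    polyVal p (Projectivization.mk ℂ v hv).rep / polyVal q (Projectivization.mk ℂ v hv).rep =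
      polyVal p v / polyVal q v := by
  obtain ⟨c, hc, h⟩ := exists_rep_mk_eq hv
  rw [h, polyVal_smul hp, polyVal_smul hq, mul_div_mul_left _ _ (pow_ne_zero _ hc)]

lemma analyticOnNhd_polyVal [FiniteDimensional ℂ V] (p : MvPolynomial (Module.Dual ℂ V) ℂ) :
    AnalyticOnNhd ℂ (polyVal p) Set.univ := fun v _ => by
  have h := AnalyticAt.aeval_mvPolynomial (𝕜 := ℂ) (A := ℂ) (z := v)
    (f := fun (v : V) (φ : Module.Dual ℂ V) => φ v)
    (fun φ => (LinearMap.toContinuousLinearMap φ).analyticAt v) p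
  have h2 : (fun x : V => MvPolynomial.aeval (fun φ : Module.Dual ℂ V => φ x) p) = polyVal p := by
    funext x
    rw [MvPolynomial.aeval_eq_eval]
    rfl
  rw [← h2]
  exact h

lemma continuous_polyVal [FiniteDimensional ℂ V] (p : MvPolynomial (Module.Dual ℂ V) ℂ) :
    Continuous (polyVal (V := V) p) :=
  continuousOn_univ.mp (analyticOnNhd_polyVal p).continuousOn

lemma continuous_projMk :
    Continuous fun v : {v : V // v ≠ 0} => Projectivization.mk ℂ v.1 v.2 :=
  continuous_coinduced_rng

lemma isOpen_proj_iff {U : Set (ℙ ℂ V)} :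
    IsOpen U ↔ IsOpen {v : {v : V // v ≠ 0} | Projectivization.mk ℂ v.1 v.2 ∈ U} :=
  isOpen_coinduced

lemma isOpen_polyVal_ne_zero [FiniteDimensional ℂ V] {d : ℕ}
    {p : MvPolynomial (Module.Dual ℂ V) ℂ} (hp : p.IsHomogeneous d) :
    IsOpen {m : ℙ ℂ V | polyVal p m.rep ≠ 0} := by
  rw [isOpen_proj_iff]
  have : {v : {v : V // v ≠ 0} | Projectivization.mk ℂ v.1 v.2 ∈
      {m : ℙ ℂ V | polyVal p m.rep ≠ 0}} = {v | polyVal p v.1 ≠ 0} := by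
    ext v
    exact polyVal_rep_mk_ne_zero_iff hp v.2
  rw [this]
  exact isOpen_ne.preimage ((continuous_polyVal p).comp continuous_subtype_val)

/-- A property of points of `ℙ(V)` that holds near `ℓ` holds for the lines spanned by the vectors
near a representative. -/
lemma eventually_mk {ℓ : ℙ ℂ V} {P : ℙ ℂ V → Prop} (h : ∀ᶠ m in 𝓝 ℓ, P m) :
    ∀ᶠ v in 𝓝 ℓ.rep, ∀ hv : v ≠ 0, P (Projectivization.mk ℂ v hv) := by
  have h1 := (continuous_projMk (V := V)).tendsto ⟨ℓ.rep, ℓ.rep_nonzero⟩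
  simp only [Projectivization.mk_rep] at h1
  have h2 := h1.eventually h
  rw [nhds_subtype_eq_comap, eventually_comap] at h2
  filter_upwards [h2] with v hv hv0
  exact hv ⟨v, hv0⟩ rfl

lemma pull_of_ne {f : ℙ ℂ V → ℂ} {v : V} (hv : v ≠ 0) :
    pull f v = f (Projectivization.mk ℂ v hv) := by simp [pull, hv]

lemma pull_rep (f : ℙ ℂ V → ℂ) (ℓ : ℙ ℂ V) : pull f ℓ.rep = f ℓ := by
  rw [pull_of_ne ℓ.rep_nonzero, Projectivization.mk_rep]

lemma pull_eventuallyEq {f g : ℙ ℂ V → ℂ} {ℓ : ℙ ℂ V} (h : f =ᶠ[𝓝 ℓ] g) :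
    pull f =ᶠ[𝓝 ℓ.rep] pull g := by
  filter_upwards [eventually_mk h] with v hv
  by_cases h0 : v = 0
  · simp [pull, h0]
  · rw [pull_of_ne h0, pull_of_ne h0]
    exact hv h0

lemma IsRegularAt.isHolomorphicAt [FiniteDimensional ℂ V] {ℓ : ℙ ℂ V} {f : ℙ ℂ V → ℂ}
    (hf : IsRegularAt ℓ f) : IsHolomorphicAt ℓ f := by
  obtain ⟨d, p, q, hp, hq, h0, h⟩ := hf
  have h1 : AnalyticAt ℂ (fun v => polyVal p v / polyVal q v) ℓ.rep :=
    (analyticOnNhd_polyVal p _ trivial).div (analyticOnNhd_polyVal q _ trivial) h0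
  refine h1.congr ?_
  filter_upwards [(isOpen_ne.preimage (continuous_polyVal q)).mem_nhds h0,
    isOpen_ne.mem_nhds ℓ.rep_nonzero] with v hv hv0
  rw [pull_of_ne hv0, h _ ((polyVal_rep_mk_ne_zero_iff hq hv0).mpr hv), polyVal_div_rep_mk hp hq]

lemma IsRegularAt.eventually [FiniteDimensional ℂ V] {ℓ : ℙ ℂ V} {f : ℙ ℂ V → ℂ}
    (hf : IsRegularAt ℓ f) : ∀ᶠ m in 𝓝 ℓ, IsRegularAt m f := by
  obtain ⟨d, p, q, hp, hq, h0, h⟩ := hf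
  filter_upwards [(isOpen_polyVal_ne_zero hq).mem_nhds h0] with m hm
  exact ⟨d, p, q, hp, hq, hm, h⟩

lemma IsRegularAt.eventually_ne_zero [FiniteDimensional ℂ V] {ℓ : ℙ ℂ V} {f : ℙ ℂ V → ℂ}
    (hf : IsRegularAt ℓ f) (hne : f ℓ ≠ 0) : ∀ᶠ m in 𝓝 ℓ, f m ≠ 0 := by
  obtain ⟨d, p, q, hp, hq, h0, h⟩ := hf
  have hp0 : polyVal p ℓ.rep ≠ 0 := by
    intro h1
    rw [h _ h0, h1, zero_div] at hne
    exact hne rfl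
  filter_upwards [(isOpen_polyVal_ne_zero hq).mem_nhds h0,
    (isOpen_polyVal_ne_zero hp).mem_nhds hp0] with m hm hm'
  rw [h _ hm]
  exact div_ne_zero hm' hm

lemma IsRegularAt.inv {ℓ : ℙ ℂ V} {f : ℙ ℂ V → ℂ} (hf : IsRegularAt ℓ f) (hne : f ℓ ≠ 0) :
    IsRegularAt ℓ (fun m => (f m)⁻¹) := by
  obtain ⟨d, p, q, hp, hq, h0, h⟩ := hf
  have hp0 : polyVal p ℓ.rep ≠ 0 := by
    intro h1
    rw [h _ h0, h1, zero_div] at hne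
    exact hne rfl
  refine ⟨d + d, q * q, p * q, hq.mul hq, hp.mul hq, ?_, ?_⟩
  · simpa [polyVal] using And.intro hp0 h0
  · intro m hm
    have hm2 : polyVal p m.rep ≠ 0 ∧ polyVal q m.rep ≠ 0 := by simpa [polyVal] using hm
    change (f m)⁻¹ = _
    rw [h m hm2.2, inv_div]
    have : polyVal (q * q) m.rep / polyVal (p * q) m.rep =
      (polyVal q m.rep * polyVal q m.rep) / (polyVal p m.rep * polyVal q m.rep) := by
      simp [polyVal]
    rw [this, mul_div_mul_right _ _ hm2.2]

lemma isRegularAt_const (ℓ : ℙ ℂ V) (c : ℂ) : IsRegularAt ℓ fun _ => c :=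
  ⟨0, MvPolynomial.C c, 1, MvPolynomial.isHomogeneous_C _ _, MvPolynomial.isHomogeneous_one _ _,
    by simp [polyVal], by simp [polyVal]⟩

lemma isRegularAt_div (φ φ₀ : Module.Dual ℂ V) {ℓ : ℙ ℂ V} (h : φ₀ ℓ.rep ≠ 0) :
    IsRegularAt ℓ fun m => φ m.rep / φ₀ m.rep :=
  ⟨1, MvPolynomial.X φ, MvPolynomial.X φ₀, MvPolynomial.isHomogeneous_X _ _,
    MvPolynomial.isHomogeneous_X _ _, by simpa [polyVal] using h, by simp [polyVal]⟩

lemma IsRegularAt.add {ℓ : ℙ ℂ V} {f g : ℙ ℂ V → ℂ} (hf : IsRegularAt ℓ f)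
    (hg : IsRegularAt ℓ g) : IsRegularAt ℓ (fun m => f m + g m) :=
  (regularFunctions ℓ).add_mem hf hg

lemma IsRegularAt.sub {ℓ : ℙ ℂ V} {f g : ℙ ℂ V → ℂ} (hf : IsRegularAt ℓ f)
    (hg : IsRegularAt ℓ g) : IsRegularAt ℓ (fun m => f m - g m) :=
  (regularFunctions ℓ).sub_mem hf hg

lemma IsRegularAt.mul {ℓ : ℙ ℂ V} {f g : ℙ ℂ V → ℂ} (hf : IsRegularAt ℓ f)
    (hg : IsRegularAt ℓ g) : IsRegularAt ℓ (fun m => f m * g m) :=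
  (regularFunctions ℓ).mul_mem hf hg

lemma IsRegularAt.neg {ℓ : ℙ ℂ V} {f : ℙ ℂ V → ℂ} (hf : IsRegularAt ℓ f) :
    IsRegularAt ℓ (fun m => -f m) :=
  (regularFunctions ℓ).neg_mem hf

lemma IsRegularAt.sum {ℓ : ℙ ℂ V} {ι : Type*} (s : Finset ι) {f : ι → ℙ ℂ V → ℂ}
    (hf : ∀ i ∈ s, IsRegularAt ℓ (f i)) : IsRegularAt ℓ (fun m => ∑ i ∈ s, f i m) := by
  have h := (regularFunctions ℓ).sum_mem hf
  have h2 : (fun m => ∑ i ∈ s, f i m) = ∑ i ∈ s, f i := by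
    funext m
    simp
  rw [h2]
  exact h

lemma IsRegularAt.prod {ℓ : ℙ ℂ V} {ι : Type*} (s : Finset ι) {f : ι → ℙ ℂ V → ℂ}
    (hf : ∀ i ∈ s, IsRegularAt ℓ (f i)) : IsRegularAt ℓ (fun m => ∏ i ∈ s, f i m) := by
  have h := (regularFunctions ℓ).prod_mem hf
  have h2 : (fun m => ∏ i ∈ s, f i m) = ∏ i ∈ s, f i := by
    funext m
    simp
  rw [h2]
  exact h

lemma IsRegularAt.det {ℓ : ℙ ℂ V} {ι : Type*} [Fintype ι] [DecidableEq ι]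
    {M : ℙ ℂ V → Matrix ι ι ℂ} (hM : ∀ i j, IsRegularAt ℓ fun m => M m i j) :
    IsRegularAt ℓ fun m => (M m).det := by
  simp only [Matrix.det_apply']
  exact IsRegularAt.sum _ fun τ _ => (isRegularAt_const ℓ _).mul
    (IsRegularAt.prod _ fun i _ => hM _ _)

lemma IsRegularAt.matrix_mul {ℓ : ℙ ℂ V} {ι κ μ : Type*} [Fintype κ]
    {M : ℙ ℂ V → Matrix ι κ ℂ} {N : ℙ ℂ V → Matrix κ μ ℂ}
    (hM : ∀ i j, IsRegularAt ℓ fun m => M m i j) (hN : ∀ i j, IsRegularAt ℓ fun m => N m i j)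
    (i : ι) (j : μ) : IsRegularAt ℓ fun m => (M m * N m) i j := by
  simp only [Matrix.mul_apply]
  exact IsRegularAt.sum _ fun k _ => (hM i k).mul (hN k j)

lemma IsRegularAt.matrix_inv {ℓ : ℙ ℂ V} {ι : Type*} [Fintype ι] [DecidableEq ι]
    {M : ℙ ℂ V → Matrix ι ι ℂ} (hM : ∀ i j, IsRegularAt ℓ fun m => M m i j)
    (hdet : (M ℓ).det ≠ 0) (i j : ι) : IsRegularAt ℓ fun m => (M m)⁻¹ i j := by
  have h : (fun m => (M m)⁻¹ i j) =
      fun m => ((M m).det)⁻¹ * ((M m).updateRow j (Pi.single i 1)).det := by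
    funext m
    rw [Matrix.inv_def, Matrix.smul_apply, Matrix.adjugate_apply, Ring.inverse_eq_inv, smul_eq_mul]
  rw [h]
  refine ((IsRegularAt.det hM).inv hdet).mul (IsRegularAt.det fun k l => ?_)
  by_cases hk : k = j
  · subst hk
    simpa using isRegularAt_const ℓ (Pi.single (M := fun _ => ℂ) i 1 l)
  · simpa [Matrix.updateRow_ne hk] using hM k l

/-! ### Differentials -/

lemma differential_congr {f g : ℙ ℂ V → ℂ} {ℓ : ℙ ℂ V} (h : f =ᶠ[𝓝 ℓ] g) :
    differential ℓ f = differential ℓ g :=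
  (pull_eventuallyEq h).fderiv_eq

lemma pull_add (f g : ℙ ℂ V → ℂ) : pull (f + g) = pull f + pull g := by
  funext v
  by_cases h : v = 0 <;> simp [pull, h]

lemma pull_mul (f g : ℙ ℂ V → ℂ) : pull (f * g) = pull f * pull g := by
  funext v
  by_cases h : v = 0 <;> simp [pull, h]

lemma differential_add {f g : ℙ ℂ V → ℂ} {ℓ : ℙ ℂ V} (hf : IsHolomorphicAt ℓ f)
    (hg : IsHolomorphicAt ℓ g) : differential ℓ (f + g) = differential ℓ f + differential ℓ g := by
  rw [differential, pull_add, fderiv_add hf.differentiableAt hg.differentiableAt]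
  rfl

lemma differential_mul {f g : ℙ ℂ V → ℂ} {ℓ : ℙ ℂ V} (hf : IsHolomorphicAt ℓ f)
    (hg : IsHolomorphicAt ℓ g) :
    differential ℓ (f * g) = f ℓ • differential ℓ g + g ℓ • differential ℓ f := by
  rw [differential, pull_mul, fderiv_mul hf.differentiableAt hg.differentiableAt, pull_rep,
    pull_rep]
  rfl

lemma differential_const (ℓ : ℙ ℂ V) (c : ℂ) : differential ℓ (fun _ => c) = 0 := by
  have : pull (fun _ : ℙ ℂ V => c) =ᶠ[𝓝 ℓ.rep] fun _ => c := by
    filter_upwards [isOpen_ne.mem_nhds ℓ.rep_nonzero] with v hv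
    rw [pull_of_ne hv]
  rw [differential, this.fderiv_eq]
  simp

lemma differential_div [FiniteDimensional ℂ V] (φ φ₀ : Module.Dual ℂ V) {ℓ : ℙ ℂ V}
    (h : φ₀ ℓ.rep = 1) (w : V) :
    differential ℓ (fun m => φ m.rep / φ₀ m.rep) w = φ w - φ ℓ.rep * φ₀ w := by
  let φ' := LinearMap.toContinuousLinearMap φ
  let φ₀' := LinearMap.toContinuousLinearMap φ₀
  have h0 : φ₀' ℓ.rep = 1 := h
  have hreg : IsHolomorphicAt ℓ (fun m : ℙ ℂ V => φ m.rep / φ₀ m.rep) :=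
    (isRegularAt_div φ φ₀ (by rw [h]; exact one_ne_zero)).isHolomorphicAt
  have h1 : pull (fun m : ℙ ℂ V => φ m.rep / φ₀ m.rep) * ⇑φ₀' =ᶠ[𝓝 ℓ.rep] φ' := by
    filter_upwards [isOpen_ne.mem_nhds ℓ.rep_nonzero,
      (isOpen_ne.preimage φ₀'.continuous).mem_nhds (by rw [Set.mem_preimage, h0]; exact one_ne_zero)]
      with v hv hv0
    rw [Pi.mul_apply, pull_of_ne hv]
    obtain ⟨c, hc, h⟩ := exists_rep_mk_eq hv
    rw [h, map_smul, map_smul, smul_eq_mul, smul_eq_mul, mul_div_mul_left _ _ hc]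
    exact div_mul_cancel₀ _ hv0
  have h2 := h1.fderiv_eq (𝕜 := ℂ)
  rw [fderiv_mul hreg.differentiableAt φ₀'.differentiableAt, pull_rep, h0, one_smul,
    ContinuousLinearMap.fderiv, ContinuousLinearMap.fderiv] at h2
  have h3 := DFunLike.congr_fun h2 w
  simp only [_root_.add_apply, _root_.smul_apply, smul_eq_mul, h,
    div_one] at h3
  change _ = φ w at h3
  change φ ℓ.rep * φ₀ w + _ = _ at h3
  rw [← h3, add_sub_cancel_left]
  rfl

end RegularFunctions

/-! ### The local ring at a point -/

section LocalRing

open Filter IsLocalRing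

variable {V : Type*} [NormedAddCommGroup V] [NormedSpace ℂ V]

/-- The germ at `ℓ` of a function that is regular at `ℓ`. -/
def germ {ℓ : ℙ ℂ V} (f : ℙ ℂ V → ℂ) (hf : IsRegularAt ℓ f) : LocalRing ℓ :=
  ⟨(f : (𝓝 ℓ).Germ ℂ), f, hf, rfl⟩

lemma germ_eq_iff {ℓ : ℙ ℂ V} {f g : ℙ ℂ V → ℂ} {hf : IsRegularAt ℓ f} {hg : IsRegularAt ℓ g} :
    germ f hf = germ g hg ↔ f =ᶠ[𝓝 ℓ] g := by
  rw [← Germ.coe_eq]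
  exact Subtype.ext_iff

lemma exists_germ_eq {ℓ : ℙ ℂ V} (x : LocalRing ℓ) : ∃ f hf, germ f hf = x := by
  obtain ⟨_, f, hf, rfl⟩ := x
  exact ⟨f, hf, rfl⟩

/-- The value at `ℓ` of a germ. -/
def germValue (ℓ : ℙ ℂ V) : LocalRing ℓ →+* ℂ :=
  (Filter.Germ.valueRingHom (x := ℓ)).comp (LocalRing ℓ).subtype

lemma germValue_germ {ℓ : ℙ ℂ V} {f : ℙ ℂ V → ℂ} (hf : IsRegularAt ℓ f) :
    germValue ℓ (germ f hf) = f ℓ := rfl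

/-- The differential of a germ, as a linear form on `V`. -/
def germDifferential (ℓ : ℙ ℂ V) (x : LocalRing ℓ) : V →L[ℂ] ℂ :=
  Germ.liftOn (x : (𝓝 ℓ).Germ ℂ) (differential ℓ) fun _ _ h => differential_congr h

lemma germDifferential_germ {ℓ : ℙ ℂ V} {f : ℙ ℂ V → ℂ} (hf : IsRegularAt ℓ f) :
    germDifferential ℓ (germ f hf) = differential ℓ f := rfl

/-- The constants in the local ring. -/
def germConst (ℓ : ℙ ℂ V) : ℂ →+* LocalRing ℓ where
  toFun c := germ (fun _ => c) (isRegularAt_const ℓ c)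
  map_one' := rfl
  map_mul' _ _ := rfl
  map_zero' := rfl
  map_add' _ _ := rfl

lemma germValue_const (ℓ : ℙ ℂ V) (c : ℂ) : germValue ℓ (germConst ℓ c) = c := rfl

lemma germDifferential_const (ℓ : ℙ ℂ V) (c : ℂ) : germDifferential ℓ (germConst ℓ c) = 0 :=
  differential_const ℓ c

lemma germDifferential_zero (ℓ : ℙ ℂ V) : germDifferential ℓ 0 = 0 := differential_const ℓ 0

section FiniteDimensional

variable [FiniteDimensional ℂ V]

lemma germDifferential_add (ℓ : ℙ ℂ V) (x y : LocalRing ℓ) :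
    germDifferential ℓ (x + y) = germDifferential ℓ x + germDifferential ℓ y := by
  obtain ⟨f, hf, rfl⟩ := exists_germ_eq x
  obtain ⟨g, hg, rfl⟩ := exists_germ_eq y
  exact differential_add hf.isHolomorphicAt hg.isHolomorphicAt

lemma germDifferential_mul (ℓ : ℙ ℂ V) (x y : LocalRing ℓ) :
    germDifferential ℓ (x * y) =
      germValue ℓ x • germDifferential ℓ y + germValue ℓ y • germDifferential ℓ x := by
  obtain ⟨f, hf, rfl⟩ := exists_germ_eq x
  obtain ⟨g, hg, rfl⟩ := exists_germ_eq y
  exact differential_mul hf.isHolomorphicAt hg.isHolomorphicAt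

lemma germDifferential_sum (ℓ : ℙ ℂ V) {ι : Type*} (s : Finset ι) (x : ι → LocalRing ℓ) :
    germDifferential ℓ (∑ i ∈ s, x i) = ∑ i ∈ s, germDifferential ℓ (x i) := by
  classical
  induction s using Finset.induction_on with
  | empty => simp [germDifferential_zero]
  | insert a s ha ih => rw [Finset.sum_insert ha, Finset.sum_insert ha, germDifferential_add, ih]

lemma germDifferential_sub (ℓ : ℙ ℂ V) (x y : LocalRing ℓ) :
    germDifferential ℓ (x - y) = germDifferential ℓ x - germDifferential ℓ y := by
  rw [eq_sub_iff_add_eq, ← germDifferential_add, sub_add_cancel]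

lemma isUnit_iff_germValue_ne_zero {ℓ : ℙ ℂ V} (x : LocalRing ℓ) :
    IsUnit x ↔ germValue ℓ x ≠ 0 := by
  constructor
  · intro h
    exact (h.map (germValue ℓ)).ne_zero
  · intro h
    obtain ⟨f, hf, rfl⟩ := exists_germ_eq x
    rw [germValue_germ] at h
    refine IsUnit.of_mul_eq_one (germ _ (hf.inv h)) ?_
    change germ _ (hf.mul (hf.inv h)) = germ _ (isRegularAt_const ℓ 1)
    rw [germ_eq_iff]
    filter_upwards [hf.eventually_ne_zero h] with m hm
    exact mul_inv_cancel₀ hm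

instance isLocalRing_localRing (ℓ : ℙ ℂ V) : IsLocalRing (LocalRing ℓ) := by
  apply IsLocalRing.of_nonunits_add
  intro a b ha hb
  rw [mem_nonunits_iff, isUnit_iff_germValue_ne_zero, not_not] at *
  rw [map_add, ha, hb, add_zero]

lemma mem_maximalIdeal_iff {ℓ : ℙ ℂ V} {x : LocalRing ℓ} :
    x ∈ maximalIdeal (LocalRing ℓ) ↔ germValue ℓ x = 0 := by
  rw [IsLocalRing.mem_maximalIdeal, mem_nonunits_iff, isUnit_iff_germValue_ne_zero, not_not]

/-- An ideal of the local ring is proper if and only if all its elements vanish at the point. -/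
lemma ne_top_iff_germValue {ℓ : ℙ ℂ V} {I : Ideal (LocalRing ℓ)} :
    I ≠ ⊤ ↔ ∀ x ∈ I, germValue ℓ x = 0 := by
  constructor
  · intro h x hx
    exact mem_maximalIdeal_iff.mp (le_maximalIdeal h hx)
  · intro h htop
    have := h 1 (by rw [htop]; trivial)
    simp at this

end FiniteDimensional

/-! ### Affine coordinates at a point -/

open Module

section Coordinates

variable {ℓ : ℙ ℂ V} (e : Basis (Fin 6) ℂ V)

/-- The affine coordinate functions on `ℙ(V)` of a basis of `V`. -/
def affineCoord (i : Fin 5) (m : ℙ ℂ V) : ℂ := e.coord i.succ m.rep / e.coord 0 m.rep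

/-- The point of the affine chart with given affine coordinates. -/
def chartVector (t : Fin 5 → ℂ) : V := e 0 + ∑ i, t i • e i.succ

lemma coord_chartVector_zero (t : Fin 5 → ℂ) : e.coord 0 (chartVector e t) = 1 := by
  simp [chartVector]

lemma coord_chartVector_succ (t : Fin 5 → ℂ) (i : Fin 5) :
    e.coord i.succ (chartVector e t) = t i := by
  simp [chartVector, Finsupp.single_apply, Fin.succ_ne_zero]

lemma rep_eq_smul_chartVector {m : ℙ ℂ V} (hm : e.coord 0 m.rep ≠ 0) :
    m.rep = e.coord 0 m.rep • chartVector e fun i => affineCoord e i m := by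
  apply e.repr.injective
  ext j
  rw [← Basis.coord_apply, ← Basis.coord_apply, map_smul, smul_eq_mul]
  refine Fin.cases ?_ (fun i => ?_) j
  · rw [coord_chartVector_zero, mul_one]
  · rw [coord_chartVector_succ, affineCoord, mul_div_cancel₀ _ hm]

lemma affineCoord_mk_chartVector (t : Fin 5 → ℂ) (h : chartVector e t ≠ 0) (i : Fin 5) :
    affineCoord e i (Projectivization.mk ℂ _ h) = t i := by
  obtain ⟨c, hc, hrep⟩ := exists_rep_mk_eq h
  rw [affineCoord, hrep, map_smul, map_smul, coord_chartVector_zero, coord_chartVector_succ,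
    smul_eq_mul, smul_eq_mul, mul_div_mul_left _ _ hc, div_one]

lemma chartVector_ne_zero (t : Fin 5 → ℂ) : chartVector e t ≠ 0 := by
  intro h
  have := coord_chartVector_zero e t
  rw [h, map_zero] at this
  exact zero_ne_one this

/-- Dehomogenization of a polynomial in the linear forms. -/
def dehomogenize (p : MvPolynomial (Dual ℂ V) ℂ) : MvPolynomial (Fin 5) ℂ :=
  MvPolynomial.aeval (fun φ : Dual ℂ V =>
    MvPolynomial.C (φ (e 0)) + ∑ i, MvPolynomial.C (φ (e i.succ)) * MvPolynomial.X i) p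

lemma eval_dehomogenize (p : MvPolynomial (Dual ℂ V) ℂ) (t : Fin 5 → ℂ) :
    MvPolynomial.eval t (dehomogenize e p) = polyVal p (chartVector e t) := by
  rw [dehomogenize, polyVal, MvPolynomial.aeval_def, ← MvPolynomial.coe_eval₂Hom,
    ← RingHom.comp_apply]
  congr 1
  apply MvPolynomial.ringHom_ext
  · intro r; simp
  · intro φ; simp [chartVector, mul_comm]

lemma isRegularAt_affineCoord (he : e 0 = ℓ.rep) (i : Fin 5) : IsRegularAt ℓ (affineCoord e i) :=
  isRegularAt_div _ _ (by rw [← he]; simp)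

lemma affineCoord_self (he : e 0 = ℓ.rep) (i : Fin 5) : affineCoord e i ℓ = 0 := by
  rw [affineCoord, ← he]
  simp

/-- The affine coordinates as germs. -/
def germCoord (he : e 0 = ℓ.rep) (i : Fin 5) : LocalRing ℓ :=
  germ (affineCoord e i) (isRegularAt_affineCoord e he i)

lemma germValue_coord (he : e 0 = ℓ.rep) (i : Fin 5) : germValue ℓ (germCoord e he i) = 0 :=
  affineCoord_self e he i

lemma germDifferential_coord (he : e 0 = ℓ.rep) [FiniteDimensional ℂ V] (i : Fin 5) (w : V) :
    germDifferential ℓ (germCoord e he i) w = e.coord i.succ w := by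
  have h := differential_div (e.coord i.succ) (e.coord 0) (ℓ := ℓ) (by rw [← he]; simp) w
  have h0 : e.coord i.succ ℓ.rep = 0 := by
    rw [← he]; simp
  rw [h0, zero_mul, sub_zero] at h
  exact h

lemma linearIndependent_germDifferential_coord (he : e 0 = ℓ.rep) [FiniteDimensional ℂ V] :
    LinearIndependent ℂ fun i => germDifferential ℓ (germCoord e he i) := by
  rw [Fintype.linearIndependent_iff]
  intro g hg j
  have h := DFunLike.congr_fun hg (e j.succ)
  simp only [_root_.sum_apply, _root_.smul_apply, germDifferential_coord,
    smul_eq_mul] at h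
  simpa [Finsupp.single_apply] using h

/-- Polynomials in the affine coordinates, as germs. -/
def polyGerm (he : e 0 = ℓ.rep) : MvPolynomial (Fin 5) ℂ →+* LocalRing ℓ :=
  MvPolynomial.eval₂Hom (germConst ℓ) (germCoord e he)

lemma polyGerm_eq (he : e 0 = ℓ.rep) (p : MvPolynomial (Fin 5) ℂ) :
    (polyGerm e he p : (𝓝 ℓ).Germ ℂ) =
      ((fun m => MvPolynomial.eval (fun i => affineCoord e i m) p : ℙ ℂ V → ℂ) :
        (𝓝 ℓ).Germ ℂ) := by
  let ψ : MvPolynomial (Fin 5) ℂ →+* (ℙ ℂ V → ℂ) :=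
    RingHom.pi fun m => MvPolynomial.eval fun i => affineCoord e i m
  have h : (LocalRing ℓ).subtype.comp (polyGerm e he) =
      (Filter.Germ.coeRingHom (𝓝 ℓ)).comp ψ := by
    apply MvPolynomial.ringHom_ext
    · intro r
      have : ψ (MvPolynomial.C r) = fun _ => r := by funext m; simp [ψ, RingHom.pi_apply]
      rw [RingHom.comp_apply, RingHom.comp_apply, this]
      simp [polyGerm]
      rfl
    · intro i
      have : ψ (MvPolynomial.X i) = affineCoord e i := by funext m; simp [ψ, RingHom.pi_apply]
      rw [RingHom.comp_apply, RingHom.comp_apply, this]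
      simp [polyGerm]
      rfl
  exact RingHom.congr_fun h p

lemma germValue_polyGerm (he : e 0 = ℓ.rep) (p : MvPolynomial (Fin 5) ℂ) :
    germValue ℓ (polyGerm e he p) = MvPolynomial.eval 0 p := by
  change Filter.Germ.value (polyGerm e he p : (𝓝 ℓ).Germ ℂ) = _
  rw [polyGerm_eq]
  change MvPolynomial.eval (fun i => affineCoord e i ℓ) p = _
  congr 2
  funext i
  exact affineCoord_self e he i

lemma polyGerm_injective (he : e 0 = ℓ.rep) : Function.Injective (polyGerm e he) := by
  rw [injective_iff_map_eq_zero]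
  intro p hp
  have h1 : ((fun m => MvPolynomial.eval (fun i => affineCoord e i m) p : ℙ ℂ V → ℂ) :
      (𝓝 ℓ).Germ ℂ) = ((0 : ℙ ℂ V → ℂ) : (𝓝 ℓ).Germ ℂ) := by
    rw [← polyGerm_eq e he, hp]; rfl
  have h2 := eventually_mk (Germ.coe_eq.mp h1)
  have hcont : Continuous (chartVector e) := by unfold chartVector; fun_prop
  have h0 : chartVector e 0 = ℓ.rep := by simp [chartVector, he]
  rw [← h0] at h2
  have h3 := hcont.continuousAt.eventually h2
  have h4 : (fun t => MvPolynomial.eval t p) = fun _ : Fin 5 → ℂ => (0 : ℂ) := by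
    have han : AnalyticOnNhd ℂ (fun t : Fin 5 → ℂ => MvPolynomial.eval t p) Set.univ := by
      intro t _
      have h := AnalyticAt.aeval_mvPolynomial (𝕜 := ℂ) (A := ℂ) (z := t)
        (f := fun (t : Fin 5 → ℂ) (i : Fin 5) => t i)
        (fun i => (ContinuousLinearMap.proj (R := ℂ) (φ := fun _ : Fin 5 => ℂ) i).analyticAt t) p
      have h2 : (fun x : Fin 5 → ℂ => MvPolynomial.aeval (fun i => x i) p) =
          fun t => MvPolynomial.eval t p := by
        funext x
        rw [MvPolynomial.aeval_eq_eval]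
      rw [h2] at h
      exact h
    refine han.eq_of_eventuallyEq (z₀ := 0) (fun t _ => analyticAt_const) ?_
    filter_upwards [h3] with t ht
    have h5 := ht (chartVector_ne_zero e t)
    simp only [affineCoord_mk_chartVector] at h5
    exact h5
  exact MvPolynomial.funext fun t => by simpa using congrFun h4 t

lemma exists_polyGerm_fraction (he : e 0 = ℓ.rep) (x : LocalRing ℓ) :
    ∃ p q : MvPolynomial (Fin 5) ℂ, MvPolynomial.eval 0 q ≠ 0 ∧
      x * polyGerm e he q = polyGerm e he p := by
  obtain ⟨_, f, ⟨d, p, q, hp, hq, hq0, hf⟩, rfl⟩ := x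
  have h0 : chartVector e 0 = ℓ.rep := by simp [chartVector, he]
  refine ⟨dehomogenize e p, dehomogenize e q, by rw [eval_dehomogenize, h0]; exact hq0, ?_⟩
  apply Subtype.ext
  rw [Subring.coe_mul, polyGerm_eq, polyGerm_eq]
  change ((f * _ : ℙ ℂ V → ℂ) : (𝓝 ℓ).Germ ℂ) = _
  have : FiniteDimensional ℂ V := e.finiteDimensional_of_finite
  have hc0 : polyVal (MvPolynomial.X (e.coord 0)) ℓ.rep ≠ 0 := by simp [polyVal, ← he]
  rw [Germ.coe_eq]
  filter_upwards [(isOpen_polyVal_ne_zero hq).mem_nhds hq0,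
    (isOpen_polyVal_ne_zero (MvPolynomial.isHomogeneous_X _ (e.coord 0))).mem_nhds hc0]
    with m hm hm0
  have hm0' : e.coord 0 m.rep ≠ 0 := by simpa [polyVal] using hm0
  have hrep := rep_eq_smul_chartVector e hm0'
  simp only [Pi.mul_apply, eval_dehomogenize]
  set t : Fin 5 → ℂ := fun i => affineCoord e i m
  have hpv : polyVal p m.rep = (e.coord 0 m.rep) ^ d * polyVal p (chartVector e t) := by
    conv_lhs => rw [hrep]
    rw [polyVal_smul hp]
  have hqv : polyVal q m.rep = (e.coord 0 m.rep) ^ d * polyVal q (chartVector e t) := by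
    conv_lhs => rw [hrep]
    rw [polyVal_smul hq]
  have hqt : polyVal q (chartVector e t) ≠ 0 := by
    intro h
    change polyVal q m.rep ≠ 0 at hm
    rw [hqv, h, mul_zero] at hm
    exact hm rfl
  rw [hf m hm, hpv, hqv, mul_div_mul_left _ _ (pow_ne_zero _ hm0'), div_mul_cancel₀ _ hqt]

/-- The ideal of the origin in the polynomial ring of the chart. -/
def originIdeal : Ideal (MvPolynomial (Fin 5) ℂ) :=
  RingHom.ker (MvPolynomial.eval (0 : Fin 5 → ℂ))

instance originIdeal_isPrime : originIdeal.IsPrime := RingHom.ker_isPrime _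

/-- The local ring of `ℙ(V)` at `ℓ` is the localization of the polynomial ring of the chart at the
origin. -/
lemma nonempty_localization_equiv (he : e 0 = ℓ.rep) :
    Nonempty (Localization.AtPrime originIdeal ≃+* LocalRing ℓ) := by
  have : FiniteDimensional ℂ V := e.finiteDimensional_of_finite
  let : Algebra (MvPolynomial (Fin 5) ℂ) (LocalRing ℓ) := (polyGerm e he).toAlgebra
  have halg : ∀ p, algebraMap (MvPolynomial (Fin 5) ℂ) (LocalRing ℓ) p = polyGerm e he p :=
    fun _ => rfl
  have : IsLocalization.AtPrime (LocalRing ℓ) originIdeal := by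
    refine (isLocalization_iff _ _).mpr ⟨?_, ?_, ?_⟩
    · rintro ⟨q, hq⟩
      rw [halg, isUnit_iff_germValue_ne_zero, germValue_polyGerm]
      exact hq
    · intro x
      obtain ⟨p, q, hq, h⟩ := exists_polyGerm_fraction e he x
      exact ⟨(p, ⟨q, hq⟩), h⟩
    · intro p q h
      exact ⟨1, by rw [polyGerm_injective e he h]⟩
  exact ⟨(IsLocalization.algEquiv originIdeal.primeCompl
    (Localization.AtPrime originIdeal) (LocalRing ℓ)).toRingEquiv⟩

end Coordinates

end LocalRing

/-! ### Regularity and dimension of quotients of the local ring -/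

section Dimension

open Filter IsLocalRing Module

variable {V : Type*} [NormedAddCommGroup V] [NormedSpace ℂ V] {ℓ : ℙ ℂ V}

lemma exists_basis_zero_eq_rep (hV : finrank ℂ V = 6) (ℓ : ℙ ℂ V) :
    ∃ e : Basis (Fin 6) ℂ V, e 0 = ℓ.rep := exists_basis_zero_eq hV ℓ.rep_nonzero

lemma isRegularLocalRing_localRing (hV : finrank ℂ V = 6) (ℓ : ℙ ℂ V) :
    IsRegularLocalRing (LocalRing ℓ) := by
  obtain ⟨e, he⟩ := exists_basis_zero_eq_rep hV ℓ
  obtain ⟨φ⟩ := nonempty_localization_equiv e he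
  have := IsRegularRing.isRegularLocalRing_localization originIdeal
  exact IsRegularLocalRing.of_ringEquiv φ

lemma isDomain_localRing (hV : finrank ℂ V = 6) (ℓ : ℙ ℂ V) : IsDomain (LocalRing ℓ) := by
  obtain ⟨e, he⟩ := exists_basis_zero_eq_rep hV ℓ
  obtain ⟨φ⟩ := nonempty_localization_equiv e he
  exact φ.symm.injective.isDomain (φ.symm : LocalRing ℓ →+* Localization.AtPrime originIdeal)

lemma finrank_span_le_ncard {S : Set (V →L[ℂ] ℂ)} (hS : S.Finite) :
    finrank ℂ (Submodule.span ℂ S) ≤ S.ncard := by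
  have := hS.fintype
  rw [Set.ncard_eq_toFinset_card']
  exact finrank_span_le_card S

variable [FiniteDimensional ℂ V]

lemma germDifferential_mul_of_value_eq_zero (a x : LocalRing ℓ) (hx : germValue ℓ x = 0) :
    germDifferential ℓ (a * x) = germValue ℓ a • germDifferential ℓ x := by
  ext w
  rw [germDifferential_mul]
  simp [hx]

lemma germDifferential_const_mul (c : ℂ) (x : LocalRing ℓ) :
    germDifferential ℓ (germConst ℓ c * x) = c • germDifferential ℓ x := by
  ext w
  rw [germDifferential_mul, germDifferential_const, germValue_const]
  simp

/-- Polynomials without constant term are combinations of the coordinates. -/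
lemma mem_span_X_of_eval_zero (p : MvPolynomial (Fin 5) ℂ) (hp : MvPolynomial.eval 0 p = 0) :
    p ∈ Ideal.span (Set.range (MvPolynomial.X : Fin 5 → MvPolynomial (Fin 5) ℂ)) := by
  have h : ∀ q : MvPolynomial (Fin 5) ℂ, q - MvPolynomial.C (MvPolynomial.eval 0 q) ∈
      Ideal.span (Set.range (MvPolynomial.X : Fin 5 → MvPolynomial (Fin 5) ℂ)) := by
    intro q
    induction q using MvPolynomial.induction_on with
    | C a => simp
    | add p q hp hq =>
      have := Ideal.add_mem _ hp hq
      convert this using 1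
      simp only [map_add]
      ring
    | mul_X p i hp =>
      simp only [map_mul, MvPolynomial.eval_X, Pi.zero_apply, mul_zero, map_zero, sub_zero]
      exact Ideal.mul_mem_left _ _ (Ideal.subset_span ⟨i, rfl⟩)
  have := h p
  rwa [hp, map_zero, sub_zero] at this

lemma maximalIdeal_eq_span_coord (e : Basis (Fin 6) ℂ V) (he : e 0 = ℓ.rep) :
    maximalIdeal (LocalRing ℓ) = Ideal.span (Set.range (germCoord e he)) := by
  apply le_antisymm
  · intro x hx
    obtain ⟨p, q, hq, h⟩ := exists_polyGerm_fraction e he x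
    have hu : IsUnit (polyGerm e he q) := by
      rw [isUnit_iff_germValue_ne_zero, germValue_polyGerm]; exact hq
    rw [← Ideal.mul_unit_mem_iff_mem _ hu, h]
    have hp0 : MvPolynomial.eval 0 p = 0 := by
      rw [← germValue_polyGerm e he, ← h, map_mul, mem_maximalIdeal_iff.mp hx, zero_mul]
    have h2 := Ideal.mem_map_of_mem (polyGerm e he) (mem_span_X_of_eval_zero p hp0)
    rw [Ideal.map_span, ← Set.range_comp] at h2
    have h3 : polyGerm e he ∘ MvPolynomial.X = germCoord e he := by
      funext i; simp [polyGerm]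
    rwa [h3] at h2
  · rw [Ideal.span_le]
    rintro _ ⟨i, rfl⟩
    exact mem_maximalIdeal_iff.mpr (germValue_coord e he i)

lemma germDifferential_mem_span {S : Set (LocalRing ℓ)} (hS : ∀ s ∈ S, germValue ℓ s = 0)
    {x : LocalRing ℓ} (hx : x ∈ Ideal.span S) :
    germValue ℓ x = 0 ∧ germDifferential ℓ x ∈ Submodule.span ℂ (germDifferential ℓ '' S) := by
  induction hx using Submodule.span_induction with
  | mem x hx => exact ⟨hS x hx, Submodule.subset_span ⟨x, hx, rfl⟩⟩
  | zero => exact ⟨map_zero _, by rw [germDifferential_zero]; exact zero_mem _⟩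
  | add x y _ _ hx hy =>
    refine ⟨by rw [map_add, hx.1, hy.1, add_zero], ?_⟩
    rw [germDifferential_add]
    exact add_mem hx.2 hy.2
  | smul a x _ hx =>
    refine ⟨by rw [smul_eq_mul, map_mul, hx.1, mul_zero], ?_⟩
    rw [smul_eq_mul, germDifferential_mul_of_value_eq_zero _ _ hx.1]
    exact Submodule.smul_mem _ _ hx.2

lemma exists_germDifferential_eq {S : Set (LocalRing ℓ)} {φ : V →L[ℂ] ℂ}
    (hφ : φ ∈ Submodule.span ℂ (germDifferential ℓ '' S)) :
    ∃ x ∈ Ideal.span S, germDifferential ℓ x = φ := by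
  induction hφ using Submodule.span_induction with
  | mem φ hφ =>
    obtain ⟨x, hx, rfl⟩ := hφ
    exact ⟨x, Ideal.subset_span hx, rfl⟩
  | zero => exact ⟨0, zero_mem _, germDifferential_zero ℓ⟩
  | add φ ψ _ _ hφ hψ =>
    obtain ⟨x, hx, rfl⟩ := hφ
    obtain ⟨y, hy, rfl⟩ := hψ
    exact ⟨x + y, add_mem hx hy, germDifferential_add ℓ x y⟩
  | smul c φ _ hφ =>
    obtain ⟨x, hx, rfl⟩ := hφ
    exact ⟨germConst ℓ c * x, Ideal.mul_mem_left _ _ hx, germDifferential_const_mul c x⟩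

/-- Germs with vanishing value and differential lie in the square of the maximal ideal. -/
lemma mem_maximalIdeal_sq (hV : finrank ℂ V = 6) {x : LocalRing ℓ} (hx : germValue ℓ x = 0)
    (hdx : germDifferential ℓ x = 0) :
    x ∈ maximalIdeal (LocalRing ℓ) • maximalIdeal (LocalRing ℓ) := by
  obtain ⟨e, he⟩ := exists_basis_zero_eq_rep hV ℓ
  have hmem := mem_maximalIdeal_iff.mpr hx
  rw [maximalIdeal_eq_span_coord e he, Ideal.mem_span_range_iff_exists_fun] at hmem
  obtain ⟨c, rfl⟩ := hmem
  rw [germDifferential_sum] at hdx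
  simp only [germDifferential_mul_of_value_eq_zero _ _ (germValue_coord e he _)] at hdx
  have hc := Fintype.linearIndependent_iff.mp
    (linearIndependent_germDifferential_coord e he) _ hdx
  refine Submodule.sum_mem _ fun i _ => ?_
  exact Submodule.smul_mem_smul (mem_maximalIdeal_iff.mpr (hc i))
    (mem_maximalIdeal_iff.mpr (germValue_coord e he i))

lemma finrank_span_coord (e : Basis (Fin 6) ℂ V) (he : e 0 = ℓ.rep) :
    finrank ℂ (Submodule.span ℂ (germDifferential ℓ '' Set.range (germCoord e he))) = 5 := by
  rw [← Set.range_comp]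
  exact finrank_span_eq_card (linearIndependent_germDifferential_coord e he)

/-- Generators of the maximal ideal have at least five independent differentials. -/
lemma five_le_finrank_span (hV : finrank ℂ V = 6) {S : Set (LocalRing ℓ)}
    (hS : Ideal.span S = maximalIdeal (LocalRing ℓ)) :
    5 ≤ finrank ℂ (Submodule.span ℂ (germDifferential ℓ '' S)) := by
  obtain ⟨e, he⟩ := exists_basis_zero_eq_rep hV ℓ
  have hS0 : ∀ s ∈ S, germValue ℓ s = 0 := fun s hs =>
    mem_maximalIdeal_iff.mp (hS ▸ Ideal.subset_span hs)
  rw [← finrank_span_coord e he]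
  apply Submodule.finrank_mono
  rw [Submodule.span_le]
  rintro _ ⟨_, ⟨i, rfl⟩, rfl⟩
  refine (germDifferential_mem_span hS0 ?_).2
  rw [hS, mem_maximalIdeal_iff, germValue_coord]

lemma spanFinrank_maximalIdeal_localRing (hV : finrank ℂ V = 6) :
    (maximalIdeal (LocalRing ℓ)).spanFinrank = 5 := by
  have := isRegularLocalRing_localRing hV ℓ
  obtain ⟨e, he⟩ := exists_basis_zero_eq_rep hV ℓ
  apply le_antisymm
  · rw [maximalIdeal_eq_span_coord e he]
    refine (Submodule.spanFinrank_span_le_ncard_of_finite (Set.finite_range _)).trans ?_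
    rw [← Set.image_univ]
    exact (Set.ncard_image_le).trans (by simp)
  · have hfg := (maximalIdeal (LocalRing ℓ)).fg_of_isNoetherianRing
    have h1 := five_le_finrank_span hV (S := (maximalIdeal (LocalRing ℓ)).generators)
      (Submodule.span_generators _)
    rw [← Submodule.FG.generators_ncard hfg]
    have hfin := Submodule.FG.finite_generators hfg
    refine h1.trans ((finrank_span_le_ncard ?_).trans (Set.ncard_image_le hfin))
    exact hfin.image _

lemma ringKrullDim_localRing (hV : finrank ℂ V = 6) (ℓ : ℙ ℂ V) :
    ringKrullDim (LocalRing ℓ) = 5 := by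
  have := isRegularLocalRing_localRing hV ℓ
  rw [← IsRegularLocalRing.spanFinrank_maximalIdeal, spanFinrank_maximalIdeal_localRing hV]
  rfl

lemma isLocalRing_quotient {I : Ideal (LocalRing ℓ)} (hI : I ≠ ⊤) :
    IsLocalRing (LocalRing ℓ ⧸ I) := by
  have : Nontrivial (LocalRing ℓ ⧸ I) := Ideal.Quotient.nontrivial_iff.mpr hI
  exact IsLocalRing.of_surjective' (Ideal.Quotient.mk I) Ideal.Quotient.mk_surjective

lemma map_mk_maximalIdeal {I : Ideal (LocalRing ℓ)} [IsLocalRing (LocalRing ℓ ⧸ I)] :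
    (maximalIdeal (LocalRing ℓ)).map (Ideal.Quotient.mk I) = maximalIdeal (LocalRing ℓ ⧸ I) := by
  have h := IsLocalRing.eq_maximalIdeal
    (Ideal.comap_isMaximal_of_surjective (Ideal.Quotient.mk I) Ideal.Quotient.mk_surjective
      (K := maximalIdeal (LocalRing ℓ ⧸ I)))
  rw [← h, Ideal.map_comap_of_surjective _ Ideal.Quotient.mk_surjective]

/-- The Jacobian criterion, sufficiency: functions with independent differentials cut out a
smooth subscheme of the expected codimension. -/
theorem isRegularLocalRing_quotient (hV : finrank ℂ V = 6) {c : ℕ} (f : Fin c → LocalRing ℓ)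
    (hf : ∀ i, germValue ℓ (f i) = 0)
    (hli : LinearIndependent ℂ fun i => germDifferential ℓ (f i)) :
    IsRegularLocalRing (LocalRing ℓ ⧸ Ideal.span (Set.range f)) ∧
      ringKrullDim (LocalRing ℓ) = ringKrullDim (LocalRing ℓ ⧸ Ideal.span (Set.range f)) + c := by
  classical
  have := isRegularLocalRing_localRing hV ℓ
  obtain ⟨e, he⟩ := exists_basis_zero_eq_rep hV ℓ
  set m := maximalIdeal (LocalRing ℓ)
  set I := Ideal.span (Set.range f) with hIdef
  have hIm : I ≤ m := by
    rw [Ideal.span_le]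
    rintro _ ⟨i, rfl⟩
    exact mem_maximalIdeal_iff.mpr (hf i)
  have hI : I ≠ ⊤ := fun h => (maximalIdeal.isMaximal (LocalRing ℓ)).ne_top
    (top_le_iff.mp (h ▸ hIm))
  -- complete the differentials by those of some coordinates `G` to a basis of the cotangent space
  let D : LocalRing ℓ → (V →L[ℂ] ℂ) := germDifferential ℓ
  have hinj : Function.Injective f := by
    intro i j hij
    exact hli.injective (congrArg D hij)
  have hliOn : LinearIndepOn ℂ D (Set.range f) := by
    rw [linearIndepOn_range_iff hinj]
    exact hli
  obtain ⟨b, hb1, hb2, hb3, hb4⟩ := exists_linearIndepOn_extension hliOn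
    (Set.subset_union_left (t := Set.range (germCoord e he)))
  have hbfin : b.Finite := (Set.Finite.union (Set.finite_range _) (Set.finite_range _)).subset hb1
  have hb0 : ∀ x ∈ b, germValue ℓ x = 0 := by
    intro x hx
    rcases hb1 hx with ⟨i, rfl⟩ | ⟨i, rfl⟩
    exacts [hf i, germValue_coord e he i]
  have hbspan : m ≤ Ideal.span b := by
    apply Submodule.le_of_le_smul_of_le_jacobson_bot (I := m)
      (IsNoetherian.noetherian m) (maximalIdeal_le_jacobson _)
    rw [show m = Ideal.span (Set.range (germCoord e he)) from maximalIdeal_eq_span_coord e he,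
      Ideal.span_le, ← maximalIdeal_eq_span_coord e he]
    rintro _ ⟨i, rfl⟩
    have h1 : D (germCoord e he i) ∈ Submodule.span ℂ (D '' b) :=
      hb3 ⟨_, Or.inr ⟨i, rfl⟩, rfl⟩
    obtain ⟨y, hy, hyD⟩ := exists_germDifferential_eq h1
    have hy0 := (germDifferential_mem_span hb0 hy).1
    have h2 : germCoord e he i - y ∈ m • m := by
      apply mem_maximalIdeal_sq hV
      · rw [map_sub, germValue_coord, hy0, sub_zero]
      · rw [germDifferential_sub, hyD, sub_self]
    have h3 : germCoord e he i = y + (germCoord e he i - y) := by ring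
    rw [h3]
    exact add_mem (Submodule.mem_sup_left hy) (Submodule.mem_sup_right h2)
  have hcard : b.ncard = 5 := by
    have h1 : Submodule.span ℂ (D '' b) =
        Submodule.span ℂ (D '' Set.range (germCoord e he)) := by
      apply le_antisymm
      · rw [Submodule.span_le]
        rintro _ ⟨x, hx, rfl⟩
        refine (germDifferential_mem_span (S := Set.range (germCoord e he)) ?_ ?_).2
        · rintro _ ⟨i, rfl⟩; exact germValue_coord e he i
        · rw [← maximalIdeal_eq_span_coord e he, mem_maximalIdeal_iff]
          exact hb0 x hx
      · rw [Submodule.span_le]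
        rintro _ ⟨x, hx, rfl⟩
        exact hb3 ⟨x, Or.inr hx, rfl⟩
    have h2 := finrank_span_coord e he
    change finrank ℂ (Submodule.span ℂ (D '' Set.range (germCoord e he))) = 5 at h2
    rw [← h1] at h2
    have : Fintype b := hbfin.fintype
    have h3 := finrank_span_eq_card (R := ℂ) (b := fun x : b => D x) hb4
    have h4 : Set.range (fun x : b => D x) = D '' b := by
      ext; simp
    rw [h4, h2] at h3
    rw [Set.ncard_eq_toFinset_card', Set.toFinset_card, ← h3]
  have hcf : (Set.range f).ncard = c := by
    rw [← Set.image_univ, Set.ncard_image_of_injective _ hinj]; simp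
  have hc5 : c ≤ 5 := by
    rw [← hcf, ← hcard]; exact Set.ncard_le_ncard hb2 hbfin
  let G := b \ Set.range f
  have hGcard : G.ncard = 5 - c := by
    rw [← hcard, ← hcf]
    exact Set.ncard_sdiff hb2 (Set.finite_range f)
  have hGfin : G.Finite := hbfin.subset Set.sdiff_subset
  have hloc := isLocalRing_quotient hI
  have hgen : maximalIdeal (LocalRing ℓ ⧸ I) = Ideal.span (Ideal.Quotient.mk I '' G) := by
    rw [← map_mk_maximalIdeal]
    apply le_antisymm
    · refine (Ideal.map_mono hbspan).trans ?_
      rw [Ideal.map_span, Ideal.span_le]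
      rintro _ ⟨x, hx, rfl⟩
      by_cases hxf : x ∈ Set.range f
      · have : Ideal.Quotient.mk I x = 0 :=
          Ideal.Quotient.eq_zero_iff_mem.mpr (Ideal.subset_span hxf)
        rw [this]
        exact zero_mem _
      · exact Ideal.subset_span ⟨x, ⟨hx, hxf⟩, rfl⟩
    · rw [Ideal.span_le]
      rintro _ ⟨x, hx, rfl⟩
      exact Ideal.mem_map_of_mem _ (mem_maximalIdeal_iff.mpr (hb0 x hx.1))
  have hspan : (maximalIdeal (LocalRing ℓ ⧸ I)).spanFinrank ≤ 5 - c := by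
    rw [hgen]
    refine (Submodule.spanFinrank_span_le_ncard_of_finite (hGfin.image _)).trans ?_
    rw [← hGcard]
    exact Set.ncard_image_le hGfin
  have hdim5 := ringKrullDim_localRing hV ℓ
  have hlow : ringKrullDim (LocalRing ℓ) ≤ ringKrullDim (LocalRing ℓ ⧸ I) + c := by
    have h := ringKrullDim_le_ringKrullDim_quotient_add_encard (Set.range f) (by
      rw [IsLocalRing.ringJacobson_eq_maximalIdeal]
      exact fun x hx => hIm (Ideal.subset_span hx))
    rw [← (Set.finite_range f).cast_ncard_eq, hcf] at h
    exact h
  have hup := ringKrullDim_le_spanFinrank_maximalIdeal (LocalRing ℓ ⧸ I)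
  rw [hdim5] at hlow
  rw [hdim5]
  obtain ⟨n, hn⟩ : ∃ n : ℕ, ringKrullDim (LocalRing ℓ ⧸ I) = n := by
    have h1 : ringKrullDim (LocalRing ℓ ⧸ I) ≠ ⊥ := by
      intro h; rw [h] at hlow; simp at hlow
    have h2 : ringKrullDim (LocalRing ℓ ⧸ I) ≠ ⊤ := by
      intro h
      rw [h, top_le_iff] at hup
      exact absurd (WithBot.coe_injective hup) (ENat.natCast_ne_top _)
    obtain ⟨n, hn⟩ := WithBot.ne_bot_iff_exists.mp h1
    rw [← hn] at h2 ⊢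
    have h3 : n ≠ ⊤ := fun h => h2 (by rw [h]; rfl)
    obtain ⟨k, rfl⟩ := ENat.ne_top_iff_exists.mp h3
    exact ⟨k, rfl⟩
  rw [hn] at hlow hup ⊢
  have h1 : (5 : ℕ) ≤ n + c := by exact_mod_cast hlow
  have h2 : n ≤ (maximalIdeal (LocalRing ℓ ⧸ I)).spanFinrank := by exact_mod_cast hup
  constructor
  · apply IsRegularLocalRing.of_spanFinrank_maximalIdeal_le
    rw [hn]
    have : (maximalIdeal (LocalRing ℓ ⧸ I)).spanFinrank ≤ n := by omega
    exact_mod_cast this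
  · have : 5 = n + c := by omega
    exact_mod_cast this

/-- The Jacobian criterion, necessity. -/
theorem five_le_of_isRegularLocalRing_quotient (hV : finrank ℂ V = 6) {S : Set (LocalRing ℓ)}
    (hS : ∀ s ∈ S, germValue ℓ s = 0)
    (hreg : IsRegularLocalRing (LocalRing ℓ ⧸ Ideal.span S)) {d : ℕ}
    (hd : ringKrullDim (LocalRing ℓ ⧸ Ideal.span S) = d) :
    5 ≤ d + finrank ℂ (Submodule.span ℂ (germDifferential ℓ '' S)) := by
  have := isRegularLocalRing_localRing hV ℓ
  set I := Ideal.span S with hIdef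
  have hI : I ≠ ⊤ := by
    rw [ne_top_iff_germValue]
    exact fun x hx => (germDifferential_mem_span hS hx).1
  have hspan : (maximalIdeal (LocalRing ℓ ⧸ I)).spanFinrank = d := by
    have := IsRegularLocalRing.spanFinrank_maximalIdeal (R := LocalRing ℓ ⧸ I)
    rw [hd] at this
    exact_mod_cast this
  have hfg := (maximalIdeal (LocalRing ℓ ⧸ I)).fg_of_isNoetherianRing
  have hfin := Submodule.FG.finite_generators hfg
  have hcard := Submodule.FG.generators_ncard hfg
  rw [hspan] at hcard
  let lift : LocalRing ℓ ⧸ I → LocalRing ℓ := Function.surjInv Ideal.Quotient.mk_surjective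
  have hlift : ∀ x, Ideal.Quotient.mk I (lift x) = x :=
    Function.surjInv_eq Ideal.Quotient.mk_surjective
  let T := lift '' (maximalIdeal (LocalRing ℓ ⧸ I)).generators
  have hTfin : T.Finite := hfin.image _
  have hgen : Ideal.span (T ∪ S) = maximalIdeal (LocalRing ℓ) := by
    have hle : I ≤ Ideal.span (T ∪ S) := Ideal.span_mono Set.subset_union_right
    have hcomap : maximalIdeal (LocalRing ℓ) =
        (maximalIdeal (LocalRing ℓ ⧸ I)).comap (Ideal.Quotient.mk I) :=
      (IsLocalRing.eq_maximalIdeal (Ideal.comap_isMaximal_of_surjective (Ideal.Quotient.mk I)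
        Ideal.Quotient.mk_surjective)).symm
    have hmap : (Ideal.span (T ∪ S)).map (Ideal.Quotient.mk I) =
        maximalIdeal (LocalRing ℓ ⧸ I) := by
      rw [Ideal.map_span, Set.image_union, Ideal.span_union]
      have h1 : Ideal.Quotient.mk I '' T = (maximalIdeal (LocalRing ℓ ⧸ I)).generators := by
        rw [← Set.image_comp]
        simp [hlift]
      have h2 : Ideal.span (Ideal.Quotient.mk I '' S) = ⊥ := by
        rw [Ideal.span_eq_bot]
        rintro _ ⟨s, hs, rfl⟩
        exact Ideal.Quotient.eq_zero_iff_mem.mpr (Ideal.subset_span hs)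
      rw [h1, h2, sup_bot_eq]
      exact Submodule.span_generators _
    rw [hcomap, ← hmap, Ideal.comap_map_of_surjective _ Ideal.Quotient.mk_surjective]
    rw [left_eq_sup]
    intro x hx
    have : Ideal.Quotient.mk I x = 0 := hx
    exact hle (Ideal.Quotient.eq_zero_iff_mem.mp this)
  have h5 := five_le_finrank_span hV hgen
  rw [Set.image_union, Submodule.span_union] at h5
  have h6 := Submodule.finrank_add_le_finrank_add_finrank
    (Submodule.span ℂ (germDifferential ℓ '' T)) (Submodule.span ℂ (germDifferential ℓ '' S))
  have h7 : finrank ℂ (Submodule.span ℂ (germDifferential ℓ '' T)) ≤ d := by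
    refine (finrank_span_le_ncard (hTfin.image _)).trans
      ((Set.ncard_image_le hTfin).trans ((Set.ncard_image_le hfin).trans hcard.le))
  omega

end Dimension

/-! ### Ideals of minors -/

section Minors

open Matrix

variable {R : Type*} [CommRing R] {ι κ ι' κ' : Type*}

/-- The ideal generated by the `p × p`-minors of a matrix. Rows and columns may be repeated,
which adds only zeros and sign changes. -/
def minorsIdeal (p : ℕ) (M : Matrix ι κ R) : Ideal R :=
  Ideal.span {x | ∃ (r : Fin p → ι) (s : Fin p → κ), x = (M.submatrix r s).det}

lemma det_mem_minorsIdeal {p : ℕ} (M : Matrix ι κ R) (r : Fin p → ι) (s : Fin p → κ) :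
    (M.submatrix r s).det ∈ minorsIdeal p M := Ideal.subset_span ⟨r, s, rfl⟩

lemma minorsIdeal_le_iff {p : ℕ} {M : Matrix ι κ R} {I : Ideal R} :
    minorsIdeal p M ≤ I ↔ ∀ (r : Fin p → ι) (s : Fin p → κ), (M.submatrix r s).det ∈ I := by
  rw [minorsIdeal, Ideal.span_le]
  constructor
  · exact fun h r s => h ⟨r, s, rfl⟩
  · rintro h _ ⟨r, s, rfl⟩
    exact h r s

lemma minorsIdeal_transpose (p : ℕ) (M : Matrix ι κ R) : minorsIdeal p Mᵀ = minorsIdeal p M := by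
  apply le_antisymm <;> rw [minorsIdeal_le_iff] <;> intro r s
  · rw [← det_transpose]
    exact det_mem_minorsIdeal M s r
  · rw [← det_transpose]
    exact det_mem_minorsIdeal Mᵀ s r

/-- The minors of a product are combinations of those of the second factor. -/
lemma minorsIdeal_mul_le_right [Fintype ι] (p : ℕ) (X : Matrix ι' ι R) (M : Matrix ι κ R) :
    minorsIdeal p (X * M) ≤ minorsIdeal p M := by
  classical
  rw [minorsIdeal_le_iff]
  intro r s
  have h : (X * M).submatrix r s =
      Matrix.of fun i => ∑ a, X (r i) a • fun j => M a (s j) := by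
    ext i j
    simp [Matrix.mul_apply, Finset.sum_apply]
  rw [h]
  change (detRowAlternating (R := R) (n := Fin p)).toMultilinearMap
    (fun i => ∑ a, X (r i) a • fun j => M a (s j)) ∈ _
  rw [MultilinearMap.map_sum]
  refine Submodule.sum_mem _ fun f _ => ?_
  rw [MultilinearMap.map_smul_univ]
  exact Submodule.smul_mem _ _ (det_mem_minorsIdeal M f s)

lemma minorsIdeal_mul_le_left [Fintype κ] (p : ℕ) (M : Matrix ι κ R) (Z : Matrix κ κ' R) :
    minorsIdeal p (M * Z) ≤ minorsIdeal p M := by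
  rw [← minorsIdeal_transpose, transpose_mul, ← minorsIdeal_transpose p M]
  exact minorsIdeal_mul_le_right p _ _

lemma minorsIdeal_neg (p : ℕ) (M : Matrix ι κ R) : minorsIdeal p (-M) = minorsIdeal p M := by
  have h : ∀ N : Matrix ι κ R, minorsIdeal p (-N) ≤ minorsIdeal p N := by
    intro N
    rw [minorsIdeal_le_iff]
    intro r s
    change (-N.submatrix r s).det ∈ _
    rw [det_neg]
    exact Ideal.mul_mem_left _ _ (det_mem_minorsIdeal N r s)
  exact le_antisymm (h M) (by simpa using h (-M))

variable {k n : ℕ}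

/-- The ideal generated by the entries of a matrix. -/
def entriesIdeal (S : Matrix ι κ R) : Ideal R := Ideal.span (Set.range fun p : ι × κ => S p.1 p.2)

lemma minorsIdeal_diag_le (S : Matrix (Fin k) (Fin k) R) {p : ℕ} (hp : n < p) :
    minorsIdeal p (fromBlocks S 0 0 (1 : Matrix (Fin n) (Fin n) R)) ≤ entriesIdeal S := by
  rw [minorsIdeal_le_iff]
  intro r s
  rw [← Ideal.Quotient.eq_zero_iff_mem, RingHom.map_det]
  by_cases hr : ∃ i j, r i = Sum.inl j
  · obtain ⟨i, j, hij⟩ := hr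
    apply det_eq_zero_of_row_eq_zero i
    intro l
    simp only [RingHom.mapMatrix_apply, map_apply, submatrix_apply, hij]
    rcases s l with a | a
    · exact Ideal.Quotient.eq_zero_iff_mem.mpr (Ideal.subset_span ⟨(j, a), rfl⟩)
    · simp
  · -- all rows come from the unit block, so two of them agree
    push Not at hr
    have h : ∀ i, ∃ j, r i = Sum.inr j := by
      intro i
      rcases hri : r i with a | a
      · exact absurd hri (hr i a)
      · exact ⟨a, rfl⟩
    choose g hg using h
    obtain ⟨i, j, hij, hgij⟩ := Fintype.exists_ne_map_eq_of_card_lt g (by simpa using hp)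
    apply det_zero_of_row_eq hij
    funext l
    simp [hg, hgij]

lemma le_minorsIdeal_diag (S : Matrix (Fin k) (Fin k) R) :
    entriesIdeal S ≤ minorsIdeal (n + 1) (fromBlocks S 0 0 (1 : Matrix (Fin n) (Fin n) R)) := by
  rw [entriesIdeal, Ideal.span_le]
  rintro _ ⟨⟨i, j⟩, rfl⟩
  let e : Fin (n + 1) ≃ Fin n ⊕ Fin 1 := finSumFinEquiv.symm
  have h := det_mem_minorsIdeal (fromBlocks S 0 0 (1 : Matrix (Fin n) (Fin n) R))
    (Sum.elim Sum.inr (fun _ => Sum.inl i) ∘ e) (Sum.elim Sum.inr (fun _ => Sum.inl j) ∘ e)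
  rw [← submatrix_submatrix, det_submatrix_equiv_self] at h
  have h2 : (fromBlocks S 0 0 (1 : Matrix (Fin n) (Fin n) R)).submatrix
      (Sum.elim Sum.inr (fun _ : Fin 1 => Sum.inl i)) (Sum.elim Sum.inr (fun _ : Fin 1 => Sum.inl j)) =
      fromBlocks 1 0 0 (Matrix.of fun _ _ => S i j) := by
    ext a b
    rcases a with a | a <;> rcases b with b | b <;> simp
  rw [h2, det_fromBlocks_zero₂₁, det_one, one_mul, det_unique] at h
  exact h

lemma minorsIdeal_diag_eq_top (S : Matrix (Fin k) (Fin k) R) {p : ℕ} (hp : p ≤ n) :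
    minorsIdeal p (fromBlocks S 0 0 (1 : Matrix (Fin n) (Fin n) R)) = ⊤ := by
  rw [Ideal.eq_top_iff_one]
  have h := det_mem_minorsIdeal (fromBlocks S 0 0 (1 : Matrix (Fin n) (Fin n) R))
    (Sum.inr ∘ Fin.castLE hp) (Sum.inr ∘ Fin.castLE hp)
  have h2 : (fromBlocks S 0 0 (1 : Matrix (Fin n) (Fin n) R)).submatrix
      (Sum.inr ∘ Fin.castLE hp) (Sum.inr ∘ Fin.castLE hp) = 1 := by
    ext a b
    simp [Matrix.one_apply]
  rwa [h2, det_one] at h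

/-- Block elimination does not change the ideals of minors. -/
lemma minorsIdeal_fromBlocks (p : ℕ) (A : Matrix (Fin k) (Fin k) R) (B : Matrix (Fin k) (Fin n) R)
    (C : Matrix (Fin n) (Fin k) R) (D Y : Matrix (Fin n) (Fin n) R) (hDY : D * Y = 1)
    (hYD : Y * D = 1) :
    minorsIdeal p (fromBlocks A B C D) =
      minorsIdeal p (fromBlocks (A - B * Y * C) 0 0 (1 : Matrix (Fin n) (Fin n) R)) := by
  have h1 : fromBlocks A B C D =
      fromBlocks 1 (B * Y) 0 1 * fromBlocks (A - B * Y * C) 0 0 (1 : Matrix (Fin n) (Fin n) R) *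
        fromBlocks 1 0 C D := by
    simp [fromBlocks_multiply, Matrix.mul_assoc, hYD]
  have h2 : fromBlocks (A - B * Y * C) 0 0 (1 : Matrix (Fin n) (Fin n) R) =
      fromBlocks 1 (-(B * Y)) 0 1 * fromBlocks A B C D * fromBlocks 1 0 (-(Y * C)) Y := by
    simp [fromBlocks_multiply, Matrix.mul_assoc, hDY, hYD, ← Matrix.mul_assoc D Y,
      sub_eq_add_neg]
  apply le_antisymm
  · conv_lhs => rw [h1]
    exact (minorsIdeal_mul_le_left p _ _).trans (minorsIdeal_mul_le_right p _ _)
  · conv_lhs => rw [h2]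
    exact (minorsIdeal_mul_le_left p _ _).trans (minorsIdeal_mul_le_right p _ _)

end Minors

/-! ### Matrices of germs -/

section GermMatrix

open Filter Matrix

variable {V : Type*} [NormedAddCommGroup V] [NormedSpace ℂ V] {ℓ : ℙ ℂ V} {ι κ μ : Type*}

/-- The matrix of germs at `ℓ` of a matrix of functions that are regular at `ℓ`. -/
def germMatrix (M : ℙ ℂ V → Matrix ι κ ℂ) (hM : ∀ i j, IsRegularAt ℓ fun m => M m i j) :
    Matrix ι κ (LocalRing ℓ) := Matrix.of fun i j => germ (fun m => M m i j) (hM i j)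

lemma germ_sum (s : Finset ι) {f : ι → ℙ ℂ V → ℂ} (hf : ∀ i, IsRegularAt ℓ (f i)) :
    ∑ i ∈ s, germ (f i) (hf i) =
      germ (fun m => ∑ i ∈ s, f i m) (IsRegularAt.sum s fun i _ => hf i) := by
  classical
  induction s using Finset.induction_on with
  | empty => rfl
  | insert a s ha ih =>
    rw [Finset.sum_insert ha, ih]
    refine (germ_eq_iff (hf := (hf a).add (IsRegularAt.sum s fun i _ => hf i))).mpr
      (Eventually.of_forall fun m => ?_)
    exact (Finset.sum_insert (f := fun i => f i m) ha).symm

lemma germMatrix_congr {M N : ℙ ℂ V → Matrix ι κ ℂ} {hM : ∀ i j, IsRegularAt ℓ fun m => M m i j}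
    {hN : ∀ i j, IsRegularAt ℓ fun m => N m i j} (h : ∀ᶠ m in 𝓝 ℓ, M m = N m) :
    germMatrix M hM = germMatrix N hN := by
  ext i j : 1
  refine (germ_eq_iff (hf := hM i j) (hg := hN i j)).mpr ?_
  filter_upwards [h] with m hm
  rw [hm]

lemma germMatrix_mul [Fintype κ] {M : ℙ ℂ V → Matrix ι κ ℂ} {N : ℙ ℂ V → Matrix κ μ ℂ}
    (hM : ∀ i j, IsRegularAt ℓ fun m => M m i j) (hN : ∀ i j, IsRegularAt ℓ fun m => N m i j) :
    germMatrix M hM * germMatrix N hN =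
      germMatrix (fun m => M m * N m) (IsRegularAt.matrix_mul hM hN) := by
  ext i j : 1
  rw [Matrix.mul_apply]
  refine (germ_sum Finset.univ fun l => (hM i l).mul (hN l j)).trans ?_
  exact (germ_eq_iff (hg := IsRegularAt.matrix_mul hM hN i j)).mpr
    (Eventually.of_forall fun m => (Matrix.mul_apply).symm)

lemma germMatrix_det [Fintype ι] [DecidableEq ι] {M : ℙ ℂ V → Matrix ι ι ℂ}
    (hM : ∀ i j, IsRegularAt ℓ fun m => M m i j) :
    (germMatrix M hM).det = germ (fun m => (M m).det) (IsRegularAt.det hM) := by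
  let M' : Matrix ι ι (regularFunctions ℓ) := Matrix.of fun i j => ⟨fun m => M m i j, hM i j⟩
  let φ : regularFunctions ℓ →+* LocalRing ℓ :=
    { toFun := fun f => germ f.1 f.2
      map_one' := rfl
      map_mul' := fun _ _ => rfl
      map_zero' := rfl
      map_add' := fun _ _ => rfl }
  have h1 : germMatrix M hM = φ.mapMatrix M' := rfl
  rw [h1, ← RingHom.map_det]
  refine (germ_eq_iff (hf := M'.det.2)).mpr (Eventually.of_forall fun m => ?_)
  exact RingHom.map_det ((Pi.evalRingHom (fun _ => ℂ) m).comp (regularFunctions ℓ).subtype) M'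

lemma isRegularAt_const_matrix (ℓ : ℙ ℂ V) (Z : Matrix ι κ ℂ) (i : ι) (j : κ) :
    IsRegularAt ℓ fun _ => Z i j := isRegularAt_const ℓ _

end GermMatrix

/-! ### Regular frames of `F` -/

section Frames

open Filter Matrix Module

variable {V : Type*} [NormedAddCommGroup V] [NormedSpace ℂ V] {ℓ : ℙ ℂ V} {ι κ μ : Type*}

/-- A family of sections of `⋀³V ⊗ 𝒪` that is regular at `ℓ` and a frame of `F` near `ℓ`. -/
structure IsFrame (ℓ : ℙ ℂ V) (s : ι → ℙ ℂ V → ⋀[ℂ]^3 V) : Prop where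
  regular : ∀ (j : ι) (φ : Dual ℂ (⋀[ℂ]^3 V)), IsRegularAt ℓ fun m => φ (s j m)
  frame : ∀ᶠ m in 𝓝 ℓ, LinearIndependent ℂ (fun j => s j m) ∧
    Submodule.span ℂ (Set.range fun j => s j m) = F m

/-- The matrix of the values of a family of functionals on a family of sections. -/
def evalMatrix (s : ι → ℙ ℂ V → ⋀[ℂ]^3 V) (φ : κ → Dual ℂ (⋀[ℂ]^3 V)) (m : ℙ ℂ V) :
    Matrix ι κ ℂ := Matrix.of fun j l => φ l (s j m)

lemma IsFrame.evalMatrix_regular {s : ι → ℙ ℂ V → ⋀[ℂ]^3 V} (hs : IsFrame ℓ s)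
    (φ : κ → Dual ℂ (⋀[ℂ]^3 V)) (j : ι) (l : κ) :
    IsRegularAt ℓ fun m => evalMatrix s φ m j l := hs.regular j (φ l)

lemma IsFrame.reindex {s : ι → ℙ ℂ V → ⋀[ℂ]^3 V} (hs : IsFrame ℓ s) (e : κ ≃ ι) :
    IsFrame ℓ fun j => s (e j) where
  regular j φ := hs.regular (e j) φ
  frame := by
    filter_upwards [hs.frame] with m hm
    refine ⟨hm.1.comp e e.injective, ?_⟩
    rw [← hm.2]
    congr 1
    exact e.surjective.range_comp fun j => s j m

lemma IsFrame.eventually [FiniteDimensional ℂ V] [Finite ι] {s : ι → ℙ ℂ V → ⋀[ℂ]^3 V}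
    (hs : IsFrame ℓ s) : ∀ᶠ m in 𝓝 ℓ, IsFrame m s := by
  let e := finBasis ℂ (⋀[ℂ]^3 V)
  have h1 : ∀ᶠ m in 𝓝 ℓ, ∀ j i, IsRegularAt m fun m => e.coord i (s j m) :=
    eventually_all.mpr fun j => eventually_all.mpr fun i => (hs.regular j _).eventually
  filter_upwards [h1, hs.frame.eventually_nhds] with m hm1 hm2
  refine ⟨fun j φ => ?_, hm2⟩
  have h : (fun m => φ (s j m)) = fun m => ∑ i, e.coord i (s j m) * φ (e i) := by
    funext m
    conv_lhs => rw [← e.sum_repr (s j m), map_sum]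
    simp only [map_smul, smul_eq_mul, Basis.coord_apply]
  rw [h]
  exact IsRegularAt.sum _ fun i _ => (hm1 j i).mul (isRegularAt_const _ _)

lemma LinearIndependent.exists_dual [Fintype ι] [DecidableEq ι] {W : Type*} [AddCommGroup W]
    [Module ℂ W] {b : ι → W} (hb : LinearIndependent ℂ b) :
    ∃ φ : ι → Dual ℂ W, ∀ i j, φ i (b j) = if i = j then 1 else 0 := by
  obtain ⟨g, hg⟩ := LinearMap.exists_leftInverse_of_injective
    (Fintype.linearCombination ℂ b)
    (LinearMap.ker_eq_bot.mpr (hb.fintypeLinearCombination_injective))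
  refine ⟨fun i => LinearMap.proj i ∘ₗ g, fun i j => ?_⟩
  have h := LinearMap.congr_fun hg (Pi.single j 1)
  rw [LinearMap.comp_apply, Fintype.linearCombination_apply_single, one_smul] at h
  simp [h, Pi.single_apply]

/-- Two frames differ by a regular matrix. -/
lemma IsFrame.exists_change [FiniteDimensional ℂ V] [Fintype ι] [Fintype κ]
    {s : ι → ℙ ℂ V → ⋀[ℂ]^3 V} {t : κ → ℙ ℂ V → ⋀[ℂ]^3 V} (hs : IsFrame ℓ s) (ht : IsFrame ℓ t) :
    ∃ X : ℙ ℂ V → Matrix κ ι ℂ, (∀ i j, IsRegularAt ℓ fun m => X m i j) ∧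
      ∀ᶠ m in 𝓝 ℓ, ∀ j, t j m = ∑ i, X m j i • s i m := by
  classical
  obtain ⟨φ, hφ⟩ := LinearIndependent.exists_dual hs.frame.self_of_nhds.1
  have ha : ∀ i j, IsRegularAt ℓ fun m => evalMatrix s φ m i j := hs.evalMatrix_regular φ
  have hdet : (evalMatrix s φ ℓ).det ≠ 0 := by
    have : evalMatrix s φ ℓ = 1 := by
      ext i j
      rw [evalMatrix, Matrix.of_apply, hφ, Matrix.one_apply]
      simp only [eq_comm]
    rw [this, det_one]
    exact one_ne_zero
  refine ⟨fun m => evalMatrix t φ m * (evalMatrix s φ m)⁻¹,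
    IsRegularAt.matrix_mul (ht.evalMatrix_regular φ) (IsRegularAt.matrix_inv ha hdet), ?_⟩
  filter_upwards [hs.frame, ht.frame, (IsRegularAt.det ha).eventually_ne_zero hdet]
    with m hsm htm hm j
  have hmem : t j m ∈ Submodule.span ℂ (Set.range fun i => s i m) := by
    rw [hsm.2, ← htm.2]
    exact Submodule.subset_span ⟨j, rfl⟩
  obtain ⟨c, hc⟩ := (Submodule.mem_span_range_iff_exists_fun ℂ).mp hmem
  have h1 : evalMatrix t φ m j = c ᵥ* evalMatrix s φ m := by
    ext l
    simp [evalMatrix, ← hc, Matrix.vecMul, dotProduct]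
  have h2 : (evalMatrix t φ m * (evalMatrix s φ m)⁻¹) j = c := by
    rw [Matrix.mul_apply_eq_vecMul, h1, Matrix.vecMul_vecMul,
      Matrix.mul_nonsing_inv _ (Ne.isUnit hm), Matrix.vecMul_one]
  rw [h2]
  exact hc.symm

lemma evalMatrix_eq_mul [Fintype ι] {s : ι → ℙ ℂ V → ⋀[ℂ]^3 V} {t : κ → ℙ ℂ V → ⋀[ℂ]^3 V}
    {m : ℙ ℂ V} {X : Matrix κ ι ℂ} (h : ∀ j, t j m = ∑ i, X j i • s i m)
    (φ : μ → Dual ℂ (⋀[ℂ]^3 V)) : evalMatrix t φ m = X * evalMatrix s φ m := by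
  ext j l
  simp [evalMatrix, h, Matrix.mul_apply]

lemma evalMatrix_mul_const [Fintype κ] {s : ι → ℙ ℂ V → ⋀[ℂ]^3 V}
    {φ : κ → Dual ℂ (⋀[ℂ]^3 V)} {ψ : μ → Dual ℂ (⋀[ℂ]^3 V)} {Z : Matrix κ μ ℂ}
    (h : ∀ j, ψ j = ∑ i, Z i j • φ i) (m : ℙ ℂ V) :
    evalMatrix s ψ m = evalMatrix s φ m * Z := by
  ext j l
  simp [evalMatrix, h, Matrix.mul_apply, mul_comm]

/-- The germ at `ℓ` of the matrix of a family of functionals in a frame of `F`. -/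
def IsFrame.germEval {s : ι → ℙ ℂ V → ⋀[ℂ]^3 V} (hs : IsFrame ℓ s)
    (φ : κ → Dual ℂ (⋀[ℂ]^3 V)) : Matrix ι κ (LocalRing ℓ) :=
  germMatrix (evalMatrix s φ) (hs.evalMatrix_regular φ)

/-- The matrices of functionals in two frames, where the first functionals are combinations of
the second. -/
lemma IsFrame.exists_germEval_eq [FiniteDimensional ℂ V] [Fintype ι] [Fintype κ]
    {ι' κ' : Type*} [Fintype ι'] [Fintype κ']
    {s : ι → ℙ ℂ V → ⋀[ℂ]^3 V} {t : ι' → ℙ ℂ V → ⋀[ℂ]^3 V} (hs : IsFrame ℓ s) (ht : IsFrame ℓ t)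
    {φ : κ → Dual ℂ (⋀[ℂ]^3 V)} {ψ : κ' → Dual ℂ (⋀[ℂ]^3 V)}
    (h : ∀ j, ψ j ∈ Submodule.span ℂ (Set.range φ)) :
    ∃ (X : Matrix ι' ι (LocalRing ℓ)) (Z : Matrix κ κ' (LocalRing ℓ)),
      ht.germEval ψ = X * hs.germEval φ * Z := by
  obtain ⟨X, hX, hXt⟩ := hs.exists_change ht
  choose Z hZ using fun j => (Submodule.mem_span_range_iff_exists_fun ℂ).mp (h j)
  refine ⟨germMatrix X hX, germMatrix (fun _ => Matrix.of fun i j => Z j i)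
    (fun i j => isRegularAt_const ℓ _), ?_⟩
  rw [IsFrame.germEval, IsFrame.germEval, germMatrix_mul, germMatrix_mul]
  apply germMatrix_congr
  filter_upwards [hXt] with m hm
  rw [← evalMatrix_eq_mul hm, evalMatrix_mul_const (Z := Matrix.of fun i j => Z j i)]
  intro j
  exact (hZ j).symm

/-- The ideals of minors do not depend on the frame, nor on the basis of a space of
functionals. -/
lemma IsFrame.minorsIdeal_le [FiniteDimensional ℂ V] [Fintype ι] [Fintype κ]
    {ι' κ' : Type*} [Fintype ι'] [Fintype κ']
    {s : ι → ℙ ℂ V → ⋀[ℂ]^3 V} {t : ι' → ℙ ℂ V → ⋀[ℂ]^3 V} (hs : IsFrame ℓ s) (ht : IsFrame ℓ t)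
    {φ : κ → Dual ℂ (⋀[ℂ]^3 V)} {ψ : κ' → Dual ℂ (⋀[ℂ]^3 V)}
    (h : ∀ j, ψ j ∈ Submodule.span ℂ (Set.range φ)) (p : ℕ) :
    minorsIdeal p (ht.germEval ψ) ≤ minorsIdeal p (hs.germEval φ) := by
  obtain ⟨X, Z, hXZ⟩ := hs.exists_germEval_eq ht h
  rw [hXZ]
  exact (minorsIdeal_mul_le_left p _ _).trans (minorsIdeal_mul_le_right p _ _)

lemma linearIndependent_of_det_evalMatrix [Fintype ι] [DecidableEq ι]
    {s : ι → ℙ ℂ V → ⋀[ℂ]^3 V} {φ : ι → Dual ℂ (⋀[ℂ]^3 V)} {m : ℙ ℂ V}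
    (h : (evalMatrix s φ m).det ≠ 0) : LinearIndependent ℂ fun j => s j m := by
  rw [Fintype.linearIndependent_iff]
  intro c hc
  have h0 : c ᵥ* evalMatrix s φ m = 0 := by
    ext l
    have := congrArg (φ l) hc
    simpa [evalMatrix, Matrix.vecMul, dotProduct] using this
  exact congrFun (Matrix.eq_zero_of_vecMul_eq_zero h h0)

/-- A frame can be changed such that given functionals become dual to it. -/
def dualFrame [Fintype ι] [DecidableEq ι] (s : ι → ℙ ℂ V → ⋀[ℂ]^3 V)
    (ψ : ι → Dual ℂ (⋀[ℂ]^3 V)) : ι → ℙ ℂ V → ⋀[ℂ]^3 V :=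
  fun j m => ∑ i, (evalMatrix s ψ m)⁻¹ j i • s i m

lemma IsFrame.dualFrame_regular [Fintype ι] [DecidableEq ι] {s : ι → ℙ ℂ V → ⋀[ℂ]^3 V}
    (hs : IsFrame ℓ s) {ψ : ι → Dual ℂ (⋀[ℂ]^3 V)} (hdet : (evalMatrix s ψ ℓ).det ≠ 0) (j : ι)
    (φ : Dual ℂ (⋀[ℂ]^3 V)) : IsRegularAt ℓ fun m => φ (dualFrame s ψ j m) := by
  simp only [dualFrame, map_sum, map_smul, smul_eq_mul]
  exact IsRegularAt.sum _ fun i _ =>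
    (IsRegularAt.matrix_inv (hs.evalMatrix_regular ψ) hdet j i).mul (hs.regular i φ)

lemma evalMatrix_dualFrame [Fintype ι] [DecidableEq ι] {s : ι → ℙ ℂ V → ⋀[ℂ]^3 V}
    {ψ : ι → Dual ℂ (⋀[ℂ]^3 V)} {m : ℙ ℂ V} (h : (evalMatrix s ψ m).det ≠ 0) :
    evalMatrix (dualFrame s ψ) ψ m = 1 := by
  rw [evalMatrix_eq_mul (s := s) (X := (evalMatrix s ψ m)⁻¹) (fun j => rfl),
    Matrix.nonsing_inv_mul _ (Ne.isUnit h)]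

lemma IsFrame.eventually_det_ne_zero [FiniteDimensional ℂ V] [Fintype ι] [DecidableEq ι]
    {s : ι → ℙ ℂ V → ⋀[ℂ]^3 V} (hs : IsFrame ℓ s) {ψ : ι → Dual ℂ (⋀[ℂ]^3 V)}
    (hdet : (evalMatrix s ψ ℓ).det ≠ 0) : ∀ᶠ m in 𝓝 ℓ, (evalMatrix s ψ m).det ≠ 0 :=
  (IsRegularAt.det (hs.evalMatrix_regular ψ)).eventually_ne_zero hdet

lemma IsFrame.isFrame_dualFrame [FiniteDimensional ℂ V] [Fintype ι] [DecidableEq ι]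
    {s : ι → ℙ ℂ V → ⋀[ℂ]^3 V}
    (hs : IsFrame ℓ s) {ψ : ι → Dual ℂ (⋀[ℂ]^3 V)} (hdet : (evalMatrix s ψ ℓ).det ≠ 0) :
    IsFrame ℓ (dualFrame s ψ) := by
  refine ⟨hs.dualFrame_regular hdet, ?_⟩
  filter_upwards [hs.frame, hs.eventually_det_ne_zero hdet] with m hsm hm
  have hli : LinearIndependent ℂ fun j => dualFrame s ψ j m := by
    apply linearIndependent_of_det_evalMatrix (φ := ψ)
    rw [evalMatrix_dualFrame hm, det_one]
    exact one_ne_zero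
  refine ⟨hli, ?_⟩
  apply Submodule.eq_of_le_of_finrank_eq
  · rw [Submodule.span_le, ← hsm.2]
    rintro _ ⟨j, rfl⟩
    exact Submodule.sum_mem _ fun i _ => Submodule.smul_mem _ _ (Submodule.subset_span ⟨i, rfl⟩)
  · rw [finrank_span_eq_card hli, ← hsm.2, finrank_span_eq_card hsm.1]

/-- The sections `m ↦ m ∧ η` of `F`, normalised by a linear form. -/
lemma isFrame_wedge (hV : finrank ℂ V = 6) [Fintype ι] (hι : Fintype.card ι = 10)
    {x₀ : Dual ℂ V} (hx : x₀ ℓ.rep = 1) {η : ι → ⋀[ℂ]^2 V}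
    (hη : LinearIndependent ℂ fun j => wedge12 ℓ.rep (η j)) :
    IsFrame ℓ fun j m => (x₀ m.rep)⁻¹ • wedge12 m.rep (η j) := by
  classical
  have : FiniteDimensional ℂ V := .of_finrank_pos (by omega)
  have hreg : ∀ (j : ι) (φ : Dual ℂ (⋀[ℂ]^3 V)),
      IsRegularAt ℓ fun m => φ ((x₀ m.rep)⁻¹ • wedge12 m.rep (η j)) := by
    intro j φ
    have h := isRegularAt_div (φ ∘ₗ wedge12.flip (η j)) x₀ (ℓ := ℓ) (by rw [hx]; exact one_ne_zero)
    convert h using 2 with m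
    simp [div_eq_inv_mul]
  refine ⟨hreg, ?_⟩
  obtain ⟨φ, hφ⟩ := LinearIndependent.exists_dual hη
  let s : ι → ℙ ℂ V → ⋀[ℂ]^3 V := fun j m => (x₀ m.rep)⁻¹ • wedge12 m.rep (η j)
  have hdet : (evalMatrix s φ ℓ).det ≠ 0 := by
    have : evalMatrix s φ ℓ = 1 := by
      ext i j
      simp [evalMatrix, s, hx, hφ, Matrix.one_apply, eq_comm]
    rw [this, det_one]
    exact one_ne_zero
  have hev := (IsRegularAt.det (M := evalMatrix s φ)
    (fun i j => hreg i (φ j))).eventually_ne_zero hdet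
  filter_upwards [hev] with m hm
  have hli : LinearIndependent ℂ fun j => s j m := linearIndependent_of_det_evalMatrix hm
  refine ⟨hli, ?_⟩
  have hle : Submodule.span ℂ (Set.range fun j => s j m) ≤ F m := by
    rw [Submodule.span_le]
    rintro _ ⟨j, rfl⟩
    exact Submodule.smul_mem _ _ (mem_F.mpr ⟨η j, rfl⟩)
  apply Submodule.eq_of_le_of_finrank_eq hle
  have hF : finrank ℂ (F m) = 10 := by
    obtain ⟨vol⟩ : Nonempty (⋀[ℂ]^6 V ≃ₗ[ℂ] ℂ) := by
      apply FiniteDimensional.nonempty_linearEquiv_of_finrank_eq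
      rw [exteriorPower.finrank_eq, hV, finrank_self]; rfl
    exact (F_lagrangian vol hV m).finrank_eq vol hV
  rw [finrank_span_eq_card hli, hι, hF]

end Frames

/-! ### Symplectic trivializations -/

section Graphs

open Module

variable {W : Type*} [AddCommGroup W] [Module ℂ W] {L L' E : Submodule ℂ W}

lemma IsGraph.add_mem {q : L →ₗ[ℂ] L'} (h : IsGraph q E) (x : L) : (x : W) + q x ∈ E := by
  rw [h]
  exact ⟨x, rfl⟩

lemma IsGraph.exists_eq {q : L →ₗ[ℂ] L'} (h : IsGraph q E) {X : W} (hX : X ∈ E) :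
    ∃ x : L, (x : W) + q x = X := by
  rw [h] at hX
  exact hX

lemma isGraph_iff_of_basis {ι : Type*} {q : L →ₗ[ℂ] L'} (b : Basis ι ℂ L) :
    IsGraph q E ↔ Submodule.span ℂ (Set.range fun j => (b j : W) + q (b j)) = E := by
  have h : LinearMap.range (L.subtype + L'.subtype ∘ₗ q) =
      Submodule.span ℂ (Set.range fun j => (b j : W) + q (b j)) := by
    rw [LinearMap.range_eq_map, ← b.span_eq, Submodule.map_span, ← Set.range_comp]
    rfl
  rw [IsGraph, h, eq_comm]

/-- A subspace with the same complement `L'` as `L` is a graph over `L`. -/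
lemma exists_isGraph (h : IsCompl L L') (hE : IsCompl E L') :
    ∃ q : L →ₗ[ℂ] L', IsGraph q E := by
  let e := Submodule.prodEquivOfIsCompl E L' hE
  have he : ∀ X : W, ((e.symm X).1 : W) + (e.symm X).2 = X := fun X => e.apply_symm_apply X
  refine ⟨-(LinearMap.snd ℂ E L' ∘ₗ e.symm.toLinearMap ∘ₗ L.subtype), le_antisymm ?_ ?_⟩
  · intro X hX
    obtain ⟨x, y, hxy, -⟩ := Submodule.existsUnique_add_of_isCompl h X
    refine ⟨x, ?_⟩
    have h1 : e.symm (x : W) = (⟨X, hX⟩, -y) := by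
      rw [LinearEquiv.symm_apply_eq]
      change (x : W) = X + ((-y : L') : W)
      rw [← hxy, Submodule.coe_neg]
      abel
    change (x : W) + ((-(e.symm (x : W)).2 : L') : W) = X
    rw [h1, neg_neg, hxy]
  · rintro _ ⟨x, rfl⟩
    change (x : W) + ((-(e.symm (x : W)).2 : L') : W) ∈ E
    have h1 : (x : W) + ((-(e.symm (x : W)).2 : L') : W) = (e.symm (x : W)).1 := by
      rw [Submodule.coe_neg]
      nth_rewrite 1 [← he x]
      abel
    rw [h1]
    exact (e.symm (x : W)).1.2

lemma IsGraph.apply_eq_zero {q : L →ₗ[ℂ] L'} (h : IsCompl L L') (hq : IsGraph q E) {x : L}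
    (hx : (x : W) ∈ E) : q x = 0 := by
  obtain ⟨y, hy⟩ := hq.exists_eq hx
  have h1 : ((x - y : L) : W) = q y := by
    rw [Submodule.coe_sub, ← hy]
    abel
  have h2 : ((x - y : L) : W) = 0 :=
    (Submodule.disjoint_def.mp h.disjoint) _ (x - y).2 (h1 ▸ (q y).2)
  have h3 : x = y := sub_eq_zero.mp (Subtype.ext h2)
  rw [h3]
  apply Subtype.ext
  rw [← h1, h2]
  rfl

lemma IsLagrangian.apply_eq_zero {σ : LinearMap.BilinForm ℂ W} (h : IsLagrangian σ E) {X Y : W}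
    (hX : X ∈ E) (hY : Y ∈ E) : σ X Y = 0 := by
  have : Y ∈ E.orthogonalBilin σ := by rw [h]; exact hY
  exact this X hX

lemma IsLagrangian.mem {σ : LinearMap.BilinForm ℂ W} (h : IsLagrangian σ E) {Y : W}
    (hY : ∀ X ∈ E, σ X Y = 0) : Y ∈ E := by
  have : Y ∈ E.orthogonalBilin σ := hY
  rwa [h] at this

end Graphs

section Trivializations

open Filter Matrix Module

variable {V : Type*} [NormedAddCommGroup V] [NormedSpace ℂ V] (vol : ⋀[ℂ]^6 V ≃ₗ[ℂ] ℂ)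
  {A : Submodule ℂ (⋀[ℂ]^3 V)} {ℓ : ℙ ℂ V}

/-- The functional `σ(·, X)` on `⋀³V`. -/
def pairing (X : ⋀[ℂ]^3 V) : Dual ℂ (⋀[ℂ]^3 V) := (symp vol).flip X

lemma pairing_apply (X Y : ⋀[ℂ]^3 V) : pairing vol X Y = symp vol Y X := rfl

/-- The functionals that vanish on a Lagrangian subspace `A` are the `σ(·, X)`, `X ∈ A`. -/
lemma mem_span_pairing (hV : finrank ℂ V = 6) (hA : IsLagrangian (symp vol) A) {κ : Type*}
    {a : κ → ⋀[ℂ]^3 V} (ha : Submodule.span ℂ (Set.range a) = A) {ψ : Dual ℂ (⋀[ℂ]^3 V)}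
    (hψ : ∀ X ∈ A, ψ X = 0) :
    ψ ∈ Submodule.span ℂ (Set.range fun l => pairing vol (a l)) := by
  have : FiniteDimensional ℂ V := .of_finrank_pos (by omega)
  let Y := ((symp vol).toDual (symp_nondegenerate vol hV)).symm ψ
  have hY : ∀ X, symp vol Y X = ψ X := fun X =>
    LinearMap.BilinForm.apply_toDual_symm_apply ψ X
  have hYA : Y ∈ A := hA.mem fun X hX => by rw [symp_swap, hY, hψ X hX, neg_zero]
  have hψ2 : ψ = (symp vol).flip (-Y) := by
    refine LinearMap.ext fun X => ?_
    change ψ X = symp vol X (-Y)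
    rw [map_neg, ← symp_swap, hY]
  have h3 : Submodule.span ℂ (Set.range fun l => pairing vol (a l)) =
      A.map (symp vol).flip := by
    rw [← ha, Submodule.map_span, ← Set.range_comp]
    rfl
  rw [h3, hψ2]
  exact Submodule.mem_map_of_mem (neg_mem hYA)

/-- The entries of the matrix of a symplectic trivialization, as pairings of bases of `E` and
of `A`. -/
lemma SympTriv.matrix_eq {W : Type*} [AddCommGroup W] [Module ℂ W] {σ : LinearMap.BilinForm ℂ W}
    {A : Submodule ℂ W} {E : ℙ ℂ V → Submodule ℂ W} (hA : IsLagrangian σ A)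
    (T : SympTriv σ A E ℓ) (m : ℙ ℂ V) (j k : Fin 10) :
    T.matrix m j k = -σ ((T.b j : W) + T.qE m (T.b j)) (T.b k + T.qA (T.b k)) := by
  have h1 := T.lagrangian_L.apply_eq_zero (T.b j).2 (T.b k).2
  have h2 := T.lagrangian_L'.apply_eq_zero (T.qE m (T.b j)).2 (T.qA (T.b k)).2
  have h3 := hA.apply_eq_zero (T.graph_A.add_mem (T.b j)) (T.graph_A.add_mem (T.b k))
  have h4 := T.lagrangian_L'.apply_eq_zero (T.qA (T.b j)).2 (T.qA (T.b k)).2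
  have h5 : T.matrix m j k = σ (T.qA (T.b j)) (T.b k) - σ (T.qE m (T.b j)) (T.b k) := by
    change σ ((T.qA (T.b j) : W) - T.qE m (T.b j)) (T.b k) = _
    rw [map_sub, LinearMap.sub_apply]
  simp only [map_add, LinearMap.add_apply] at h3 ⊢
  rw [h5]
  linear_combination h3 - h4 + h2

/-- A symplectic trivialization gives a regular frame of `F`. -/
lemma SympTriv.exists_isFrame [FiniteDimensional ℂ V] {s : Fin 10 → ℙ ℂ V → ⋀[ℂ]^3 V}
    (hs : IsFrame ℓ s) (T : SympTriv (symp vol) A F ℓ) :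
    ∃ t : Fin 10 → ℙ ℂ V → ⋀[ℂ]^3 V, IsFrame ℓ t ∧
      ∀ᶠ m in 𝓝 ℓ, ∀ j, t j m = (T.b j : ⋀[ℂ]^3 V) + T.qE m (T.b j) := by
  let ψ : Fin 10 → Dual ℂ (⋀[ℂ]^3 V) := fun k =>
    T.b.coord k ∘ₗ T.L.projectionOnto T.L' T.isCompl
  let u : Fin 10 → ℙ ℂ V → ⋀[ℂ]^3 V := fun j m => (T.b j : ⋀[ℂ]^3 V) + T.qE m (T.b j)
  have hu : ∀ m, evalMatrix u ψ m = 1 := by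
    intro m
    ext j k
    simp [evalMatrix, u, ψ, Matrix.one_apply, Finsupp.single_apply]
  have hspan : ∀ᶠ m in 𝓝 ℓ, Submodule.span ℂ (Set.range fun j => s j m) = F m ∧
      ∀ j, u j m ∈ F m := by
    filter_upwards [hs.frame, T.graph_E] with m hsm hm
    exact ⟨hsm.2, fun j => hm.add_mem _⟩
  have hmul : ∀ᶠ m in 𝓝 ℓ, ∃ P : Matrix (Fin 10) (Fin 10) ℂ, P * evalMatrix s ψ m = 1 ∧
      ∀ j, u j m = ∑ i, P j i • s i m := by
    filter_upwards [hspan] with m hm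
    have h1 : ∀ j, u j m ∈ Submodule.span ℂ (Set.range fun j => s j m) :=
      fun j => hm.1 ▸ hm.2 j
    choose P hP using fun j => (Submodule.mem_span_range_iff_exists_fun ℂ).mp (h1 j)
    refine ⟨P, ?_, fun j => (hP j).symm⟩
    rw [← hu m]
    exact (evalMatrix_eq_mul (X := P) (fun j => (hP j).symm) ψ).symm
  have hdet : ∀ᶠ m in 𝓝 ℓ, (evalMatrix s ψ m).det ≠ 0 := by
    filter_upwards [hmul] with m hm
    obtain ⟨P, hP, -⟩ := hm
    intro h0
    have := congrArg Matrix.det hP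
    rw [det_mul, h0, mul_zero, det_one] at this
    exact zero_ne_one this
  refine ⟨dualFrame s ψ, hs.isFrame_dualFrame hdet.self_of_nhds, ?_⟩
  filter_upwards [hmul] with m hm j
  obtain ⟨P, hP, hPu⟩ := hm
  change dualFrame s ψ j m = u j m
  rw [dualFrame, Matrix.inv_eq_left_inv hP, hPu j]

/-- The minors of a symplectic trivialization, in terms of a frame of `F`. -/
lemma SympTriv.exists_minors_eq [FiniteDimensional ℂ V] (hA : IsLagrangian (symp vol) A)
    {s : Fin 10 → ℙ ℂ V → ⋀[ℂ]^3 V}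
    (hs : IsFrame ℓ s) (T : SympTriv (symp vol) A F ℓ) :
    ∃ (t : Fin 10 → ℙ ℂ V → ⋀[ℂ]^3 V) (ht : IsFrame ℓ t) (a : Fin 10 → ⋀[ℂ]^3 V),
      Submodule.span ℂ (Set.range a) = A ∧ ∀ (p : ℕ) (r s : Fin p → Fin 10),
      ((fun m => ((T.matrix m).submatrix r s).det : ℙ ℂ V → ℂ) : (𝓝 ℓ).Germ ℂ) =
        ((-ht.germEval fun l => pairing vol (a l)).submatrix r s).det := by
  obtain ⟨t, ht, hev⟩ := T.exists_isFrame vol hs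
  refine ⟨t, ht, fun l => (T.b l : ⋀[ℂ]^3 V) + T.qA (T.b l),
    (isGraph_iff_of_basis T.b).mp T.graph_A, fun p r s => ?_⟩
  set φ : Fin 10 → Dual ℂ (⋀[ℂ]^3 V) := fun l => pairing vol ((T.b l : ⋀[ℂ]^3 V) + T.qA (T.b l))
  have hreg : ∀ i j, IsRegularAt ℓ fun m => (-evalMatrix t φ m).submatrix r s i j :=
    fun i j => (ht.evalMatrix_regular φ (r i) (s j)).neg
  have h1 : (-ht.germEval φ).submatrix r s =
      germMatrix (fun m => (-evalMatrix t φ m).submatrix r s) hreg := rfl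
  rw [h1, germMatrix_det]
  refine Germ.coe_eq.mpr ?_
  filter_upwards [hev] with m hm
  congr 1
  ext i j
  rw [submatrix_apply, SympTriv.matrix_eq hA, ← hm]
  rfl

lemma pairing_mem_span_pairing (hV : finrank ℂ V = 6) (hA : IsLagrangian (symp vol) A)
    {κ κ' : Type*} {a : κ → ⋀[ℂ]^3 V} {a' : κ' → ⋀[ℂ]^3 V}
    (ha : Submodule.span ℂ (Set.range a) = A) (ha' : Submodule.span ℂ (Set.range a') = A)
    (j : κ') : pairing vol (a' j) ∈ Submodule.span ℂ (Set.range fun l => pairing vol (a l)) := by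
  apply mem_span_pairing vol hV hA ha
  intro X hX
  exact hA.apply_eq_zero hX (ha' ▸ Submodule.subset_span ⟨j, rfl⟩)

/-- The degeneracy loci are given by the minors of the pairing between a frame of `F` and a
basis of `A`. -/
theorem D_eq_minorsIdeal (hV : finrank ℂ V = 6) (hA : IsLagrangian (symp vol) A)
    (T₀ : SympTriv (symp vol) A F ℓ) {ι κ : Type*} [Fintype ι] [Fintype κ]
    {s : ι → ℙ ℂ V → ⋀[ℂ]^3 V} (hs : IsFrame ℓ s) (e : Fin 10 ≃ ι) {a : κ → ⋀[ℂ]^3 V}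
    (ha : Submodule.span ℂ (Set.range a) = A) (i : ℕ) :
    D vol A i ℓ = minorsIdeal (11 - i) (hs.germEval fun l => pairing vol (a l)) := by
  have : FiniteDimensional ℂ V := .of_finrank_pos (by omega)
  apply le_antisymm
  · rw [D, idealGen, Ideal.span_le]
    rintro f ⟨T, r, c, hf⟩
    obtain ⟨t, ht, a', ha', h⟩ := T.exists_minors_eq vol hA (hs.reindex e)
    rw [h] at hf
    rw [SetLike.mem_coe, Subtype.ext hf]
    apply hs.minorsIdeal_le ht (pairing_mem_span_pairing vol hV hA ha ha')
    rw [← minorsIdeal_neg]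
    exact det_mem_minorsIdeal _ r c
  · obtain ⟨t, ht, a', ha', h⟩ := T₀.exists_minors_eq vol hA (hs.reindex e)
    refine (ht.minorsIdeal_le hs (pairing_mem_span_pairing vol hV hA ha' ha) _).trans ?_
    rw [← minorsIdeal_neg, minorsIdeal_le_iff]
    intro r c
    exact Ideal.subset_span ⟨T₀, r, c, (h _ r c).symm⟩

end Trivializations

/-! ### The hypersurface `Y_A` -/

section Hypersurface

open Filter Matrix Module

/-- The minors of full size of a square matrix are the multiples of its determinant. -/
lemma minorsIdeal_card {R : Type*} [CommRing R] {ι : Type*} [Fintype ι] [DecidableEq ι] {p : ℕ}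
    (e : Fin p ≃ ι) (M : Matrix ι ι R) : minorsIdeal p M = Ideal.span {M.det} := by
  apply le_antisymm
  · rw [minorsIdeal_le_iff]
    intro r s
    have h : M.submatrix r s = (1 : Matrix ι ι R).submatrix r e * (M.submatrix e e *
        (1 : Matrix ι ι R).submatrix e s) := by
      rw [Matrix.submatrix_mul_equiv, Matrix.mul_one, Matrix.submatrix_mul_equiv, Matrix.one_mul]
    rw [h, det_mul, det_mul, det_submatrix_equiv_self]
    exact Ideal.mul_mem_left _ _ (Ideal.mul_mem_right _ _ (Ideal.subset_span rfl))
  · rw [Ideal.span_singleton_le_iff_mem, ← det_submatrix_equiv_self e]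
    exact det_mem_minorsIdeal M e e

variable {V : Type*} [NormedAddCommGroup V] [NormedSpace ℂ V] (vol : ⋀[ℂ]^6 V ≃ₗ[ℂ] ℂ)
  {A : Submodule ℂ (⋀[ℂ]^3 V)} {ℓ : ℙ ℂ V}

lemma IsFrame.germ_det_eq {s : Fin 10 → ℙ ℂ V → ⋀[ℂ]^3 V} (hs : IsFrame ℓ s)
    (e : Basis (Fin 10) ℂ (⋀[ℂ]^3 V ⧸ A)) :
    ((fun m => e.det fun j => A.mkQ (s j m) : ℙ ℂ V → ℂ) : (𝓝 ℓ).Germ ℂ) =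
      (hs.germEval fun i => e.coord i ∘ₗ A.mkQ).det := by
  rw [IsFrame.germEval, germMatrix_det]
  refine Germ.coe_eq.mpr (Eventually.of_forall fun m => ?_)
  change e.det (fun j => A.mkQ (s j m)) = (evalMatrix s (fun i => e.coord i ∘ₗ A.mkQ) m).det
  rw [Basis.det_apply, ← det_transpose]
  rfl

/-- The hypersurface `Y_A` is given by the determinant of the pairing between a frame of `F` and
a basis of `A`. -/
theorem Y_eq_minorsIdeal (hV : finrank ℂ V = 6) (hA : IsLagrangian (symp vol) A)
    {ι κ : Type*} [Fintype ι] [Fintype κ]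
    {s : ι → ℙ ℂ V → ⋀[ℂ]^3 V} (hs : IsFrame ℓ s) (e : Fin 10 ≃ ι) {a : κ → ⋀[ℂ]^3 V}
    (ha : Submodule.span ℂ (Set.range a) = A) :
    Y A ℓ = minorsIdeal 10 (hs.germEval fun l => pairing vol (a l)) := by
  have : FiniteDimensional ℂ V := .of_finrank_pos (by omega)
  apply le_antisymm
  · rw [Y, idealGen, Ideal.span_le]
    rintro f ⟨t, b, h1, h2, hf⟩
    have ht : IsFrame ℓ t := ⟨h1, h2⟩
    rw [ht.germ_det_eq b] at hf
    rw [SetLike.mem_coe, Subtype.ext hf]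
    refine hs.minorsIdeal_le ht (ψ := fun i => b.coord i ∘ₗ A.mkQ) (fun i => ?_) 10 ?_
    · apply mem_span_pairing vol hV hA ha
      intro X hX
      rw [LinearMap.comp_apply, Submodule.mkQ_apply, (Submodule.Quotient.mk_eq_zero A).mpr hX,
        map_zero]
    · rw [minorsIdeal_card (Equiv.refl _)]
      exact Ideal.subset_span rfl
  · have hfin : finrank ℂ (⋀[ℂ]^3 V ⧸ A) = 10 := by
      have h1 := A.finrank_quotient_add_finrank
      rw [finrank_trivectors hV, hA.finrank_eq vol hV] at h1
      omega
    let b := finBasisOfFinrankEq ℂ _ hfin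
    have ht := hs.reindex e
    refine (ht.minorsIdeal_le hs (φ := fun i => b.coord i ∘ₗ A.mkQ) (fun j => ?_) 10).trans ?_
    · have hle : A ≤ LinearMap.ker (pairing vol (a j)) := fun X hX =>
        hA.apply_eq_zero hX (ha ▸ Submodule.subset_span ⟨j, rfl⟩)
      have h1 : pairing vol (a j) = ∑ i, A.liftQ _ hle (b i) • (b.coord i ∘ₗ A.mkQ) := by
        refine LinearMap.ext fun X => ?_
        have h2 : A.liftQ _ hle (A.mkQ X) = pairing vol (a j) X := rfl
        rw [← h2]
        conv_lhs => rw [← b.sum_repr (A.mkQ X), map_sum]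
        simp [mul_comm]
      rw [h1]
      exact Submodule.sum_mem _ fun i _ => Submodule.smul_mem _ _ (Submodule.subset_span ⟨i, rfl⟩)
    · rw [minorsIdeal_card (Equiv.refl _), Ideal.span_singleton_le_iff_mem]
      exact Ideal.subset_span ⟨_, b, ht.regular, ht.frame, (ht.germ_det_eq b).symm⟩

end Hypersurface

/-! ### The local structure of the degeneracy loci -/

section LocalStructure

open Filter Matrix Module

variable {V : Type*} [NormedAddCommGroup V] [NormedSpace ℂ V] (vol : ⋀[ℂ]^6 V ≃ₗ[ℂ] ℂ)
  {A : Submodule ℂ (⋀[ℂ]^3 V)} {ℓ : ℙ ℂ V}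

/-- A basis of `L` that is adapted to a subspace. -/
lemma exists_adapted_basis {W : Type*} [AddCommGroup W] [Module ℂ W] [FiniteDimensional ℂ W]
    (A L : Submodule ℂ W) {k n : ℕ} (hk : finrank ℂ ↥(A ⊓ L) = k) (hL : finrank ℂ L = k + n) :
    ∃ b : Basis (Fin k ⊕ Fin n) ℂ L,
      Submodule.span ℂ (Set.range fun j => (b (Sum.inl j) : W)) = A ⊓ L := by
  let P : Submodule ℂ L := A.comap L.subtype
  have hmap : P.map L.subtype = A ⊓ L := by
    rw [Submodule.map_comap_eq, Submodule.range_subtype, inf_comm]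
  have hP : finrank ℂ P = k := by
    rw [← hk, ← hmap]
    exact (Submodule.equivMapOfInjective _ L.injective_subtype P).finrank_eq
  obtain ⟨C, hC⟩ := P.exists_isCompl
  have hCn : finrank ℂ C = n := by
    have := Submodule.finrank_add_eq_of_isCompl hC
    omega
  let b := ((finBasisOfFinrankEq ℂ P hP).prod (finBasisOfFinrankEq ℂ C hCn)).map
    (Submodule.prodEquivOfIsCompl P C hC)
  refine ⟨b, ?_⟩
  have h1 : ∀ j, (b (Sum.inl j) : W) = L.subtype (P.subtype (finBasisOfFinrankEq ℂ P hP j)) := by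
    intro j
    simp [b]
  simp only [h1]
  have h2 : Submodule.span ℂ (Set.range (P.subtype ∘ finBasisOfFinrankEq ℂ P hP)) = P := by
    rw [Set.range_comp, ← Submodule.map_span, Basis.span_eq, Submodule.map_top,
      Submodule.range_subtype]
  have h3 := Submodule.map_span L.subtype (Set.range (P.subtype ∘ finBasisOfFinrankEq ℂ P hP))
  rw [h2, hmap, ← Set.range_comp] at h3
  exact h3.symm

lemma linearIndependent_coe_basis {W ι : Type*} [AddCommGroup W] [Module ℂ W]
    {L : Submodule ℂ W} (b : Basis ι ℂ L) : LinearIndependent ℂ fun j => (b j : W) :=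
  b.linearIndependent.map' L.subtype L.ker_subtype

lemma symp_isAlt : (symp vol).IsAlt := fun X => by
  have h := symp_swap vol X X
  exact self_eq_neg.mp h

set_option maxHeartbeats 800000 in
/-- In suitable bases the pairing between `F` and `A` is, near `ℓ`, a symmetric matrix of regular
functions. At `ℓ` only its lower right block is nonzero, and invertible; the upper left block,
which corresponds to `K = A ∩ F_ℓ`, has the differential `w ↦ σ(w ∧ η, ℓ ∧ η')` there. -/
theorem exists_local_matrix (hV : finrank ℂ V = 6) (hA : IsLagrangian (symp vol) A) (ℓ : ℙ ℂ V)
    {k n : ℕ} (hk : finrank ℂ ↥(A ⊓ F ℓ) = k) (hkn : k + n = 10) :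
    ∃ (η : Fin k → ⋀[ℂ]^2 V) (N : ℙ ℂ V → Matrix (Fin k ⊕ Fin n) (Fin k ⊕ Fin n) ℂ),
      LinearIndependent ℂ (fun j => wedge12 ℓ.rep (η j)) ∧
      Submodule.span ℂ (Set.range fun j => wedge12 ℓ.rep (η j)) = A ⊓ F ℓ ∧
      (∀ᶠ m in 𝓝 ℓ, ∀ i j, IsRegularAt m fun m => N m i j) ∧
      (∀ᶠ m in 𝓝 ℓ, (N m).IsSymm) ∧
      (∀ i (h : ∀ i j, IsRegularAt ℓ fun m => N m i j),
        D vol A i ℓ = minorsIdeal (11 - i) (germMatrix N h)) ∧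
      (∀ᶠ m in 𝓝 ℓ, ∀ h : ∀ i j, IsRegularAt m fun m => N m i j,
        Y A m = minorsIdeal 10 (germMatrix N h)) ∧
      (∀ j l, N ℓ (Sum.inl j) l = 0) ∧ (∀ j l, N ℓ j (Sum.inl l) = 0) ∧
      (N ℓ).toBlocks₂₂.det ≠ 0 ∧
      ∀ j l w, differential ℓ (fun m => N m (Sum.inl j) (Sum.inl l)) w =
        symp vol (wedge12 w (η j)) (wedge12 ℓ.rep (η l)) := by
  have : FiniteDimensional ℂ V := .of_finrank_pos (by omega)
  have hF := F_lagrangian vol hV ℓ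
  obtain ⟨L', hL', c₁, c₂⟩ := exists_lagrangian_isCompl (symp_nondegenerate vol hV)
    (symp_isAlt vol) hF hA
  obtain ⟨b, hb⟩ := exists_adapted_basis A (F ℓ) hk
    (by rw [hF.finrank_eq vol hV, hkn])
  have hbA : ∀ j, (b (Sum.inl j) : ⋀[ℂ]^3 V) ∈ A := by
    intro j
    have : (b (Sum.inl j) : ⋀[ℂ]^3 V) ∈ A ⊓ F ℓ := by
      rw [← hb]
      exact Submodule.subset_span ⟨j, rfl⟩
    exact this.1
  choose η hη using fun j => mem_F.mp (b j).2
  have hbli : LinearIndependent ℂ fun j => (b j : ⋀[ℂ]^3 V) :=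
    linearIndependent_coe_basis b
  have hηli : LinearIndependent ℂ fun j => wedge12 ℓ.rep (η j) := by
    simp only [hη]
    exact hbli
  obtain ⟨q, hq⟩ := exists_isGraph c₁ c₂
  obtain ⟨e₀, he₀⟩ := exists_basis_zero_eq hV ℓ.rep_nonzero
  let x₀ : Dual ℂ V := e₀.coord 0
  have hx₀ : x₀ ℓ.rep = 1 := by simp [x₀, ← he₀]
  let s : Fin k ⊕ Fin n → ℙ ℂ V → ⋀[ℂ]^3 V := fun j m => (x₀ m.rep)⁻¹ • wedge12 m.rep (η j)
  have hs : IsFrame ℓ s := isFrame_wedge hV (by simp [hkn]) hx₀ hηli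
  have hsℓ : ∀ j, s j ℓ = b j := fun j => by simp only [s, hx₀, hη, inv_one, one_smul]
  -- the projection to `F_ℓ` along `L'`, in coordinates
  let ψ : Fin k ⊕ Fin n → Dual ℂ (⋀[ℂ]^3 V) := fun l =>
    b.coord l ∘ₗ (F ℓ).projectionOnto L' c₁
  have hψℓ : evalMatrix s ψ ℓ = 1 := by
    ext j l
    simp [evalMatrix, hsℓ, ψ, Matrix.one_apply, Finsupp.single_apply]
  have hdet : (evalMatrix s ψ ℓ).det ≠ 0 := by
    rw [hψℓ, det_one]
    exact one_ne_zero
  let t := dualFrame s ψ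
  have ht : IsFrame ℓ t := hs.isFrame_dualFrame hdet
  have htℓ : ∀ j, t j ℓ = b j := by
    intro j
    simp [t, dualFrame, hψℓ, Matrix.one_apply, hsℓ]
  let qE : ℙ ℂ V → F ℓ →ₗ[ℂ] L' := fun m =>
    b.constr ℂ fun j => L'.projectionOnto (F ℓ) c₁.symm (t j m)
  have htq : ∀ᶠ m in 𝓝 ℓ, ∀ j, (b j : ⋀[ℂ]^3 V) + qE m (b j) = t j m := by
    filter_upwards [hs.eventually_det_ne_zero hdet] with m hm j
    have h1 : (F ℓ).projectionOnto L' c₁ (t j m) = b j := by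
      apply b.repr.injective
      ext l
      have h2 : evalMatrix t ψ m j l = (1 : Matrix (Fin k ⊕ Fin n) (Fin k ⊕ Fin n) ℂ) j l :=
        congrFun (congrFun (evalMatrix_dualFrame hm) j) l
      rw [Matrix.one_apply] at h2
      simpa [Finsupp.single_apply, evalMatrix, ψ] using h2
    have h3 := Submodule.projection_add_projection_eq_self c₁ (t j m)
    rw [← Submodule.coe_projectionOnto_apply, ← Submodule.coe_projectionOnto_apply, h1] at h3
    rw [← h3]
    simp only [qE, Basis.constr_basis]
  have hgraph : ∀ᶠ m in 𝓝 ℓ, IsGraph (qE m) (F m) := by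
    filter_upwards [htq, ht.frame] with m hm htm
    rw [isGraph_iff_of_basis b, ← htm.2]
    simp only [hm]
  let e : Fin k ⊕ Fin n ≃ Fin 10 := finSumFinEquiv.trans (finCongr hkn)
  let T₀ : SympTriv (symp vol) A F ℓ :=
    { L := F ℓ, L' := L', lagrangian_L := hF, lagrangian_L' := hL', isCompl := c₁, qA := q,
      qE := qE, graph_A := hq, graph_E := hgraph, b := b.reindex e }
  let a : Fin k ⊕ Fin n → ⋀[ℂ]^3 V := fun l => (b l : ⋀[ℂ]^3 V) + q (b l)
  have ha : Submodule.span ℂ (Set.range a) = A := (isGraph_iff_of_basis b).mp hq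
  have haA : ∀ l, a l ∈ A := fun l => hq.add_mem _
  have ha1 : ∀ l, a (Sum.inl l) = b (Sum.inl l) := by
    intro l
    simp only [a, hq.apply_eq_zero c₁ (hbA l)]
    simp
  let φ : Fin k ⊕ Fin n → Dual ℂ (⋀[ℂ]^3 V) := fun l => pairing vol (a l)
  have hN : ∀ m j l, evalMatrix t φ m j l = symp vol (t j m) (a l) := fun _ _ _ => rfl
  refine ⟨fun j => η (Sum.inl j), evalMatrix t φ, hηli.comp _ Sum.inl_injective, ?_, ?_, ?_, ?_,
    ?_, ?_, ?_, ?_, ?_⟩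
  · simp only [hη]
    exact hb
  · filter_upwards [ht.eventually] with m hm
    exact hm.evalMatrix_regular φ
  · filter_upwards [htq, ht.frame] with m hm htm
    have hmem : ∀ j, t j m ∈ F m := fun j => htm.2 ▸ Submodule.subset_span ⟨j, rfl⟩
    ext j l
    rw [transpose_apply, hN, hN]
    have h2 := hL'.apply_eq_zero (qE m (b j)).2 (q (b l)).2
    have h3 := hL'.apply_eq_zero (qE m (b l)).2 (q (b j)).2
    have h4 := hL'.apply_eq_zero (qE m (b j)).2 (qE m (b l)).2
    have h5 := hL'.apply_eq_zero (q (b j)).2 (q (b l)).2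
    have h6 := (F_lagrangian vol hV m).apply_eq_zero (hmem j) (hmem l)
    have h7 := hA.apply_eq_zero (haA j) (haA l)
    have h8 := symp_swap vol (b l) (q (b j))
    have h9 := symp_swap vol (qE m (b l)) (b j)
    have h10 := symp_swap vol (b l) (b j)
    rw [← hm, ← hm] at h6 ⊢
    simp only [a, map_add, LinearMap.add_apply] at h6 h7 ⊢
    linear_combination h3 - h2 - h7 + h5 - h6 + h4 + h8 + h9 + h10
  · intro i h
    exact D_eq_minorsIdeal vol hV hA T₀ ht e.symm ha i
  · filter_upwards [ht.eventually] with m hm h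
    exact Y_eq_minorsIdeal vol hV hA hm e.symm ha
  · intro j l
    rw [hN, htℓ]
    exact hA.apply_eq_zero (hbA j) (haA l)
  · intro j l
    rw [hN, htℓ, ha1]
    exact hF.apply_eq_zero (b j).2 (b (Sum.inl l)).2
  · -- a vector of the left kernel of the block lies in `A ∩ F_ℓ`
    intro h0
    obtain ⟨c, hc0, hc⟩ := Matrix.exists_vecMul_eq_zero_iff.mpr h0
    let β : ⋀[ℂ]^3 V := ∑ j, c j • (b (Sum.inr j) : ⋀[ℂ]^3 V)
    have hβF : β ∈ F ℓ := Submodule.sum_mem _ fun j _ => Submodule.smul_mem _ _ (b _).2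
    have hβa : ∀ l, symp vol (a l) β = 0 := by
      intro l
      rw [symp_swap, neg_eq_zero]
      rcases l with l | l
      · rw [ha1]
        exact hF.apply_eq_zero hβF (b _).2
      · have h1 := congrFun hc l
        simp only [Matrix.vecMul, dotProduct, toBlocks₂₂, Matrix.of_apply, hN, htℓ,
          Pi.zero_apply] at h1
        simpa [β] using h1
    have hβA : β ∈ A := by
      apply hA.mem
      intro X hX
      rw [← ha] at hX
      induction hX using Submodule.span_induction with
      | mem x hx =>
        obtain ⟨l, rfl⟩ := hx
        exact hβa l
      | zero => simp
      | add x y _ _ hx hy => simp [hx, hy]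
      | smul r x _ hx => simp [hx]
    have hmem : β ∈ Submodule.span ℂ (Set.range fun j => (b (Sum.inl j) : ⋀[ℂ]^3 V)) := by
      rw [hb]
      exact ⟨hβA, hβF⟩
    obtain ⟨d, hd⟩ := (Submodule.mem_span_range_iff_exists_fun ℂ).mp hmem
    have hli := Fintype.linearIndependent_iff.mp hbli (Sum.elim (-d) c) (by
      rw [Fintype.sum_sum_type]
      simp only [Sum.elim_inl, Sum.elim_inr, Pi.neg_apply, neg_smul, Finset.sum_neg_distrib, hd]
      simp [β])
    exact hc0 (funext fun j => hli (Sum.inr j))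
  · intro j l w
    have hg : ∀ i, IsRegularAt ℓ fun m => symp vol (s i m) (b (Sum.inl l)) := fun i =>
      hs.regular i (pairing vol (b (Sum.inl l)))
    have hP := IsRegularAt.matrix_inv (hs.evalMatrix_regular ψ) hdet
    have hNr := ht.evalMatrix_regular φ (Sum.inl j) (Sum.inl l)
    have h1 : germ _ hNr = ∑ i, germ _ (hP (Sum.inl j) i) * germ _ (hg i) := by
      refine Eq.trans ?_ (germ_sum Finset.univ fun i => (hP (Sum.inl j) i).mul (hg i)).symm
      refine germ_eq_iff.mpr (Eventually.of_forall fun m => ?_)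
      change symp vol (t (Sum.inl j) m) (a (Sum.inl l)) = _
      rw [ha1]
      simp [t, dualFrame]
    have hg0 : ∀ i, germValue ℓ (germ _ (hg i)) = 0 := by
      intro i
      rw [germValue_germ, hsℓ]
      exact hF.apply_eq_zero (b i).2 (b _).2
    have h2 := congrArg (germDifferential ℓ) h1
    rw [germDifferential_sum] at h2
    simp only [germDifferential_mul_of_value_eq_zero _ _ (hg0 _), germValue_germ, hψℓ,
      inv_one] at h2
    rw [germDifferential_germ] at h2
    rw [h2, Finset.sum_eq_single (Sum.inl j)]
    · have h3 : (fun m => symp vol (s (Sum.inl j) m) (b (Sum.inl l))) = fun m : ℙ ℂ V =>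
          (pairing vol (b (Sum.inl l)) ∘ₗ wedge12.flip (η (Sum.inl j))) m.rep / x₀ m.rep := by
        funext m
        simp [s, pairing_apply, div_eq_inv_mul]
      rw [germDifferential_germ, h3, Matrix.one_apply_eq]
      change (1 : ℂ) * differential ℓ _ w = _
      rw [differential_div _ _ hx₀, one_mul, hη]
      have h4 : (pairing vol (b (Sum.inl l)) ∘ₗ wedge12.flip (η (Sum.inl j))) ℓ.rep = 0 := by
        change symp vol (wedge12 ℓ.rep (η (Sum.inl j))) (b (Sum.inl l)) = 0
        rw [hη]
        exact hF.apply_eq_zero (b _).2 (b _).2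
      rw [h4, zero_mul, sub_zero]
      rfl
    · intro i _ hi
      rw [Matrix.one_apply_ne hi.symm]
      ext
      simp
    · simp

end LocalStructure

section SchurComplement

open Filter Matrix Module

variable {V : Type*} [NormedAddCommGroup V] [NormedSpace ℂ V] {ℓ : ℙ ℂ V} {k n : ℕ}

/-- The Schur complement of the lower right block. -/
def schur (N : Matrix (Fin k ⊕ Fin n) (Fin k ⊕ Fin n) ℂ) : Matrix (Fin k) (Fin k) ℂ :=
  N.toBlocks₁₁ - N.toBlocks₁₂ * N.toBlocks₂₂⁻¹ * N.toBlocks₂₁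

lemma schur_isSymm {N : Matrix (Fin k ⊕ Fin n) (Fin k ⊕ Fin n) ℂ} (h : N.IsSymm) :
    (schur N).IsSymm := by
  have h11 : N.toBlocks₁₁ᵀ = N.toBlocks₁₁ := by ext i j; exact h.apply _ _
  have h12 : N.toBlocks₁₂ᵀ = N.toBlocks₂₁ := by ext i j; exact h.apply _ _
  have h21 : N.toBlocks₂₁ᵀ = N.toBlocks₁₂ := by ext i j; exact h.apply _ _
  have h22 : N.toBlocks₂₂ᵀ = N.toBlocks₂₂ := by ext i j; exact h.apply _ _
  rw [Matrix.IsSymm, schur, transpose_sub, transpose_mul, transpose_mul, transpose_nonsing_inv,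
    h11, h12, h21, h22, Matrix.mul_assoc]

variable {N : ℙ ℂ V → Matrix (Fin k ⊕ Fin n) (Fin k ⊕ Fin n) ℂ}

lemma isRegularAt_schur_correction (hN : ∀ i j, IsRegularAt ℓ fun m => N m i j)
    (hdet : (N ℓ).toBlocks₂₂.det ≠ 0) (i j : Fin k) : IsRegularAt ℓ fun m =>
      ((N m).toBlocks₁₂ * (N m).toBlocks₂₂⁻¹ * (N m).toBlocks₂₁) i j :=
  IsRegularAt.matrix_mul (M := fun m => (N m).toBlocks₁₂ * (N m).toBlocks₂₂⁻¹)
    (N := fun m => (N m).toBlocks₂₁)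
    (IsRegularAt.matrix_mul (M := fun m => (N m).toBlocks₁₂) (N := fun m => (N m).toBlocks₂₂⁻¹)
      (fun i j => hN (Sum.inl i) (Sum.inr j))
      (IsRegularAt.matrix_inv (M := fun m => (N m).toBlocks₂₂)
        (fun i j => hN (Sum.inr i) (Sum.inr j)) hdet))
    (fun i j => hN (Sum.inr i) (Sum.inl j)) i j

lemma isRegularAt_schur (hN : ∀ i j, IsRegularAt ℓ fun m => N m i j)
    (hdet : (N ℓ).toBlocks₂₂.det ≠ 0) (i j : Fin k) : IsRegularAt ℓ fun m => schur (N m) i j :=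
  (hN (Sum.inl i) (Sum.inl j)).sub (isRegularAt_schur_correction hN hdet i j)

lemma germMatrix_schur [FiniteDimensional ℂ V] (hN : ∀ i j, IsRegularAt ℓ fun m => N m i j)
    (hdet : (N ℓ).toBlocks₂₂.det ≠ 0) :
    ∃ Y : Matrix (Fin n) (Fin n) (LocalRing ℓ),
      (germMatrix N hN).toBlocks₂₂ * Y = 1 ∧ Y * (germMatrix N hN).toBlocks₂₂ = 1 ∧
      germMatrix (fun m => schur (N m)) (isRegularAt_schur hN hdet) =
        (germMatrix N hN).toBlocks₁₁ -
          (germMatrix N hN).toBlocks₁₂ * Y * (germMatrix N hN).toBlocks₂₁ := by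
  have h12 : ∀ i j, IsRegularAt ℓ fun m => (N m).toBlocks₁₂ i j := fun i j => hN _ _
  have h21 : ∀ i j, IsRegularAt ℓ fun m => (N m).toBlocks₂₁ i j := fun i j => hN _ _
  have h22 : ∀ i j, IsRegularAt ℓ fun m => (N m).toBlocks₂₂ i j := fun i j => hN _ _
  have hinv := IsRegularAt.matrix_inv h22 hdet
  have hev := (IsRegularAt.det h22).eventually_ne_zero hdet
  have hone : germMatrix (fun _ : ℙ ℂ V => (1 : Matrix (Fin n) (Fin n) ℂ))
      (fun i j => isRegularAt_const ℓ _) = 1 := by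
    ext i j : 1
    by_cases h : i = j
    · subst h
      rw [Matrix.one_apply_eq]
      exact (germ_eq_iff (hf := isRegularAt_const_matrix ℓ 1 i i) (hg := isRegularAt_const ℓ 1)).mpr
        (Eventually.of_forall fun m => Matrix.one_apply_eq i)
    · rw [Matrix.one_apply_ne h]
      exact (germ_eq_iff (hf := isRegularAt_const_matrix ℓ 1 i j) (hg := isRegularAt_const ℓ 0)).mpr
        (Eventually.of_forall fun m => Matrix.one_apply_ne h)
  refine ⟨germMatrix _ hinv, ?_, ?_, ?_⟩
  · change germMatrix _ h22 * _ = 1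
    rw [germMatrix_mul, ← hone]
    apply germMatrix_congr
    filter_upwards [hev] with m hm
    exact Matrix.mul_nonsing_inv _ (Ne.isUnit hm)
  · change _ * germMatrix _ h22 = 1
    rw [germMatrix_mul, ← hone]
    apply germMatrix_congr
    filter_upwards [hev] with m hm
    exact Matrix.nonsing_inv_mul _ (Ne.isUnit hm)
  · change _ = _ - germMatrix _ h12 * _ * germMatrix _ h21
    rw [germMatrix_mul, germMatrix_mul]
    rfl

lemma minorsIdeal_germMatrix [FiniteDimensional ℂ V]
    (hN : ∀ i j, IsRegularAt ℓ fun m => N m i j) (hdet : (N ℓ).toBlocks₂₂.det ≠ 0) (p : ℕ) :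
    minorsIdeal p (germMatrix N hN) = minorsIdeal p
      (fromBlocks (germMatrix (fun m => schur (N m)) (isRegularAt_schur hN hdet)) 0 0
        (1 : Matrix (Fin n) (Fin n) (LocalRing ℓ))) := by
  obtain ⟨Y, h1, h2, h3⟩ := germMatrix_schur hN hdet
  rw [h3, ← fromBlocks_toBlocks (germMatrix N hN)]
  exact minorsIdeal_fromBlocks p _ _ _ _ Y h1 h2

/-- If the off-diagonal blocks vanish at `ℓ`, the correction term of the Schur complement vanishes
to second order. -/
lemma differential_schur [FiniteDimensional ℂ V] (hN : ∀ i j, IsRegularAt ℓ fun m => N m i j)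
    (hdet : (N ℓ).toBlocks₂₂.det ≠ 0) (h1 : ∀ j l, N ℓ (Sum.inl j) l = 0)
    (h2 : ∀ j l, N ℓ j (Sum.inl l) = 0) (j l : Fin k) :
    differential ℓ (fun m => schur (N m) j l) =
      differential ℓ fun m => N m (Sum.inl j) (Sum.inl l) := by
  obtain ⟨Y, -, -, h3⟩ := germMatrix_schur hN hdet
  have h4 : germ _ (isRegularAt_schur hN hdet j l) = germ _ (hN (Sum.inl j) (Sum.inl l)) -
      ∑ i, ((germMatrix N hN).toBlocks₁₂ * Y) j i * germ _ (hN (Sum.inr i) (Sum.inl l)) :=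
    congrFun (congrFun h3 j) l
  have h5 := congrArg (germDifferential ℓ) h4
  have h6 : ∀ i, germValue ℓ (((germMatrix N hN).toBlocks₁₂ * Y) j i) = 0 := by
    intro i
    rw [Matrix.mul_apply, map_sum]
    refine Finset.sum_eq_zero fun a _ => ?_
    rw [map_mul]
    have : germValue ℓ ((germMatrix N hN).toBlocks₁₂ j a) = 0 := h1 j (Sum.inr a)
    rw [this, zero_mul]
  have h7 : ∀ i, germValue ℓ (germ _ (hN (Sum.inr i) (Sum.inl l))) = 0 := fun i => h2 _ _
  rw [germDifferential_sub, germDifferential_sum] at h5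
  simp only [germDifferential_mul_of_value_eq_zero _ _ (h7 _), h6, germDifferential_germ] at h5
  rw [h5]
  ext w
  simp

end SchurComplement

section NormalForm

open Filter Matrix Module

variable {V : Type*} [NormedAddCommGroup V] [NormedSpace ℂ V] (vol : ⋀[ℂ]^6 V ≃ₗ[ℂ] ℂ)
  {A : Submodule ℂ (⋀[ℂ]^3 V)}

/-- Near a point `ℓ` where `K = A ∩ F_ℓ` has dimension `k`, the degeneracy loci are those of a
symmetric `k × k`-matrix `S` of regular functions that vanishes at `ℓ`, with the differential
`w ↦ σ(w ∧ η, ℓ ∧ η')` on `K`. -/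
theorem exists_normal_form (hV : finrank ℂ V = 6) (hA : IsLagrangian (symp vol) A) (ℓ : ℙ ℂ V)
    {k : ℕ} (hk : finrank ℂ ↥(A ⊓ F ℓ) = k) :
    ∃ (η : Fin k → ⋀[ℂ]^2 V) (S : ℙ ℂ V → Matrix (Fin k) (Fin k) ℂ),
      LinearIndependent ℂ (fun j => wedge12 ℓ.rep (η j)) ∧
      Submodule.span ℂ (Set.range fun j => wedge12 ℓ.rep (η j)) = A ⊓ F ℓ ∧
      (∀ᶠ m in 𝓝 ℓ, ∀ i j, IsRegularAt m fun m => S m i j) ∧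
      (∀ᶠ m in 𝓝 ℓ, (S m).IsSymm) ∧ S ℓ = 0 ∧
      (∀ j l w, differential ℓ (fun m => S m j l) w =
        symp vol (wedge12 w (η j)) (wedge12 ℓ.rep (η l))) ∧
      (∀ h : ∀ i j, IsRegularAt ℓ fun m => S m i j,
        D vol A k ℓ = entriesIdeal (germMatrix S h)) ∧
      (∀ i, D vol A i ℓ ≠ ⊤ ↔ i ≤ k) ∧
      (∀ᶠ m in 𝓝 ℓ, ∀ h : ∀ i j, IsRegularAt m fun m => S m i j,
        Y A m = Ideal.span {(germMatrix S h).det}) := by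
  have : FiniteDimensional ℂ V := .of_finrank_pos (by omega)
  have hk10 : k ≤ 10 := by
    rw [← hk, ← (F_lagrangian vol hV ℓ).finrank_eq vol hV]
    exact Submodule.finrank_mono inf_le_right
  obtain ⟨n, hkn⟩ : ∃ n, k + n = 10 := ⟨10 - k, by omega⟩
  obtain ⟨η, N, hli, hspan, hreg, hsymm, hD, hY, h1, h2, hdet, hdiff⟩ :=
    exists_local_matrix vol hV hA ℓ hk hkn
  have hregℓ := hreg.self_of_nhds
  have hdetev : ∀ᶠ m in 𝓝 ℓ, (N m).toBlocks₂₂.det ≠ 0 :=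
    (IsRegularAt.det (M := fun m => (N m).toBlocks₂₂)
      (fun i j => hregℓ (Sum.inr i) (Sum.inr j))).eventually_ne_zero hdet
  have hS0 : schur (N ℓ) = 0 := by
    ext j l
    simp [schur, Matrix.mul_apply, toBlocks₁₁, toBlocks₁₂, toBlocks₂₁, h1, h2]
  have hminors := fun i => (hD i hregℓ).trans (minorsIdeal_germMatrix hregℓ hdet _)
  refine ⟨η, fun m => schur (N m), hli, hspan, ?_, ?_, hS0, ?_, ?_, ?_, ?_⟩
  · filter_upwards [hreg, hdetev] with m hm hm'
    exact isRegularAt_schur hm hm'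
  · filter_upwards [hsymm] with m hm
    exact schur_isSymm hm
  · intro j l w
    rw [differential_schur hregℓ hdet h1 h2, hdiff]
  · intro h
    rw [hminors]
    have h11 : 11 - k = n + 1 := by omega
    rw [h11]
    exact le_antisymm (minorsIdeal_diag_le _ n.lt_succ_self) (le_minorsIdeal_diag _)
  · intro i
    rw [hminors]
    constructor
    · intro h
      by_contra hik
      exact h (minorsIdeal_diag_eq_top _ (by omega))
    · intro hik
      rw [ne_top_iff_germValue]
      intro x hx
      have hx' := minorsIdeal_diag_le _ (by omega : n < 11 - i) hx
      refine (germDifferential_mem_span ?_ hx').1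
      rintro _ ⟨⟨a, c⟩, rfl⟩
      exact congrFun (congrFun hS0 a) c
  · filter_upwards [hreg, hdetev, hY] with m hm hm' hYm h
    rw [hYm hm, minorsIdeal_germMatrix hm hm', minorsIdeal_card
      (finSumFinEquiv.trans (finCongr hkn)).symm, det_fromBlocks_zero₂₁, det_one, mul_one]

end NormalForm

/-! ### Decomposable trivectors and the differential of the normal form -/

section Decomposables

open Filter Matrix Module exteriorPower

variable {V : Type*} [NormedAddCommGroup V] [NormedSpace ℂ V] (vol : ⋀[ℂ]^6 V ≃ₗ[ℂ] ℂ)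
  {A : Submodule ℂ (⋀[ℂ]^3 V)} {ℓ : ℙ ℂ V}

/-- `A ∩ F_ℓ` contains no nonzero decomposable trivector. The decomposable trivectors in `F_ℓ`
are the `ℓ ∧ x ∧ y`. -/
def NoDecomposable (A : Submodule ℂ (⋀[ℂ]^3 V)) (ℓ : ℙ ℂ V) : Prop :=
  ∀ x y : V, wedge12 ℓ.rep (wedge11 x y) ∈ A → wedge12 ℓ.rep (wedge11 x y) = 0

lemma eq_vec₃ {W : Type*} (v : Fin 3 → W) : v = ![v 0, v 1, v 2] := by
  ext i
  fin_cases i <;> rfl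

lemma forall_noDecomposable_iff :
    (∀ ℓ, NoDecomposable A ℓ) ↔ ∀ v : Fin 3 → V, ιMulti ℂ 3 v ∈ A → ιMulti ℂ 3 v = 0 := by
  constructor
  · intro h v hv
    by_cases h0 : v 0 = 0
    · exact (ιMulti ℂ 3).map_coord_zero 0 h0
    obtain ⟨c, hc, hrep⟩ := exists_rep_mk_eq h0
    have h1 : wedge12 (Projectivization.mk ℂ (v 0) h0).rep (wedge11 (v 1) (v 2)) =
        c • ιMulti ℂ 3 v := by
      rw [hrep, map_smul, LinearMap.smul_apply, wedge12_wedge11, ← eq_vec₃ v]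
    have h2 := h _ _ _ (h1 ▸ A.smul_mem c hv)
    rw [h1, smul_eq_zero] at h2
    exact h2.resolve_left hc
  · intro h ℓ x y hxy
    rw [wedge12_wedge11] at hxy ⊢
    exact h _ hxy

lemma ιMulti_eq_zero_of_not_linearIndependent {v : Fin 3 → V} (h : ¬LinearIndependent ℂ v) :
    ιMulti ℂ 3 v = 0 := (ιMulti ℂ 3).map_linearDependent v h

lemma wedge12_ιMulti₂ (v : V) (x : Fin 2 → V) :
    wedge12 v (ιMulti ℂ 2 x) = ιMulti ℂ 3 ![v, x 0, x 1] := by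
  rw [← wedge12_wedge11, wedge11_apply]
  congr 2

lemma symp_ιMulti_eq_zero_of_mem_span {v : Fin 3 → V} {w a b : V}
    (hw : w ∈ Submodule.span ℂ (Set.range v)) :
    symp vol (ιMulti ℂ 3 ![w, a, b]) (ιMulti ℂ 3 v) = 0 := by
  rw [symp_ιMulti]
  apply AlternatingMap.map_linearDependent
  intro hli
  obtain ⟨c, hc⟩ := (Submodule.mem_span_range_iff_exists_fun ℂ).mp hw
  have h := Fintype.linearIndependent_iff.mp hli ![-1, 0, 0, c 0, c 1, c 2] (by
    rw [Fin.sum_univ_three] at hc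
    simp [Fin.sum_univ_six, ← hc]
    abel) 0
  simp at h

lemma ιMulti_mem_F_of_mem_span (hV : finrank ℂ V = 6) {v : Fin 3 → V}
    (hℓ : ℓ.rep ∈ Submodule.span ℂ (Set.range v)) : ιMulti ℂ 3 v ∈ F ℓ := by
  obtain ⟨vol⟩ : Nonempty (⋀[ℂ]^6 V ≃ₗ[ℂ] ℂ) := by
    have : FiniteDimensional ℂ V := .of_finrank_pos (by omega)
    apply FiniteDimensional.nonempty_linearEquiv_of_finrank_eq
    rw [exteriorPower.finrank_eq, hV, finrank_self]; rfl
  apply (F_lagrangian vol hV ℓ).mem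
  intro X hX
  obtain ⟨η, rfl⟩ := mem_F.mp hX
  have h : (symp vol).flip (ιMulti ℂ 3 v) ∘ₗ wedge12 ℓ.rep = 0 := by
    apply exteriorPower.linearMap_ext
    ext x
    change symp vol (wedge12 ℓ.rep (ιMulti ℂ 2 x)) (ιMulti ℂ 3 v) = 0
    rw [wedge12_ιMulti₂]
    exact symp_ιMulti_eq_zero_of_mem_span vol hℓ
  exact LinearMap.congr_fun h η

/-- A nonzero decomposable trivector lies in `F_ℓ` only for `ℓ` in its three-dimensional
subspace. -/
lemma mem_span_of_ιMulti_mem_F (hV : finrank ℂ V = 6) {v : Fin 3 → V}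
    (hv : LinearIndependent ℂ v) (h : ιMulti ℂ 3 v ∈ F ℓ) :
    ℓ.rep ∈ Submodule.span ℂ (Set.range v) := by
  have : FiniteDimensional ℂ V := .of_finrank_pos (by omega)
  obtain ⟨vol⟩ : Nonempty (⋀[ℂ]^6 V ≃ₗ[ℂ] ℂ) := by
    apply FiniteDimensional.nonempty_linearEquiv_of_finrank_eq
    rw [exteriorPower.finrank_eq, hV, finrank_self]; rfl
  by_contra hℓ
  have h4 : LinearIndependent ℂ (Fin.snoc v ℓ.rep : Fin 4 → V) :=
    linearIndependent_finSnoc.mpr ⟨hv, hℓ⟩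
  have hlt : ∀ {n : ℕ} (u : Fin n → V), n < 6 →
      ∃ x, x ∉ Submodule.span ℂ (Set.range u) := by
    intro n u hn
    by_contra! hall
    have htop : Submodule.span ℂ (Set.range u) = ⊤ := by
      rw [Submodule.eq_top_iff']
      exact hall
    have h1 := finrank_range_le_card (R := ℂ) (b := u)
    rw [Set.finrank, htop, finrank_top, hV, Fintype.card_fin] at h1
    omega
  obtain ⟨x, hx⟩ := hlt _ (by norm_num : 4 < 6)
  have h5 := linearIndependent_finSnoc.mpr ⟨h4, hx⟩
  obtain ⟨y, hy⟩ := hlt _ (by norm_num : 5 < 6)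
  have h6 := linearIndependent_finSnoc.mpr ⟨h5, hy⟩
  apply volForm_ne_zero_of_linearIndependent vol hV h6
  have h7 : (Fin.snoc (Fin.snoc (Fin.snoc v ℓ.rep : Fin 4 → V) x : Fin 5 → V) y : Fin 6 → V) =
      ![v 0, v 1, v 2, ℓ.rep, x, y] := by
    ext i
    fin_cases i <;> rfl
  rw [h7]
  have h8 := (F_lagrangian vol hV ℓ).apply_eq_zero h (mem_F.mpr ⟨wedge11 x y, rfl⟩)
  rwa [wedge12_wedge11, symp_ιMulti] at h8

variable {k : ℕ} {η : Fin k → ⋀[ℂ]^2 V}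

/-- A decomposable trivector in `A ∩ F_ℓ` gives a relation between the differentials
`w ↦ σ(w ∧ η, ℓ ∧ η')`. -/
lemma exists_relation
    (hspan : Submodule.span ℂ (Set.range fun j => wedge12 ℓ.rep (η j)) = A ⊓ F ℓ)
    (h : ¬NoDecomposable A ℓ) :
    ∃ t : Fin k → ℂ, t ≠ 0 ∧ ∀ w, ∑ j, ∑ l, t j * t l *
      symp vol (wedge12 w (η j)) (wedge12 ℓ.rep (η l)) = 0 := by
  rw [NoDecomposable] at h
  push Not at h
  obtain ⟨x, y, hxy, hne⟩ := h
  have hmem : wedge12 ℓ.rep (wedge11 x y) ∈ A ⊓ F ℓ := ⟨hxy, mem_F.mpr ⟨_, rfl⟩⟩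
  rw [← hspan] at hmem
  obtain ⟨t, ht⟩ := (Submodule.mem_span_range_iff_exists_fun ℂ).mp hmem
  refine ⟨t, ?_, fun w => ?_⟩
  · rintro rfl
    apply hne
    rw [← ht]
    simp
  have h1 : wedge12 ℓ.rep (∑ j, t j • η j) = wedge12 ℓ.rep (wedge11 x y) := by
    rw [← ht, map_sum]
    simp only [map_smul]
  have h2 := symp_wedge12_congr vol w h1 h1
  rw [symp_decomposable] at h2
  rw [← h2]
  simp only [map_sum, map_smul, LinearMap.sum_apply, LinearMap.smul_apply, smul_eq_mul,
    Finset.mul_sum, mul_assoc]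
  rw [Finset.sum_comm]
  refine Finset.sum_congr rfl fun j _ => Finset.sum_congr rfl fun l _ => ?_
  ring

lemma ne_zero_of_noDecomposable (hV : finrank ℂ V = 6) {η : Fin 1 → ⋀[ℂ]^2 V}
    (hli : LinearIndependent ℂ fun j => wedge12 ℓ.rep (η j))
    (hspan : Submodule.span ℂ (Set.range fun j => wedge12 ℓ.rep (η j)) = A ⊓ F ℓ)
    (h : NoDecomposable A ℓ) :
    ¬∀ w, symp vol (wedge12 w (η 0)) (wedge12 ℓ.rep (η 0)) = 0 := by
  intro h0
  obtain ⟨x, y, hxy⟩ := decomposable_of_symp_eq_zero vol hV ℓ.rep_nonzero h0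
  apply hli.ne_zero 0
  have hmem : wedge12 ℓ.rep (η 0) ∈ A ⊓ F ℓ := by
    rw [← hspan]
    exact Submodule.subset_span ⟨0, rfl⟩
  rw [hxy] at hmem ⊢
  exact h _ _ hmem.1

lemma independent_of_noDecomposable (hV : finrank ℂ V = 6) {η : Fin 2 → ⋀[ℂ]^2 V}
    (hli : LinearIndependent ℂ fun j => wedge12 ℓ.rep (η j))
    (hspan : Submodule.span ℂ (Set.range fun j => wedge12 ℓ.rep (η j)) = A ⊓ F ℓ)
    (h : NoDecomposable A ℓ) (a b d : ℂ)
    (h0 : ∀ w, a * symp vol (wedge12 w (η 0)) (wedge12 ℓ.rep (η 0)) +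
      b * symp vol (wedge12 w (η 0)) (wedge12 ℓ.rep (η 1)) +
      d * symp vol (wedge12 w (η 1)) (wedge12 ℓ.rep (η 1)) = 0) : a = 0 ∧ b = 0 ∧ d = 0 := by
  refine symp_products_independent vol hV ℓ.rep_nonzero ?_ a b d h0
  rintro s t ⟨x, y, hxy⟩
  have hmem : wedge12 ℓ.rep (s • η 0 + t • η 1) ∈ A ⊓ F ℓ := by
    rw [← hspan, map_add, map_smul, map_smul]
    exact add_mem (Submodule.smul_mem _ _ (Submodule.subset_span ⟨0, rfl⟩))
      (Submodule.smul_mem _ _ (Submodule.subset_span ⟨1, rfl⟩))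
  rw [hxy] at hmem
  have h1 := h _ _ hmem.1
  rw [← hxy, map_add, map_smul, map_smul] at h1
  have h2 := Fintype.linearIndependent_iff.mp hli ![s, t] (by
    rw [Fin.sum_univ_two]
    exact h1)
  exact ⟨h2 0, h2 1⟩

end Decomposables

/-! ### Smoothness of the strata -/

section Strata

open Filter Matrix Module

variable {V : Type*} [NormedAddCommGroup V] [NormedSpace ℂ V] {ℓ : ℙ ℂ V}

/-- The Jacobian criterion for a subscheme with as many equations as its codimension. -/
theorem regular_quotient_iff [FiniteDimensional ℂ V] (hV : finrank ℂ V = 6) {c : ℕ}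
    (f : Fin c → LocalRing ℓ) (hf : ∀ i, germValue ℓ (f i) = 0) :
    (IsRegularLocalRing (LocalRing ℓ ⧸ Ideal.span (Set.range f)) ∧
      ringKrullDim (LocalRing ℓ) = ringKrullDim (LocalRing ℓ ⧸ Ideal.span (Set.range f)) + c) ↔
      LinearIndependent ℂ fun i => germDifferential ℓ (f i) := by
  refine ⟨fun ⟨h1, h2⟩ => ?_, isRegularLocalRing_quotient hV f hf⟩
  have h3 := IsRegularLocalRing.spanFinrank_maximalIdeal
    (R := LocalRing ℓ ⧸ Ideal.span (Set.range f))
  have h4 := five_le_of_isRegularLocalRing_quotient hV (S := Set.range f)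
    (by rintro _ ⟨i, rfl⟩; exact hf i) h1 h3.symm
  rw [ringKrullDim_localRing hV, ← h3] at h2
  have h5 : 5 = Submodule.spanFinrank (IsLocalRing.maximalIdeal
    (LocalRing ℓ ⧸ Ideal.span (Set.range f))) + c := by exact_mod_cast h2
  rw [linearIndependent_iff_card_le_finrank_span, Fintype.card_fin, Set.finrank]
  rw [← Set.range_comp] at h4
  change 5 ≤ _ + finrank ℂ (Submodule.span ℂ (Set.range fun i => germDifferential ℓ (f i))) at h4
  omega

/-- A regular quotient of the local ring by one equation without linear term is the local ring
itself. -/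
theorem eq_zero_of_isRegularLocalRing_quotient [FiniteDimensional ℂ V] (hV : finrank ℂ V = 6)
    {f : LocalRing ℓ} (hf : germValue ℓ f = 0) (hdf : germDifferential ℓ f = 0)
    (h : IsRegularLocalRing (LocalRing ℓ ⧸ Ideal.span {f})) : f = 0 := by
  by_contra hne
  have := isDomain_localRing hV ℓ
  have h3 := IsRegularLocalRing.spanFinrank_maximalIdeal (R := LocalRing ℓ ⧸ Ideal.span {f})
  have h4 := five_le_of_isRegularLocalRing_quotient hV (S := {f})
    (by rintro _ rfl; exact hf) h h3.symm
  have h5 := ringKrullDim_quotient_succ_le_of_nonZeroDivisor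
    (mem_nonZeroDivisors_of_ne_zero hne)
  rw [ringKrullDim_localRing hV, ← h3] at h5
  have h6 : Submodule.spanFinrank (IsLocalRing.maximalIdeal
    (LocalRing ℓ ⧸ Ideal.span {f})) + 1 ≤ 5 := by exact_mod_cast h5
  have h7 : finrank ℂ (Submodule.span ℂ ({0} : Set (V →L[ℂ] ℂ))) = 0 := by
    rw [Submodule.span_zero_singleton, finrank_bot]
  rw [Set.image_singleton, hdf, h7] at h4
  omega

variable (vol : ⋀[ℂ]^6 V ≃ₗ[ℂ] ℂ) {A : Submodule ℂ (⋀[ℂ]^3 V)}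

/-- At a point where `K = A ∩ F_ℓ` is one-dimensional, `D_1(A, F) = Y_A` is given by one function.
Its differential vanishes if and only if `K` is spanned by a decomposable trivector. -/
theorem exists_equation_of_finrank_one (hV : finrank ℂ V = 6) (hA : IsLagrangian (symp vol) A)
    (hk : finrank ℂ ↥(A ⊓ F ℓ) = 1) :
    ∃ f : LocalRing ℓ, germValue ℓ f = 0 ∧ D vol A 1 ℓ = Ideal.span {f} ∧
      Y A ℓ = Ideal.span {f} ∧ (germDifferential ℓ f ≠ 0 ↔ NoDecomposable A ℓ) ∧
      (f = 0 → ∀ᶠ m in 𝓝 ℓ, Y A m = ⊥) := by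
  obtain ⟨η, S, hli, hspan, hreg, -, hS0, hdiff, hD, -, hY⟩ := exists_normal_form vol hV hA ℓ hk
  have hr := hreg.self_of_nhds
  refine ⟨germ _ (hr 0 0), congrFun (congrFun hS0 0) 0, ?_, ?_, ?_, ?_⟩
  · rw [hD hr, entriesIdeal]
    congr 1
    ext x
    constructor
    · rintro ⟨⟨i, j⟩, rfl⟩
      rw [Subsingleton.elim i 0, Subsingleton.elim j 0]
      rfl
    · rintro rfl
      exact ⟨(0, 0), rfl⟩
  · rw [hY.self_of_nhds hr, det_fin_one]
    rfl
  · constructor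
    · intro hne
      by_contra hno
      obtain ⟨t, ht0, ht⟩ := exists_relation vol hspan hno
      apply hne
      ext w
      have h1 := ht w
      simp only [Finset.univ_unique, Fin.default_eq_zero, Finset.sum_singleton] at h1
      have ht1 : t 0 ≠ 0 := fun h => ht0 (funext fun i => by
        rw [Subsingleton.elim i 0, h]; rfl)
      rw [germDifferential_germ, hdiff]
      exact (mul_eq_zero.mp h1).resolve_left (mul_ne_zero ht1 ht1)
    · intro hno h0
      apply ne_zero_of_noDecomposable vol hV hli hspan hno
      intro w
      rw [← hdiff, ← germDifferential_germ (hr 0 0), h0]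
      rfl
  · intro hf
    have hf' : (fun m => S m 0 0) =ᶠ[𝓝 ℓ] fun _ => 0 :=
      germ_eq_iff (hf := hr 0 0) (hg := isRegularAt_const ℓ 0).mp hf
    filter_upwards [hf'.eventually_nhds, hY, hreg] with m hm hYm hrm
    rw [hYm hrm, det_fin_one]
    have : germMatrix S hrm 0 0 = 0 :=
      germ_eq_iff (hf := hrm 0 0) (hg := isRegularAt_const m 0).mpr hm
    rw [this, Ideal.span_singleton_eq_bot]

/-- At a point where `A ∩ F_ℓ` is two-dimensional, `D_2(A, F)` is given by three functions, which
have independent differentials if and only if `A ∩ F_ℓ` contains no decomposable trivector, and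
`Y_A` is given by their discriminant. -/
theorem exists_equations_of_finrank_two (hV : finrank ℂ V = 6) (hA : IsLagrangian (symp vol) A)
    (hk : finrank ℂ ↥(A ⊓ F ℓ) = 2) :
    ∃ x y z : ℙ ℂ V → ℂ, x ℓ = 0 ∧ y ℓ = 0 ∧ z ℓ = 0 ∧
      (∀ᶠ m in 𝓝 ℓ, IsRegularAt m x ∧ IsRegularAt m y ∧ IsRegularAt m z) ∧
      (∀ (hx : IsRegularAt ℓ x) (hy : IsRegularAt ℓ y) (hz : IsRegularAt ℓ z),
        D vol A 2 ℓ = Ideal.span (Set.range ![germ x hx, germ y hy, germ z hz])) ∧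
      (∀ᶠ m in 𝓝 ℓ, ∃ h : IsRegularAt m (x * z - y ^ 2), Y A m = Ideal.span {germ _ h}) ∧
      (LinearIndependent ℂ ![differential ℓ x, differential ℓ y, differential ℓ z] ↔
        NoDecomposable A ℓ) := by
  obtain ⟨η, S, hli, hspan, hreg, hsymm, hS0, hdiff, hD, -, hY⟩ :=
    exists_normal_form vol hV hA ℓ hk
  have hr := hreg.self_of_nhds
  have hsy : germ _ (hr 1 0) = germ _ (hr 0 1) := by
    rw [germ_eq_iff]
    filter_upwards [hsymm] with m hm
    exact hm.apply 0 1
  have hdsy : differential ℓ (fun m => S m 1 0) = differential ℓ fun m => S m 0 1 :=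
    congrArg (germDifferential ℓ) hsy
  refine ⟨fun m => S m 0 0, fun m => S m 0 1, fun m => S m 1 1, congrFun (congrFun hS0 0) 0,
    congrFun (congrFun hS0 0) 1, congrFun (congrFun hS0 1) 1, ?_, ?_, ?_, ?_⟩
  · filter_upwards [hreg] with m hm
    exact ⟨hm 0 0, hm 0 1, hm 1 1⟩
  · intro hx hy hz
    rw [hD hr, entriesIdeal]
    congr 1
    ext f
    constructor
    · rintro ⟨⟨i, j⟩, rfl⟩
      fin_cases i <;> fin_cases j
      exacts [⟨0, rfl⟩, ⟨1, rfl⟩, ⟨1, hsy.symm⟩, ⟨2, rfl⟩]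
    · rintro ⟨i, rfl⟩
      fin_cases i
      exacts [⟨(0, 0), rfl⟩, ⟨(0, 1), rfl⟩, ⟨(1, 1), rfl⟩]
  · filter_upwards [hreg, hsymm.eventually_nhds, hY] with m hm hsm hYm
    have h : IsRegularAt m ((fun m => S m 0 0) * (fun m => S m 1 1) - (fun m => S m 0 1) ^ 2) :=
      (regularFunctions m).sub_mem ((regularFunctions m).mul_mem (hm 0 0) (hm 1 1))
        ((regularFunctions m).pow_mem (hm 0 1) 2)
    refine ⟨h, ?_⟩
    rw [hYm hm, germMatrix_det]
    congr 2
    rw [germ_eq_iff]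
    filter_upwards [hsm] with m' hm'
    have := hm'.apply 0 1
    rw [det_fin_two, this]
    simp [sq]
  · constructor
    · intro hind
      by_contra hno
      obtain ⟨t, ht0, ht⟩ := exists_relation vol hspan hno
      have h1 := Fintype.linearIndependent_iff.mp hind ![t 0 * t 0, 2 * (t 0 * t 1), t 1 * t 1]
        (by
          ext w
          have h2 := ht w
          simp only [Fin.sum_univ_two, ← hdiff, hdsy] at h2
          simp [Fin.sum_univ_three]
          linear_combination h2)
      have h00 := h1 0
      have h11 := h1 2
      simp only [Matrix.cons_val] at h00 h11
      apply ht0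
      funext i
      fin_cases i
      · exact mul_self_eq_zero.mp h00
      · exact mul_self_eq_zero.mp h11
    · intro hno
      rw [Fintype.linearIndependent_iff]
      intro g hg
      have h1 := independent_of_noDecomposable vol hV hli hspan hno (g 0) (g 1) (g 2) (by
        intro w
        have := congrArg (fun φ : V →L[ℂ] ℂ => φ w) hg
        simpa [Fin.sum_univ_three, hdiff] using this)
      intro i
      fin_cases i
      exacts [h1.1, h1.2.1, h1.2.2]

lemma D_ne_top_iff (hV : finrank ℂ V = 6) (hA : IsLagrangian (symp vol) A) (i : ℕ) :
    D vol A i ℓ ≠ ⊤ ↔ i ≤ finrank ℂ ↥(A ⊓ F ℓ) := by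
  obtain ⟨-, -, -, -, -, -, -, -, -, h, -⟩ := exists_normal_form vol hV hA ℓ rfl
  exact h i

/-- The strata are smooth of the expected codimension exactly where `A ∩ F_ℓ` contains no
decomposable trivector. -/
theorem smooth_stratum_iff (hV : finrank ℂ V = 6) (hA : IsLagrangian (symp vol) A) {k : ℕ}
    (hk : finrank ℂ ↥(A ⊓ F ℓ) = k) (hk2 : k ≤ 2) :
    ((D vol A k).SmoothAt ℓ ∧ (D vol A k).CodimAt ℓ (k * (k + 1) / 2)) ↔ NoDecomposable A ℓ := by
  have : FiniteDimensional ℂ V := .of_finrank_pos (by omega)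
  rw [StalkIdeals.SmoothAt, StalkIdeals.CodimAt]
  obtain rfl | rfl | rfl : k = 0 ∨ k = 1 ∨ k = 2 := by omega
  · have h0 : A ⊓ F ℓ = ⊥ := Submodule.finrank_eq_zero.mp hk
    obtain ⟨-, S, -, -, hreg, -, -, -, hD, -, -⟩ := exists_normal_form vol hV hA ℓ hk
    have hD' : D vol A 0 ℓ = Ideal.span (Set.range (Fin.elim0 : Fin 0 → LocalRing ℓ)) := by
      rw [hD hreg.self_of_nhds, entriesIdeal]
      congr 1
      rw [Set.range_eq_empty, Set.range_eq_empty]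
    rw [hD']
    refine iff_of_true (isRegularLocalRing_quotient hV Fin.elim0 (fun i => i.elim0)
      linearIndependent_empty_type) ?_
    intro x y hxy
    have : wedge12 ℓ.rep (wedge11 x y) ∈ A ⊓ F ℓ := ⟨hxy, mem_F.mpr ⟨_, rfl⟩⟩
    rwa [h0] at this
  · obtain ⟨f, hf0, hD, -, hf, -⟩ := exists_equation_of_finrank_one vol hV hA hk
    rw [hD, ← hf, show ({f} : Set (LocalRing ℓ)) = Set.range ![f] by simp]
    refine (regular_quotient_iff hV ![f] (fun i => by fin_cases i; exact hf0)).trans ?_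
    rw [linearIndependent_unique_iff]
    rfl
  · obtain ⟨x, y, z, hx0, hy0, hz0, hreg, hD, -, hind⟩ :=
      exists_equations_of_finrank_two vol hV hA hk
    obtain ⟨hx, hy, hz⟩ := hreg.self_of_nhds
    rw [hD hx hy hz, ← hind]
    refine (regular_quotient_iff hV ![germ x hx, germ y hy, germ z hz] (fun i => by
      fin_cases i
      exacts [hx0, hy0, hz0])).trans ?_
    have : (fun i => germDifferential ℓ (![germ x hx, germ y hy, germ z hz] i)) =
        ![differential ℓ x, differential ℓ y, differential ℓ z] := by
      funext i
      fin_cases i <;> rfl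
    rw [this]

end Strata

/-! ### Analytic germs -/

section Analytic

open Filter Module

variable {V : Type*} [NormedAddCommGroup V] [NormedSpace ℂ V] {ℓ : ℙ ℂ V}

/-- The germ of a function that is holomorphic at `ℓ`. -/
def anGerm (f : ℙ ℂ V → ℂ) (hf : IsHolomorphicAt ℓ f) : AnLocalRing ℓ :=
  ⟨(f : (𝓝 ℓ).Germ ℂ), f, hf, rfl⟩

lemma idealGen_singleton (R : Subring ((𝓝 ℓ).Germ ℂ)) (f : R) :
    idealGen R {(f : (𝓝 ℓ).Germ ℂ)} = Ideal.span {f} := by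
  rw [idealGen]
  congr 1
  ext g
  exact Subtype.ext_iff.symm

lemma localRing_le_anLocalRing [FiniteDimensional ℂ V] : LocalRing ℓ ≤ AnLocalRing ℓ := by
  rintro _ ⟨f, hf, rfl⟩
  exact ⟨f, IsRegularAt.isHolomorphicAt hf, rfl⟩

/-- The analytic ideal of a subscheme given by one equation. -/
lemma StalkIdeals.an_of_eq_span [FiniteDimensional ℂ V] {Z : StalkIdeals V} {f : LocalRing ℓ}
    (h : Z ℓ = Ideal.span {f}) : Z.an ℓ = idealGen (AnLocalRing ℓ) {(f : (𝓝 ℓ).Germ ℂ)} := by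
  let f' : AnLocalRing ℓ := ⟨f, localRing_le_anLocalRing f.2⟩
  have h1 := idealGen_singleton (AnLocalRing ℓ) f'
  change idealGen (AnLocalRing ℓ) {(f : (𝓝 ℓ).Germ ℂ)} = _ at h1
  rw [h1]
  apply le_antisymm
  · rw [StalkIdeals.an, idealGen, Ideal.span_le]
    rintro g ⟨g', hg', hg⟩
    rw [h] at hg'
    obtain ⟨c, hc⟩ := Ideal.mem_span_singleton'.mp hg'
    refine Ideal.mem_span_singleton'.mpr ⟨⟨c, localRing_le_anLocalRing c.2⟩, Subtype.ext ?_⟩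
    rw [← hg, ← hc]
    rfl
  · rw [Ideal.span_singleton_le_iff_mem]
    refine Ideal.subset_span ⟨f, ?_, rfl⟩
    rw [h]
    exact Ideal.subset_span rfl

lemma tendsto_pull_div [FiniteDimensional ℂ V] {f : ℙ ℂ V → ℂ} (hf : IsHolomorphicAt ℓ f)
    (h0 : f ℓ = 0) (v : V) : Tendsto (fun t : ℂ => pull f (ℓ.rep + t • v) / t) (𝓝[≠] 0)
      (𝓝 (differential ℓ f v)) := by
  have h1 : HasDerivAt (fun t : ℂ => ℓ.rep + t • v) ((1 : ℂ) • v) 0 :=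
    ((hasDerivAt_id (0 : ℂ)).smul_const v).const_add _
  have h2 : HasFDerivAt (pull f) (differential ℓ f) (ℓ.rep + (0 : ℂ) • v) := by
    rw [zero_smul, add_zero]
    exact hf.differentiableAt.hasFDerivAt
  have h3 := h2.comp_hasDerivAt (0 : ℂ) h1
  rw [one_smul, hasDerivAt_iff_tendsto_slope] at h3
  refine h3.congr fun t => ?_
  simp [slope_def_field, pull_rep, h0]

lemma eventually_line {P : V → Prop} (v : V) (h : ∀ᶠ u in 𝓝 ℓ.rep, P u) :
    ∀ᶠ t : ℂ in 𝓝[≠] 0, P (ℓ.rep + t • v) := by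
  have hc : Continuous fun t : ℂ => ℓ.rep + t • v := by fun_prop
  have h1 := hc.tendsto 0
  rw [zero_smul, add_zero] at h1
  exact nhdsWithin_le_nhds (h1.eventually h)

/-- The leading terms of an equation `x z - y² = h (a d - b²)` between germs that vanish
at `ℓ`. -/
lemma differential_quadratic [FiniteDimensional ℂ V] {x y z a b d h : ℙ ℂ V → ℂ}
    (hx : IsHolomorphicAt ℓ x) (hy : IsHolomorphicAt ℓ y) (hz : IsHolomorphicAt ℓ z)
    (ha : IsHolomorphicAt ℓ a) (hb : IsHolomorphicAt ℓ b) (hd : IsHolomorphicAt ℓ d)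
    (hh : IsHolomorphicAt ℓ h) (hx0 : x ℓ = 0) (hy0 : y ℓ = 0) (hz0 : z ℓ = 0) (ha0 : a ℓ = 0)
    (hb0 : b ℓ = 0) (hd0 : d ℓ = 0)
    (heq : (x * z - y ^ 2 : ℙ ℂ V → ℂ) =ᶠ[𝓝 ℓ] h * (a * d - b ^ 2)) (v : V) :
    differential ℓ x v * differential ℓ z v - differential ℓ y v ^ 2 =
      h ℓ * (differential ℓ a v * differential ℓ d v - differential ℓ b v ^ 2) := by
  have hcont : Tendsto (fun t : ℂ => pull h (ℓ.rep + t • v)) (𝓝[≠] 0) (𝓝 (h ℓ)) := by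
    have h1 : Continuous fun t : ℂ => ℓ.rep + t • v := by fun_prop
    have h2 := h1.tendsto 0
    rw [zero_smul, add_zero] at h2
    have h3 := hh.continuousAt.tendsto.comp h2
    rw [pull_rep] at h3
    exact h3.mono_left nhdsWithin_le_nhds
  have hl := ((tendsto_pull_div hx hx0 v).mul (tendsto_pull_div hz hz0 v)).sub
    ((tendsto_pull_div hy hy0 v).pow 2)
  have hr := hcont.mul (((tendsto_pull_div ha ha0 v).mul (tendsto_pull_div hd hd0 v)).sub
    ((tendsto_pull_div hb hb0 v).pow 2))
  refine tendsto_nhds_unique_of_eventuallyEq hl hr ?_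
  have hne : ∀ᶠ u in 𝓝 ℓ.rep, u ≠ 0 := isOpen_ne.mem_nhds ℓ.rep_nonzero
  filter_upwards [eventually_line v (eventually_mk heq), eventually_line v hne,
    self_mem_nhdsWithin] with t ht hu ht0
  have h1 := ht hu
  simp only [Pi.sub_apply, Pi.mul_apply, Pi.pow_apply] at h1
  simp only [pull_of_ne hu]
  have ht0' : t ≠ 0 := ht0
  field_simp
  linear_combination h1

/-- A quadratic form of rank three is not a quadratic form in two variables. -/
lemma linearIndependent_of_quadratic {x y z a b d : V →L[ℂ] ℂ} {c : ℂ}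
    (hli : LinearIndependent ℂ ![x, y, z])
    (h : ∀ v, x v * z v - y v ^ 2 = c * (a v * d v - b v ^ 2)) :
    LinearIndependent ℂ ![a, b, d] := by
  -- the common kernel of `a, b, d` lies in the radical of the form `x z - y²`
  have hker : ∀ n, a n = 0 → b n = 0 → d n = 0 → x n = 0 ∧ y n = 0 ∧ z n = 0 := by
    intro n ha hb hd
    have h1 : ∀ v, z n * x v - 2 * y n * y v + x n * z v = 0 := by
      intro v
      have h2 := h (v + n)
      have h3 := h v
      have h4 := h n
      simp only [map_add, ha, hb, hd, add_zero] at h2 h4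
      linear_combination h2 - h3 - h4
    have h5 := Fintype.linearIndependent_iff.mp hli ![z n, -(2 * y n), x n] (by
      ext v
      have := h1 v
      simp [Fin.sum_univ_three]
      linear_combination this)
    have h6 := h5 0
    have h7 := h5 1
    have h8 := h5 2
    simp at h6 h7 h8
    exact ⟨h8, h7, h6⟩
  have hmem : ∀ φ : V →L[ℂ] ℂ, (∀ n, a n = 0 → b n = 0 → d n = 0 → φ n = 0) →
      φ ∈ Submodule.span ℂ (Set.range ![a, b, d]) := by
    intro φ hφ
    have h1 := mem_span_of_iInf_ker_le_ker (𝕜 := ℂ)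
      (L := fun i => ((![a, b, d] i : V →L[ℂ] ℂ) : V →ₗ[ℂ] ℂ)) (K := (φ : V →ₗ[ℂ] ℂ)) (by
        intro n hn
        simp only [Submodule.mem_iInf, LinearMap.mem_ker] at hn
        exact hφ n (hn 0) (hn 1) (hn 2))
    obtain ⟨g, hg⟩ := (Submodule.mem_span_range_iff_exists_fun ℂ).mp h1
    refine (Submodule.mem_span_range_iff_exists_fun ℂ).mpr ⟨g, ?_⟩
    ext v
    have := LinearMap.congr_fun hg v
    simpa using this
  have hle : Submodule.span ℂ (Set.range ![x, y, z]) ≤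
      Submodule.span ℂ (Set.range ![a, b, d]) := by
    rw [Submodule.span_le]
    rintro _ ⟨i, rfl⟩
    apply hmem
    intro n ha hb hd
    obtain ⟨h1, h2, h3⟩ := hker n ha hb hd
    fin_cases i
    exacts [h1, h2, h3]
  rw [linearIndependent_iff_card_le_finrank_span] at hli ⊢
  have : FiniteDimensional ℂ (Submodule.span ℂ (Set.range ![a, b, d])) :=
    FiniteDimensional.span_of_finite ℂ (Set.finite_range _)
  exact hli.trans (Submodule.finrank_mono hle)

end Analytic

/-! ### The hypersurface is not the whole space -/

section Global

open Filter Matrix Module exteriorPower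

variable {V : Type*} [NormedAddCommGroup V] [NormedSpace ℂ V] (vol : ⋀[ℂ]^6 V ≃ₗ[ℂ] ℂ)
  {A : Submodule ℂ (⋀[ℂ]^3 V)} {ℓ : ℙ ℂ V}

lemma Y_eq_top_of_disjoint (hV : finrank ℂ V = 6) (hA : IsLagrangian (symp vol) A)
    (h : A ⊓ F ℓ = ⊥) : Y A ℓ = ⊤ := by
  have hk : finrank ℂ ↥(A ⊓ F ℓ) = 0 := by rw [h, finrank_bot]
  obtain ⟨-, S, -, -, hreg, -, -, -, -, -, hY⟩ := exists_normal_form vol hV hA ℓ hk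
  rw [hY.self_of_nhds hreg.self_of_nhds, det_isEmpty, Ideal.span_singleton_one]

lemma nonempty_basis_of_finrank_eq {W : Type*} [AddCommGroup W] [Module ℂ W]
    [FiniteDimensional ℂ W] {L : Submodule ℂ W} {n : ℕ} (h : finrank ℂ L = n) :
    Nonempty (Basis (Fin n) ℂ L) := ⟨finBasisOfFinrankEq ℂ L h⟩

/-- If all `F_m`, `m` near `ℓ`, meet `A`, then `Y_A` is the whole space: locally its equation is
a determinant that is polynomial in `m`. -/
theorem Y_eq_bot_of_eventually (hV : finrank ℂ V = 6) (hA : IsLagrangian (symp vol) A)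
    (h : ∀ᶠ m in 𝓝 ℓ, A ⊓ F m ≠ ⊥) (m : ℙ ℂ V) : Y A m = ⊥ := by
  have : FiniteDimensional ℂ V := .of_finrank_pos (by omega)
  obtain ⟨a'⟩ := nonempty_basis_of_finrank_eq (hA.finrank_eq vol hV)
  let a : Fin 10 → ⋀[ℂ]^3 V := fun l => a' l
  have ha : Submodule.span ℂ (Set.range a) = A := by
    have h1 := Submodule.map_span A.subtype (Set.range a')
    rw [a'.span_eq, Submodule.map_top, Submodule.range_subtype, ← Set.range_comp] at h1
    exact h1.symm
  obtain ⟨b⟩ := nonempty_basis_of_finrank_eq ((F_lagrangian vol hV m).finrank_eq vol hV)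
  choose η hη using fun j => mem_F.mp (b j).2
  have hli : LinearIndependent ℂ fun j => wedge12 m.rep (η j) := by
    simp only [hη]
    exact linearIndependent_coe_basis b
  let g : V → ℂ := fun v => (Matrix.of fun j l => symp vol (wedge12 v (η j)) (a l)).det
  have hg : AnalyticOnNhd ℂ g Set.univ := by
    intro v _
    simp only [g, det_apply']
    refine Finset.analyticAt_fun_sum _ fun τ _ => analyticAt_const.mul
      (Finset.analyticAt_fun_prod _ fun i _ => ?_)
    exact (LinearMap.toContinuousLinearMap
      (pairing vol (a i) ∘ₗ wedge12.flip (η (τ i)))).analyticAt v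
  have hg0 : g =ᶠ[𝓝 ℓ.rep] 0 := by
    have hne : ∀ᶠ u in 𝓝 ℓ.rep, u ≠ 0 := isOpen_ne.mem_nhds ℓ.rep_nonzero
    filter_upwards [eventually_mk h, hne] with v hv hv0
    obtain ⟨X, hX, hX0⟩ := Submodule.exists_mem_ne_zero_of_ne_bot (hv hv0)
    have hXA := hX.1
    rw [← ha] at hXA
    obtain ⟨c, hc⟩ := (Submodule.mem_span_range_iff_exists_fun ℂ).mp hXA
    refine Matrix.exists_mulVec_eq_zero_iff.mp ⟨c, ?_, ?_⟩
    · rintro rfl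
      apply hX0
      rw [← hc]
      simp
    · funext j
      have h1 := (F_lagrangian vol hV _).apply_eq_zero (wedge12_mem_F_mk hv0 (η j)) hX.2
      rw [← hc, map_sum] at h1
      simpa [Matrix.mulVec, dotProduct, mul_comm] using h1
  have hgz : g = 0 := hg.eq_of_eventuallyEq (fun _ _ => analyticAt_const) hg0
  obtain ⟨e₀, he₀⟩ := exists_basis_zero_eq hV m.rep_nonzero
  have hx₀ : e₀.coord 0 m.rep = 1 := by simp [← he₀]
  have hs := isFrame_wedge hV (Fintype.card_fin 10) hx₀ hli
  rw [Y_eq_minorsIdeal vol hV hA hs (Equiv.refl _) ha, minorsIdeal_card (Equiv.refl _),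
    IsFrame.germEval, germMatrix_det, Ideal.span_singleton_eq_bot]
  refine germ_eq_iff (hg := isRegularAt_const m 0).mpr (Eventually.of_forall fun m' => ?_)
  have h1 : evalMatrix (fun j m' => (e₀.coord 0 m'.rep)⁻¹ • wedge12 m'.rep (η j))
      (fun l => pairing vol (a l)) m' =
      (e₀.coord 0 m'.rep)⁻¹ • Matrix.of fun j l => symp vol (wedge12 m'.rep (η j)) (a l) := by
    ext j l
    simp [evalMatrix, pairing_apply]
  change (evalMatrix _ _ m').det = 0
  rw [h1, det_smul]
  exact mul_eq_zero_of_right _ (congrFun hgz m'.rep)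

/-- Two decomposable trivectors of a Lagrangian subspace have three-dimensional subspaces that
meet. Hence not all `A ∩ F_m` are spanned by a decomposable trivector. -/
theorem exists_finrank_ne_one_or_noDecomposable (hV : finrank ℂ V = 6)
    (hA : IsLagrangian (symp vol) A) :
    ∃ m : ℙ ℂ V, finrank ℂ ↥(A ⊓ F m) ≠ 1 ∨ NoDecomposable A m := by
  have : FiniteDimensional ℂ V := .of_finrank_pos (by omega)
  by_contra! hall
  have hex : ∀ m : ℙ ℂ V, ∃ v : Fin 3 → V, LinearIndependent ℂ v ∧ ιMulti ℂ 3 v ∈ A ∧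
      ιMulti ℂ 3 v ∈ F m ∧ ιMulti ℂ 3 v ≠ 0 := by
    intro m
    have h1 := (hall m).2
    rw [NoDecomposable] at h1
    push Not at h1
    obtain ⟨x, y, hxy, hne⟩ := h1
    have hF : wedge12 m.rep (wedge11 x y) ∈ F m := mem_F.mpr ⟨_, rfl⟩
    rw [wedge12_wedge11] at hxy hne hF
    refine ⟨_, ?_, hxy, hF, hne⟩
    by_contra hli
    exact hne (ιMulti_eq_zero_of_not_linearIndependent hli)
  have hnt : Nontrivial V := nontrivial_of_finrank_pos (R := ℂ) (by omega)
  obtain ⟨w, hw⟩ := exists_ne (0 : V)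
  obtain ⟨v, hv, hvA, -, -⟩ := hex (Projectivization.mk ℂ w hw)
  obtain ⟨w', hw'⟩ : ∃ w', w' ∉ Submodule.span ℂ (Set.range v) := by
    by_contra! h1
    have h2 := finrank_range_le_card (R := ℂ) (b := v)
    rw [Set.finrank, (Submodule.eq_top_iff').mpr h1, finrank_top, hV, Fintype.card_fin] at h2
    omega
  have hw'0 : w' ≠ 0 := fun h => hw' (h ▸ zero_mem _)
  obtain ⟨u, hu, huA, huF, hu0⟩ := hex (Projectivization.mk ℂ w' hw'0)
  -- a common vector of the two subspaces
  have hdep : ¬LinearIndependent ℂ ![v 0, v 1, v 2, u 0, u 1, u 2] := by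
    intro hli
    apply volForm_ne_zero_of_linearIndependent vol hV hli
    rw [← symp_ιMulti]
    exact hA.apply_eq_zero hvA huA
  rw [Fintype.not_linearIndependent_iff] at hdep
  obtain ⟨c, hc, i₀, hi₀⟩ := hdep
  simp only [Fin.sum_univ_six] at hc
  let z := ∑ i, ![c 0, c 1, c 2] i • v i
  have hzu : z = ∑ i, ![-c 3, -c 4, -c 5] i • u i := by
    rw [← sub_eq_zero]
    simp only [z, Fin.sum_univ_three]
    rw [← hc]
    simp
    abel
  have hz0 : z ≠ 0 := by
    intro h0
    have h1 := Fintype.linearIndependent_iff.mp hv _ h0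
    have h2 := Fintype.linearIndependent_iff.mp hu _ (hzu ▸ h0)
    apply hi₀
    have h10 := h1 0
    have h11 := h1 1
    have h12 := h1 2
    have h20 := h2 0
    have h21 := h2 1
    have h22 := h2 2
    simp at h10 h11 h12 h20 h21 h22
    fin_cases i₀
    exacts [h10, h11, h12, h20, h21, h22]
  obtain ⟨r, -, hr⟩ := exists_rep_mk_eq hz0
  have hzv : z ∈ Submodule.span ℂ (Set.range v) :=
    (Submodule.mem_span_range_iff_exists_fun ℂ).mpr ⟨_, rfl⟩
  have hzu' : z ∈ Submodule.span ℂ (Set.range u) :=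
    (Submodule.mem_span_range_iff_exists_fun ℂ).mpr ⟨_, hzu.symm⟩
  have hvz : ιMulti ℂ 3 v ∈ F (Projectivization.mk ℂ z hz0) :=
    ιMulti_mem_F_of_mem_span hV (hr ▸ Submodule.smul_mem _ _ hzv)
  have huz : ιMulti ℂ 3 u ∈ F (Projectivization.mk ℂ z hz0) :=
    ιMulti_mem_F_of_mem_span hV (hr ▸ Submodule.smul_mem _ _ hzu')
  obtain ⟨t, ht⟩ := (finrank_eq_one_iff_of_nonzero'
    (⟨_, huA, huz⟩ : ↥(A ⊓ F (Projectivization.mk ℂ z hz0)))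
    (fun h => hu0 (congrArg Subtype.val h))).mp (hall _).1 ⟨_, hvA, hvz⟩
  have ht' : ιMulti ℂ 3 v = t • ιMulti ℂ 3 u := (congrArg Subtype.val ht).symm
  have h1 := mem_span_of_ιMulti_mem_F hV hv (ht' ▸ Submodule.smul_mem _ t huF)
  obtain ⟨r', hr'0, hr'⟩ := exists_rep_mk_eq hw'0
  rw [hr'] at h1
  exact hw' ((Submodule.smul_mem_iff _ hr'0).mp h1)

end Global

/-! ### The equivalence -/

section Equivalence

open Filter Module

variable {V : Type*} [NormedAddCommGroup V] [NormedSpace ℂ V] (vol : ⋀[ℂ]^6 V ≃ₗ[ℂ] ℂ)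
  {A : Submodule ℂ (⋀[ℂ]^3 V)} {ℓ : ℙ ℂ V}

/-- If `A ∩ F_ℓ` is two-dimensional without decomposable trivectors, then `Y_A` is a cone over a
conic, times a smooth germ, at `ℓ`. -/
theorem isLocallyCone_of_noDecomposable (hV : finrank ℂ V = 6) (hA : IsLagrangian (symp vol) A)
    (hk : finrank ℂ ↥(A ⊓ F ℓ) = 2) (h : NoDecomposable A ℓ) : IsLocallyCone (Y A) ℓ := by
  have : FiniteDimensional ℂ V := .of_finrank_pos (by omega)
  obtain ⟨x, y, z, hx0, hy0, hz0, hreg, -, hY, hind⟩ :=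
    exists_equations_of_finrank_two vol hV hA hk
  obtain ⟨U, hU, hUo, hℓ⟩ := eventually_nhds_iff.mp (hreg.and hY)
  refine ⟨U, hUo, hℓ, x, y, z, fun m hm => ?_, hx0, hy0, hz0, hind.mpr h, fun m hm => ?_⟩
  · obtain ⟨h1, h2, h3⟩ := (hU m hm).1
    exact ⟨h1.isHolomorphicAt, h2.isHolomorphicAt, h3.isHolomorphicAt⟩
  · obtain ⟨hr, hYm⟩ := (hU m hm).2
    have h1 := StalkIdeals.an_of_eq_span (Z := Y A) hYm
    change _ = idealGen (AnLocalRing m) {((x * z - y ^ 2 : ℙ ℂ V → ℂ) : (𝓝 m).Germ ℂ)} at h1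
    rw [h1]

/-- An analytic equation `x z - y²` for `Y_A` forces the differentials in another equation
`a d - b²` to be independent. -/
lemma linearIndependent_of_isLocallyCone (hV : finrank ℂ V = 6)
    (hcone : IsLocallyCone (Y A) ℓ) {a b d : ℙ ℂ V → ℂ} (ha : IsRegularAt ℓ a)
    (hb : IsRegularAt ℓ b) (hd : IsRegularAt ℓ d) (ha0 : a ℓ = 0) (hb0 : b ℓ = 0) (hd0 : d ℓ = 0)
    (hr : IsRegularAt ℓ (a * d - b ^ 2)) (hY : Y A ℓ = Ideal.span {germ _ hr}) :
    LinearIndependent ℂ ![differential ℓ a, differential ℓ b, differential ℓ d] := by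
  have : FiniteDimensional ℂ V := .of_finrank_pos (by omega)
  obtain ⟨U, -, hℓ, x, y, z, hol, hx0, hy0, hz0, hli, hU⟩ := hcone
  obtain ⟨hx, hy, hz⟩ := hol ℓ hℓ
  have hq : IsHolomorphicAt ℓ (x * z - y ^ 2) :=
    (holomorphicFunctions ℓ).sub_mem ((holomorphicFunctions ℓ).mul_mem hx hz)
      ((holomorphicFunctions ℓ).pow_mem hy 2)
  have h1 := hU ℓ hℓ
  rw [StalkIdeals.an_of_eq_span (Z := Y A) hY] at h1
  have h2 := idealGen_singleton (AnLocalRing ℓ) (anGerm _ hq)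
  have h3 := idealGen_singleton (AnLocalRing ℓ) (anGerm _ hr.isHolomorphicAt)
  change idealGen (AnLocalRing ℓ) {((x * z - y ^ 2 : ℙ ℂ V → ℂ) : (𝓝 ℓ).Germ ℂ)} = _ at h2
  change idealGen (AnLocalRing ℓ) {((a * d - b ^ 2 : ℙ ℂ V → ℂ) : (𝓝 ℓ).Germ ℂ)} = _ at h3
  have h4 : anGerm _ hq ∈ Ideal.span {anGerm _ hr.isHolomorphicAt} := by
    rw [← h3]
    change idealGen (AnLocalRing ℓ) {((a * d - b ^ 2 : ℙ ℂ V → ℂ) : (𝓝 ℓ).Germ ℂ)} = _ at h1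
    rw [h1, h2]
    exact Ideal.subset_span rfl
  obtain ⟨⟨_, g, hg, rfl⟩, hc⟩ := Ideal.mem_span_singleton'.mp h4
  have heq : (x * z - y ^ 2 : ℙ ℂ V → ℂ) =ᶠ[𝓝 ℓ] g * (a * d - b ^ 2) :=
    Germ.coe_eq.mp (congrArg Subtype.val hc).symm
  exact linearIndependent_of_quadratic hli (differential_quadratic hx hy hz ha.isHolomorphicAt
    hb.isHolomorphicAt hd.isHolomorphicAt hg hx0 hy0 hz0 ha0 hb0 hd0 heq)

lemma not_isLocallyCone_of_eq_bot (hV : finrank ℂ V = 6) (h : Y A ℓ = ⊥) :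
    ¬IsLocallyCone (Y A) ℓ := by
  intro hcone
  have h0 : IsRegularAt ℓ (fun _ : ℙ ℂ V => (0 : ℂ)) := isRegularAt_const ℓ 0
  have hr : IsRegularAt ℓ ((fun _ : ℙ ℂ V => (0 : ℂ)) * (fun _ => 0) - (fun _ => 0) ^ 2) :=
    (regularFunctions ℓ).sub_mem ((regularFunctions ℓ).mul_mem h0 h0)
      ((regularFunctions ℓ).pow_mem h0 2)
  have h1 := linearIndependent_of_isLocallyCone hV hcone h0 h0 h0 rfl rfl rfl hr (by
    rw [h, eq_comm, Ideal.span_singleton_eq_bot]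
    refine germ_eq_iff (hg := h0).mpr (Eventually.of_forall fun m => ?_)
    simp)
  exact h1.ne_zero 0 (differential_const ℓ 0)

lemma noDecomposable_of_isLocallyCone (hV : finrank ℂ V = 6) (hA : IsLagrangian (symp vol) A)
    (hk : finrank ℂ ↥(A ⊓ F ℓ) = 2) (h : IsLocallyCone (Y A) ℓ) : NoDecomposable A ℓ := by
  obtain ⟨x, y, z, hx0, hy0, hz0, hreg, -, hY, hind⟩ :=
    exists_equations_of_finrank_two vol hV hA hk
  obtain ⟨hx, hy, hz⟩ := hreg.self_of_nhds
  obtain ⟨hr, hYℓ⟩ := hY.self_of_nhds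
  exact hind.mp (linearIndependent_of_isLocallyCone hV h hx hy hz hx0 hy0 hz0 hr hYℓ)

lemma Y_ne_top_of_finrank_one (hV : finrank ℂ V = 6) (hA : IsLagrangian (symp vol) A)
    (hk : finrank ℂ ↥(A ⊓ F ℓ) = 1) : Y A ℓ ≠ ⊤ := by
  have : FiniteDimensional ℂ V := .of_finrank_pos (by omega)
  obtain ⟨f, hf0, -, hY, -, -⟩ := exists_equation_of_finrank_one vol hV hA hk
  rw [hY, ne_top_iff_germValue]
  intro x hx
  exact (germDifferential_mem_span (S := {f}) (by rintro _ rfl; exact hf0) hx).1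

/-- If `Y_A ∖ W_A` is smooth and `Y_A` is a cone along `W_A`, then `A` contains no decomposable
trivector. -/
theorem noDecomposable_of_smooth_of_cone (hV : finrank ℂ V = 6) (hA : IsLagrangian (symp vol) A)
    (h2 : ∀ ℓ : ℙ ℂ V, finrank ℂ ↥(A ⊓ F ℓ) ≤ 2)
    (hsmooth : ∀ ℓ ∈ (Y A).supp \ (W vol A).supp, (Y A).SmoothAt ℓ)
    (hcone : ∀ ℓ₀ ∈ (W vol A).supp, IsLocallyCone (Y A) ℓ₀) (ℓ : ℙ ℂ V) : NoDecomposable A ℓ := by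
  have : FiniteDimensional ℂ V := .of_finrank_pos (by omega)
  have hW : ∀ m, m ∈ (W vol A).supp ↔ finrank ℂ ↥(A ⊓ F m) = 2 := fun m =>
    (D_ne_top_iff vol hV hA 2).trans ⟨fun h => le_antisymm (h2 m) h, fun h => h.ge⟩
  have hcases : finrank ℂ ↥(A ⊓ F ℓ) = 0 ∨ finrank ℂ ↥(A ⊓ F ℓ) = 1 ∨
      finrank ℂ ↥(A ⊓ F ℓ) = 2 := by
    have := h2 ℓ
    omega
  rcases hcases with hk | hk | hk
  · intro x y hxy
    have h1 : wedge12 ℓ.rep (wedge11 x y) ∈ A ⊓ F ℓ := ⟨hxy, mem_F.mpr ⟨_, rfl⟩⟩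
    rwa [Submodule.finrank_eq_zero.mp hk] at h1
  · obtain ⟨f, hf0, -, hY, hdf, hfY⟩ := exists_equation_of_finrank_one vol hV hA hk
    by_contra hno
    have hdf0 : germDifferential ℓ f = 0 := by
      by_contra h
      exact hno (hdf.mp h)
    have hs := hsmooth ℓ ⟨Y_ne_top_of_finrank_one vol hV hA hk, fun h => by
      rw [hW, hk] at h
      omega⟩
    rw [StalkIdeals.SmoothAt, hY] at hs
    have hY0 := hfY (eq_zero_of_isRegularLocalRing_quotient hV hf0 hdf0 hs)
    -- the equation of `Y_A` vanishes near `ℓ`, hence everywhere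
    have hbot := Y_eq_bot_of_eventually vol hV hA (ℓ := ℓ) (by
      filter_upwards [hY0] with m hm hdis
      rw [Y_eq_top_of_disjoint vol hV hA hdis] at hm
      exact top_ne_bot hm)
    have hone : ∀ m : ℙ ℂ V, finrank ℂ ↥(A ⊓ F m) = 1 := by
      intro m
      have h3 : finrank ℂ ↥(A ⊓ F m) ≠ 0 := by
        intro h
        have h4 := Y_eq_top_of_disjoint vol hV hA (Submodule.finrank_eq_zero.mp h)
        exact bot_ne_top ((hbot m).symm.trans h4)
      have h5 : finrank ℂ ↥(A ⊓ F m) ≠ 2 := fun h =>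
        not_isLocallyCone_of_eq_bot hV (hbot m) (hcone m ((hW m).mpr h))
      have := h2 m
      omega
    obtain ⟨m, hm | hm⟩ := exists_finrank_ne_one_or_noDecomposable vol hV hA
    · exact hm (hone m)
    · obtain ⟨g, -, -, hYg, hdg, -⟩ := exists_equation_of_finrank_one vol hV hA (hone m)
      have hg : g = 0 := by
        rw [hbot m, eq_comm, Ideal.span_singleton_eq_bot] at hYg
        exact hYg
      exact hdg.mpr hm (hg ▸ germDifferential_zero m)
  · exact noDecomposable_of_isLocallyCone vol hV hA hk (hcone ℓ ((hW ℓ).mpr hk))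

end Equivalence

end EPW

end

theorem proposition2p7 {V : Type*} [NormedAddCommGroup V] [NormedSpace ℂ V]
    (hV : Module.finrank ℂ V = 6) (vol : ⋀[ℂ]^6 V ≃ₗ[ℂ] ℂ)
    (A : Submodule ℂ (⋀[ℂ]^3 V)) (hA : A ∈ EPW.LGtimes vol) :
    List.TFAE [
      A ∈ EPW.LGzero vol,
      ∀ i : ℕ, ∀ ℓ ∈ (EPW.D vol A i).supp \ (EPW.D vol A (i + 1)).supp,
        (EPW.D vol A i).SmoothAt ℓ ∧ (EPW.D vol A i).CodimAt ℓ (i * (i + 1) / 2),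
      (∀ ℓ ∈ (EPW.Y A).supp \ (EPW.W vol A).supp, (EPW.Y A).SmoothAt ℓ) ∧
        ∀ ℓ₀ ∈ (EPW.W vol A).supp, EPW.IsLocallyCone (EPW.Y A) ℓ₀] := by
  have hL : EPW.IsLagrangian (EPW.symp vol) A := hA.1
  have h1 : A ∈ EPW.LGzero vol ↔ ∀ ℓ, EPW.NoDecomposable A ℓ :=
    (and_iff_right hA).trans EPW.forall_noDecomposable_iff.symm
  have hstratum : ∀ i ℓ, ℓ ∈ (EPW.D vol A i).supp \ (EPW.D vol A (i + 1)).supp ↔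
      Module.finrank ℂ ↥(A ⊓ EPW.F ℓ) = i := by
    intro i ℓ
    change EPW.D vol A i ℓ ≠ ⊤ ∧ ¬EPW.D vol A (i + 1) ℓ ≠ ⊤ ↔ _
    rw [EPW.D_ne_top_iff vol hV hL, EPW.D_ne_top_iff vol hV hL]
    omega
  tfae_have 1 ↔ 2 := by
    rw [h1]
    constructor
    · intro h i ℓ hℓ
      have hk := (hstratum i ℓ).mp hℓ
      exact (EPW.smooth_stratum_iff vol hV hL hk (hk ▸ hA.2 ℓ)).mpr (h ℓ)
    · intro h ℓ
      exact (EPW.smooth_stratum_iff vol hV hL rfl (hA.2 ℓ)).mp (h _ ℓ ((hstratum _ ℓ).mpr rfl))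
  tfae_have 1 → 3 := by
    rw [h1]
    refine fun h => ⟨fun ℓ hℓ => ?_, fun ℓ hℓ => ?_⟩
    · have hk2 : ¬2 ≤ Module.finrank ℂ ↥(A ⊓ EPW.F ℓ) := fun hle =>
        hℓ.2 ((EPW.D_ne_top_iff vol hV hL 2).mpr hle)
      have hk0 : Module.finrank ℂ ↥(A ⊓ EPW.F ℓ) ≠ 0 := by
        have : FiniteDimensional ℂ V := .of_finrank_pos (by omega)
        exact fun h0 =>
          hℓ.1 (EPW.Y_eq_top_of_disjoint vol hV hL (Submodule.finrank_eq_zero.mp h0))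
      have hk : Module.finrank ℂ ↥(A ⊓ EPW.F ℓ) = 1 := by omega
      obtain ⟨f, -, hD, hY, -, -⟩ := EPW.exists_equation_of_finrank_one vol hV hL hk
      have hs := ((EPW.smooth_stratum_iff vol hV hL hk one_le_two).mpr (h ℓ)).1
      rw [EPW.StalkIdeals.SmoothAt, hD] at hs
      rwa [EPW.StalkIdeals.SmoothAt, hY]
    · have hk := le_antisymm (hA.2 ℓ) ((EPW.D_ne_top_iff vol hV hL 2).mp hℓ)
      exact EPW.isLocallyCone_of_noDecomposable vol hV hL hk (h ℓ)
  tfae_have 3 → 1 := by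
    rw [h1]
    exact fun h => EPW.noDecomposable_of_smooth_of_cone vol hV hL hA.2 h.1 h.2
  tfae_finish
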